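/- Let $\mathcal M\subset\mathbb R^3$ be a compact, connected, smooth embedded submanifold without boundary, and let $f:\mathbb R^3\times\mathbb R^{3\times3}\to\mathbb R$ be a Carathéodory function such that, writing $x=(x_\alpha,x_3)\in\mathbb R^2\times\mathbb R$ and $|\xi|$ for the Euclidean norm of a matrix: - $f(x_\alpha+e_i,x_3,\xi)=f(x_\alpha,x_3,\xi)$ for $i=1,2$ and all $x,\xi$; - there are $\alpha,\beta>0$ with $\alpha|\xi|\le f(x,\xi)\le\beta(1+|\xi|)$ for a.e. $x$ and all $\xi$; - there is $L>0$ with $|f(x,\xi)-f(x,\eta)|\le L|\xi-\eta|$ for a.e. $x$ and all $\xi,\eta$; - there are $C>0$ and $0<q<1$ with $|f(x,\xi)-f^\infty(x,\xi)|\le C(1+|\xi|^{1-q})$ for a.e. $x$ and all $\xi$, where $f^\infty(x,\xi):=\limsup_{t\to+\infty}f(x,t\xi)/t$. For $\nu\in\mathbb S^1\subset\mathbb R^2$ let $Q_\nu\subset\mathbb R^2$ be the open unit square centred at the origin with two sides orthogonal to $\nu$. For $a,b\in\mathcal M$ and $t>0$ let $\mathcal A_t(a,b,\nu)$ be the set of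 all $\phi\in W^{1,1}(tQ_\nu\times(-\tfrac12,\tfrac12);\mathcal M)$ whose trace on $\partial(tQ_\nu)\times(-\tfrac12,\tfrac12)$ equals $a$ where $x_\alpha\cdot\nu>0$ and $b$ where $x_\alpha\cdot\nu<0$. Then $\mathcal A_t(a,b,\nu)\ne\emptyset$ for all $t>0$, and the limit $$\theta(a,b,\nu):=\lim_{t\to+\infty}\ \inf_{\phi\in\mathcal A_t(a,b,\nu)}\ \frac1t\int_{tQ_\nu\times(-\frac12,\frac12)}f^\infty(x,\nabla\phi)\,dx$$ exists and is finite for all $a,b\in\mathcal M$, $\nu\in\mathbb S^1$. The function $\theta$ is continuous on $\mathcal M\times\mathcal M\times\mathbb S^1$, and there exist constants $C_1,C_2>0$ such that $$|\theta(a_1,b_1,\nu)-\theta(a_2,b_2,\nu)|\le C_1\big(|a_1-a_2|+|b_1-b_2|\big),\qquad \theta(a_1,b_1,\nu)\le C_2|a_1-b_1|$$ for all $a_1,b_1,a_2,b_2\in\mathcal M$ and $\nu\in\mathbb S^1$. -/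

import Mathlib

open MeasureTheory Filter Topology
open scoped ContDiff

noncomputable section

namespace ThinFilm

/-- The Euclidean plane. -/
abbrev E2 := EuclideanSpace ℝ (Fin 2)

/-- Euclidean three-space; the planar variable is `(x 0, x 1)`, the transversal one is `x 2`. -/
abbrev E3 := EuclideanSpace ℝ (Fin 3)

/-- Real `3 × 3` matrices. -/
abbrev Mat3 := Matrix (Fin 3) (Fin 3) ℝ

/-- The Euclidean (Frobenius) norm `|ξ|` of a matrix. -/
def matNorm (ξ : Mat3) : ℝ := Real.sqrt (∑ i, ∑ j, ξ i j ^ 2)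

/-! ### The target manifold -/

/-- `M` is a smooth embedded submanifold without boundary of three-space, of some dimension `d`:
near each of its points a smooth diffeomorphism between open sets of three-space straightens `M`
to the coordinate `d`-plane. -/
def IsSmoothSubmanifold (M : Set E3) : Prop :=
  ∃ d : ℕ, d ≤ 3 ∧ ∀ p ∈ M, ∃ e : OpenPartialHomeomorph E3 E3,
    p ∈ e.source ∧ ContDiffOn ℝ ∞ e e.source ∧ ContDiffOn ℝ ∞ e.symm e.target ∧
      ∀ x ∈ e.source, x ∈ M ↔ ∀ i : Fin 3, d ≤ (i : ℕ) → e x i = 0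

/-! ### The integrand -/

/-- Carathéodory integrands: Lebesgue measurable in the first variable,
continuous in the second one. -/
def IsCaratheodory (f : E3 → Mat3 → ℝ) : Prop :=
  (∀ ξ, AEMeasurable (fun x => f x ξ) volume) ∧ ∀ᵐ x, Continuous (f x)

/-- `1`-periodicity in the two planar variables. -/
def IsPlanarPeriodic (f : E3 → Mat3 → ℝ) : Prop :=
  ∀ x ξ, f (x + EuclideanSpace.single 0 1) ξ = f x ξ ∧ f (x + EuclideanSpace.single 1 1) ξ = f x ξ

/-- Linear growth and coercivity. -/
def HasLinearGrowth (f : E3 → Mat3 → ℝ) : Prop :=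
  ∃ α β : ℝ, 0 < α ∧ 0 < β ∧
    ∀ᵐ x, ∀ ξ, α * matNorm ξ ≤ f x ξ ∧ f x ξ ≤ β * (1 + matNorm ξ)

/-- Lipschitz continuity in the second variable, uniformly in the first one. -/
def IsUniformlyLipschitz (f : E3 → Mat3 → ℝ) : Prop :=
  ∃ L : ℝ, 0 < L ∧ ∀ᵐ x, ∀ ξ η, |f x ξ - f x η| ≤ L * matNorm (ξ - η)

/-- The recession function `f^∞(x, ξ) = limsup_{t → +∞} f(x, t ξ) / t`. -/
def recession (f : E3 → Mat3 → ℝ) (x : E3) (ξ : Mat3) : ℝ :=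
  limsup (fun t : ℝ => f x (t • ξ) / t) atTop

/-- Rate of convergence to the recession function. -/
def HasRecessionRate (f : E3 → Mat3 → ℝ) : Prop :=
  ∃ C q : ℝ, 0 < C ∧ 0 < q ∧ q < 1 ∧
    ∀ᵐ x, ∀ ξ, |f x ξ - recession f x ξ| ≤ C * (1 + matNorm ξ ^ (1 - q))

/-! ### The cylinder over a rotated square -/

/-- The point of three-space whose planar part is `p ν + s ν^⊥`, with `ν^⊥ = (-ν₂, ν₁)`,
and whose transversal coordinate is `z`. -/
def framePoint (ν : E2) (p s z : ℝ) : E3 :=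
  !₂[p * ν 0 - s * ν 1, p * ν 1 + s * ν 0, z]

/-- `x_α · ν`. -/
def coordNormal (ν : E2) (x : E3) : ℝ := x 0 * ν 0 + x 1 * ν 1

/-- `x_α · ν^⊥`, with `ν^⊥ = (-ν₂, ν₁)`. -/
def coordTangent (ν : E2) (x : E3) : ℝ := x 1 * ν 0 - x 0 * ν 1

/-- The cylinder `(t Q_ν) × (-1/2, 1/2)`, where `Q_ν` is the open unit square centred at the
origin with sides orthogonal and parallel to the unit vector `ν`. -/
def cylinder (ν : E2) (t : ℝ) : Set E3 :=
  {x | |coordNormal ν x| < t / 2 ∧ |coordTangent ν x| < t / 2 ∧ |x 2| < 1 / 2}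

/-- The surface integral over the lateral boundary `∂(t Q_ν) × (-1/2, 1/2)` of
`x ↦ F x n(x)`, where `n` is the outer unit normal. -/
def lateralIntegral (ν : E2) (t : ℝ) (F : E3 → E3 → ℝ) : ℝ :=
  ∫ s in (-(t / 2))..(t / 2), ∫ z in (-(1 / 2) : ℝ)..(1 / 2),
    (F (framePoint ν (t / 2) s z) (framePoint ν 1 0 0)
      + F (framePoint ν (-(t / 2)) s z) (framePoint ν (-1) 0 0)
      + F (framePoint ν s (t / 2) z) (framePoint ν 0 1 0)
      + F (framePoint ν s (-(t / 2)) z) (framePoint ν 0 (-1) 0))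

/-! ### Sobolev maps -/

/-- Smooth real test functions with compact support contained in `U`. -/
def IsTestFunction (U : Set E3) (ψ : E3 → ℝ) : Prop :=
  ContDiff ℝ ∞ ψ ∧ HasCompactSupport ψ ∧ tsupport ψ ⊆ U

/-- The `j`-th partial derivative. -/
def partialDeriv (j : Fin 3) (ψ : E3 → ℝ) (x : E3) : ℝ :=
  fderiv ℝ ψ x (EuclideanSpace.single j 1)

/-- `φ ∈ W^{1,1}(U; M)` with weak gradient `G`, where `G x i j = ∂_j φ_i (x)`. -/
structure IsSobolevMap (U : Set E3) (M : Set E3) (φ : E3 → E3) (G : E3 → Mat3) : Prop where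
  integrable : IntegrableOn φ U
  integrable_grad : ∀ i j, IntegrableOn (fun x => G x i j) U
  weak_grad : ∀ ψ, IsTestFunction U ψ → ∀ i j,
    ∫ x in U, φ x i * partialDeriv j ψ x = - ∫ x in U, G x i j * ψ x
  mem : ∀ᵐ x ∂(volume.restrict U), φ x ∈ M

/-- The map `φ ∈ W^{1,1}((t Q_ν) × (-1/2, 1/2); ℝ³)`, with weak gradient `G`, has trace `g` on the
lateral boundary `∂(t Q_ν) × (-1/2, 1/2)`: the Gauss-Green formula holds with boundary values `g`
for all smooth test functions vanishing near the top and the bottom of the cylinder (but not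
necessarily on the lateral boundary). -/
def HasLateralTrace (ν : E2) (t : ℝ) (φ : E3 → E3) (G : E3 → Mat3) (g : E3 → E3) : Prop :=
  ∀ ψ, IsTestFunction {x | |x 2| < 1 / 2} ψ → ∀ i j,
    ∫ x in cylinder ν t, (φ x i * partialDeriv j ψ x + G x i j * ψ x)
      = lateralIntegral ν t (fun x n => g x i * ψ x * n j)

/-! ### The jump density -/

/-- The boundary datum: `a` where `x_α · ν > 0`, and `b` elsewhere. -/
def jumpDatum (a b : E3) (ν : E2) (x : E3) : E3 :=
  if 0 < coordNormal ν x then a else b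

/-- The admissible maps (with their weak gradients) of the minimum problem
on `(t Q_ν) × (-1/2, 1/2)`. -/
def admissible (M : Set E3) (a b : E3) (ν : E2) (t : ℝ) : Set ((E3 → E3) × (E3 → Mat3)) :=
  {u | IsSobolevMap (cylinder ν t) M u.1 u.2 ∧
    HasLateralTrace ν t u.1 u.2 (jumpDatum a b ν)}

/-- The rescaled energy `(1/t) ∫_{(t Q_ν) × (-1/2, 1/2)} f^∞(x, G(x)) dx`. -/
def cellEnergy (f : E3 → Mat3 → ℝ) (ν : E2) (t : ℝ) (G : E3 → Mat3) : ℝ :=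
  1 / t * ∫ x in cylinder ν t, recession f x (G x)

/-- The infimum of the rescaled energy at scale `t`. -/
def cellInf (f : E3 → Mat3 → ℝ) (M : Set E3) (a b : E3) (ν : E2) (t : ℝ) : ℝ :=
  sInf ((fun u => cellEnergy f ν t u.2) '' admissible M a b ν t)

/-- The jump density `θ(a, b, ν)`: the limit of the infima as `t → +∞`. -/
def theta (f : E3 → Mat3 → ℝ) (M : Set E3) (a b : E3) (ν : E2) : ℝ :=
  limUnder atTop (fun t : ℝ => cellInf f M a b ν t)

end ThinFilm

end

open ThinFilm

/-!
The cell problems at different scales, for different boundary values and in different directions are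
compared by one construction, and the theorem is read off from the resulting inequality.

*Tiling.* Let `ν`, `ν'` be unit vectors at an angle of order `δ`, and let `u` be admissible for
`(a₂, b₂, ν)` on the cell of size `t`. On the line orthogonal to `ν'` one places about `T / t`
points, rounds them to integer points, and copies `u` into the cells of size `t` and normal `ν`
centred there. The recession function is periodic, hence each copy costs the same, and the copies
together contribute at most `T` times the rescaled energy of `u`. Outside of the copies the
competitor is an explicit map: it jumps from `b₂` to `a₂` across a graph through all small cells,
and this jump sits between two further transitions, from `b₁` to `b₂` and from `a₂` to `a₁`. The
graph ends in the middles of the faces of the large cell, where all transitions shrink to a point,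
so that the boundary values are exactly those of the large cell. Likewise the jump sharpens to a
point at the ends of each small cell, so that the boundary values there are those of `u`.

*Cost.* A transition from `a` to `b` runs along a curve in `M` of length at most `K |a - b|`; such
curves exist for every pair of points, with one constant `K`, as `M` is compact, connected and
smooth (`exists_uniform_lipJoined`). Whatever the width of the layer, the gradient integrates across
it to a multiple of the length of the curve (`lintegral_transitionSlope_le`), so that the layer may
shrink to a point without loss. The energy outside of the copies is therefore proportional to the
length `T (6 δ + 15 / t) + 5 t` of the graph outside of the small cells, for the middle transition,
and to `T` for the two others. This gives `cellInf_le_cellInf_add`.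

*Consequences.* For `ν = ν'` and equal boundary values the inequality says that the infima decrease
up to an error that vanishes as `T → ∞` and then `t → ∞`, so they converge. In the limit it bounds
the difference of two values of `θ` by a multiple of `|a₂ - b₂| δ + |a₁ - a₂| + |b₁ - b₂|`
(`theta_le_theta_add`), which contains the continuity and the Lipschitz estimate; the linear bound
follows from a single transition along a straight interface.

*Traces.* All maps constructed by hand depend on the planar variables only and are locally Lipschitz
off finitely many vertical lines. For these the Gauss-Green formula holds on cylinders
(`gaussGreen_cylinder`), by integration along almost every line. Copying `u` is justified by the
weak form of the trace condition alone (`IsPacking.hasLateralTrace_patch`): maps with equal traces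
may be exchanged, and a map with a lateral trace has a weak gradient (`HasLateralTrace.weak_grad`).
-/

namespace ThinFilm

open scoped NNReal ENNReal

/-! ### Frame coordinates -/

theorem sq_add_sq_of_norm_eq_one {ν : E2} (hν : ‖ν‖ = 1) : ν 0 ^ 2 + ν 1 ^ 2 = 1 := by
  have h := EuclideanSpace.norm_sq_eq ν
  simp only [Fin.sum_univ_two, Real.norm_eq_abs, sq_abs, hν] at h
  linarith

@[simp] theorem framePoint_apply_zero (ν : E2) (p s z : ℝ) :
    framePoint ν p s z 0 = p * ν 0 - s * ν 1 := by simp [framePoint]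

@[simp] theorem framePoint_apply_one (ν : E2) (p s z : ℝ) :
    framePoint ν p s z 1 = p * ν 1 + s * ν 0 := by simp [framePoint]

@[simp] theorem framePoint_apply_two (ν : E2) (p s z : ℝ) :
    framePoint ν p s z 2 = z := by simp [framePoint]

theorem coordNormal_framePoint {ν : E2} (hν : ‖ν‖ = 1) (p s z : ℝ) :
    coordNormal ν (framePoint ν p s z) = p := by
  have := sq_add_sq_of_norm_eq_one hν
  simp only [coordNormal, framePoint_apply_zero, framePoint_apply_one]
  linear_combination p * this

theorem coordTangent_framePoint {ν : E2} (hν : ‖ν‖ = 1) (p s z : ℝ) :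
    coordTangent ν (framePoint ν p s z) = s := by
  have := sq_add_sq_of_norm_eq_one hν
  simp only [coordTangent, framePoint_apply_zero, framePoint_apply_one]
  linear_combination s * this

theorem framePoint_coord {ν : E2} (hν : ‖ν‖ = 1) (x : E3) :
    framePoint ν (coordNormal ν x) (coordTangent ν x) (x 2) = x := by
  have := sq_add_sq_of_norm_eq_one hν
  ext i
  fin_cases i
  · simp only [Fin.zero_eta, framePoint_apply_zero, coordNormal, coordTangent]
    linear_combination x 0 * this
  · simp only [Fin.mk_one, framePoint_apply_one, coordNormal, coordTangent]
    linear_combination x 1 * this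
  · exact framePoint_apply_two ..

theorem continuous_coordNormal (ν : E2) : Continuous (coordNormal ν) := by
  unfold coordNormal; fun_prop

theorem continuous_coordTangent (ν : E2) : Continuous (coordTangent ν) := by
  unfold coordTangent; fun_prop

theorem continuous_framePoint (ν : E2) :
    Continuous fun q : ℝ × ℝ × ℝ => framePoint ν q.1 q.2.1 q.2.2 := by
  refine (PiLp.continuous_toLp 2 _).comp (continuous_pi fun i => ?_)
  fin_cases i <;> simp <;> fun_prop

/-- Frame coordinates of three-space: normal, tangential and transversal coordinate. -/
def frameHomeomorph (ν : E2) (hν : ‖ν‖ = 1) : ℝ × ℝ × ℝ ≃ₜ E3 where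
  toFun q := framePoint ν q.1 q.2.1 q.2.2
  invFun x := (coordNormal ν x, coordTangent ν x, x 2)
  left_inv q := by
    simp [coordNormal_framePoint hν, coordTangent_framePoint hν]
  right_inv x := framePoint_coord hν x
  continuous_toFun := continuous_framePoint ν
  continuous_invFun := by
    have := continuous_coordNormal ν
    have := continuous_coordTangent ν
    fun_prop

/-- The rotation of three-space that carries the standard frame to the frame of `ν`. -/
def frameRotation (ν : E2) (hν : ‖ν‖ = 1) : E3 →ₗᵢ[ℝ] E3 where
  toFun x := framePoint ν (x 0) (x 1) (x 2)
  map_add' x y := by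
    ext i; fin_cases i <;> simp <;> ring
  map_smul' c x := by
    ext i; fin_cases i <;> simp <;> ring
  norm_map' x := by
    have := sq_add_sq_of_norm_eq_one hν
    have h : ‖framePoint ν (x 0) (x 1) (x 2)‖ ^ 2 = ‖x‖ ^ 2 := by
      simp only [EuclideanSpace.norm_sq_eq, Fin.sum_univ_three, Real.norm_eq_abs, sq_abs,
        framePoint_apply_zero, framePoint_apply_one, framePoint_apply_two]
      linear_combination (x 0 ^ 2 + x 1 ^ 2) * this
    simpa using (sq_eq_sq₀ (norm_nonneg _) (norm_nonneg _)).1 h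

theorem measurePreserving_framePoint {ν : E2} (hν : ‖ν‖ = 1) :
    MeasurePreserving (fun q : ℝ × ℝ × ℝ => framePoint ν q.1 q.2.1 q.2.2) volume volume := by
  have h1 : MeasurePreserving (MeasurableEquiv.piFinSuccAbove (fun _ : Fin 3 => ℝ) 0) volume
      volume := volume_preserving_piFinSuccAbove (fun _ : Fin 3 => ℝ) 0
  have h2 : MeasurePreserving (MeasurableEquiv.finTwoArrow (α := ℝ)) volume volume :=
    volume_preserving_finTwoArrow ℝ
  have h3 := (MeasurePreserving.id (volume : Measure ℝ)).prod (h2.symm)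
  have h4 := h1.symm.comp h3
  have h5 := (EuclideanSpace.volume_preserving_symm_measurableEquiv_toLp (Fin 3)).symm
  have h6 := ((frameRotation ν hν).toLinearIsometryEquiv rfl).measurePreserving
  have h7 := (h6.comp h5).comp h4
  have e : (fun q : ℝ × ℝ × ℝ => framePoint ν q.1 q.2.1 q.2.2) =
      (⇑((frameRotation ν hν).toLinearIsometryEquiv rfl) ∘
        ⇑(MeasurableEquiv.toLp 2 (Fin 3 → ℝ)).symm.symm) ∘
      ⇑(MeasurableEquiv.piFinSuccAbove (fun _ : Fin 3 => ℝ) 0).symm ∘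
        Prod.map id ⇑MeasurableEquiv.finTwoArrow.symm := by
    ext q i
    rfl
  rw [e]
  exact h7

theorem frameHomeomorph_measurableEmbedding {ν : E2} (hν : ‖ν‖ = 1) :
    MeasurableEmbedding (fun q : ℝ × ℝ × ℝ => framePoint ν q.1 q.2.1 q.2.2) :=
  (frameHomeomorph ν hν).measurableEmbedding

theorem framePoint_mem_cylinder {ν : E2} (hν : ‖ν‖ = 1) {t : ℝ} (p s z : ℝ) :
    framePoint ν p s z ∈ cylinder ν t ↔
      p ∈ Set.Ioo (-(t / 2)) (t / 2) ∧ s ∈ Set.Ioo (-(t / 2)) (t / 2) ∧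
        z ∈ Set.Ioo (-(1 / 2) : ℝ) (1 / 2) := by
  simp only [cylinder, Set.mem_ofPred_eq, coordNormal_framePoint hν, coordTangent_framePoint hν,
    framePoint_apply_two, abs_lt, Set.mem_Ioo]

theorem isOpen_cylinder (ν : E2) (t : ℝ) : IsOpen (cylinder ν t) := by
  have h1 := continuous_coordNormal ν
  have h2 := continuous_coordTangent ν
  exact (isOpen_lt h1.abs continuous_const).inter
    ((isOpen_lt h2.abs continuous_const).inter
      (isOpen_lt (by fun_prop : Continuous fun x : E3 => |x 2|) continuous_const))

theorem framePoint_preimage_cylinder {ν : E2} (hν : ‖ν‖ = 1) (t : ℝ) :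
    (fun q : ℝ × ℝ × ℝ => framePoint ν q.1 q.2.1 q.2.2) ⁻¹' cylinder ν t =
      Set.Ioo (-(t / 2)) (t / 2) ×ˢ Set.Ioo (-(t / 2)) (t / 2) ×ˢ
        Set.Ioo (-(1 / 2) : ℝ) (1 / 2) := by
  ext ⟨p, s, z⟩
  simp only [Set.mem_preimage, framePoint_mem_cylinder hν, Set.mem_prod]

theorem setIntegral_cylinder {ν : E2} (hν : ‖ν‖ = 1) (t : ℝ) (H : E3 → ℝ) :
    ∫ x in cylinder ν t, H x =
      ∫ q in Set.Ioo (-(t / 2)) (t / 2) ×ˢ Set.Ioo (-(t / 2)) (t / 2) ×ˢ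
        Set.Ioo (-(1 / 2) : ℝ) (1 / 2), H (framePoint ν q.1 q.2.1 q.2.2) := by
  rw [← framePoint_preimage_cylinder hν, (measurePreserving_framePoint hν).setIntegral_preimage_emb
    (frameHomeomorph_measurableEmbedding hν)]

theorem integrableOn_cylinder_iff {ν : E2} (hν : ‖ν‖ = 1) (t : ℝ) (H : E3 → ℝ) :
    IntegrableOn (fun q : ℝ × ℝ × ℝ => H (framePoint ν q.1 q.2.1 q.2.2))
      (Set.Ioo (-(t / 2)) (t / 2) ×ˢ Set.Ioo (-(t / 2)) (t / 2) ×ˢ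
        Set.Ioo (-(1 / 2) : ℝ) (1 / 2)) ↔ IntegrableOn H (cylinder ν t) := by
  rw [← framePoint_preimage_cylinder hν]
  exact (measurePreserving_framePoint hν).integrableOn_comp_preimage
    (frameHomeomorph_measurableEmbedding hν)

/-! ### Functions that are Lipschitz near a point -/

/-- `w` is Lipschitz with constant `C` in some neighbourhood of `x`. -/
def LipAt {E F : Type*} [PseudoMetricSpace E] [PseudoMetricSpace F] (C : ℝ≥0) (w : E → F)
    (x : E) : Prop :=
  ∃ N ∈ 𝓝 x, LipschitzOnWith C w N

/-- A local form of Rademacher's theorem. -/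
theorem ae_differentiableAt_of_lipAt {F : E3 → ℝ} {S : Set E3}
    (hS : ∀ x ∉ S, ∃ C, LipAt C F x) : ∀ᵐ x, x ∉ S → DifferentiableAt ℝ F x := by
  rw [ae_iff]
  refine measure_null_of_locally_null _ fun x hx => ?_
  simp only [Classical.not_imp] at hx
  obtain ⟨C, N, hN, hF⟩ := hS x hx.1
  refine ⟨{y | y ∈ interior N ∧ ¬ DifferentiableAt ℝ F y}, ?_, ?_⟩
  · filter_upwards [self_mem_nhdsWithin, mem_nhdsWithin_of_mem_nhds (interior_mem_nhds.2 hN)]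
      with y hy hyN
    simp only [Classical.not_imp] at hy
    exact ⟨hyN, hy.2⟩
  · have h := hF.ae_differentiableWithinAt_of_mem (μ := volume)
    rw [ae_iff] at h
    refine measure_mono_null ?_ h
    intro y hy hy'
    exact hy.2 ((hy' (interior_subset hy.1)).differentiableAt (mem_interior_iff_mem_nhds.1 hy.1))

theorem LipAt.comp_lipschitz {E F G : Type*} [PseudoMetricSpace E] [PseudoMetricSpace F]
    [PseudoMetricSpace G] {C K : ℝ≥0} {w : F → G} {g : E → F} {x : E} (hw : LipAt C w (g x))
    (hg : LipschitzWith K g) : LipAt (C * K) (w ∘ g) x := by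
  obtain ⟨N, hN, h⟩ := hw
  exact ⟨g ⁻¹' N, hg.continuous.continuousAt hN,
    h.comp (hg.lipschitzOnWith) (Set.mapsTo_preimage _ _)⟩

theorem LipAt.lipschitz_comp {E F G : Type*} [PseudoMetricSpace E] [PseudoMetricSpace F]
    [PseudoMetricSpace G] {C K : ℝ≥0} {w : F → G} {g : E → F} {x : E} (hw : LipschitzWith K w)
    (hg : LipAt C g x) : LipAt (K * C) (w ∘ g) x := by
  obtain ⟨N, hN, h⟩ := hg
  exact ⟨N, hN, hw.comp_lipschitzOnWith h⟩

theorem LipAt.add {E F : Type*} [PseudoMetricSpace E] [SeminormedAddCommGroup F]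
    {C D : ℝ≥0} {w v : E → F} {x : E} (hw : LipAt C w x) (hv : LipAt D v x) :
    LipAt (C + D) (fun y => w y + v y) x := by
  obtain ⟨N, hN, h⟩ := hw
  obtain ⟨N', hN', h'⟩ := hv
  exact ⟨N ∩ N', inter_mem hN hN', (h.mono Set.inter_subset_left).add
    (h'.mono Set.inter_subset_right)⟩

theorem LipAt.mul {E : Type*} [PseudoMetricSpace E] {C D : ℝ≥0} {w v : E → ℝ} {x : E}
    (hw : LipAt C w x) (hv : LipAt D v x) : ∃ K, LipAt K (fun y => w y * v y) x := by
  obtain ⟨N, hN, h⟩ := hw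
  obtain ⟨N', hN', h'⟩ := hv
  refine ⟨C * (‖v x‖₊ + D) + (‖w x‖₊ + C) * D, N ∩ N' ∩ Metric.ball x 1,
    inter_mem (inter_mem hN hN') (Metric.ball_mem_nhds x one_pos), ?_⟩
  have hx : x ∈ N := mem_of_mem_nhds hN
  have hx' : x ∈ N' := mem_of_mem_nhds hN'
  refine LipschitzOnWith.of_dist_le_mul fun y hy z hz => ?_
  have e1 := h.dist_le_mul y hy.1.1 z hz.1.1
  have e2 := h'.dist_le_mul y hy.1.2 z hz.1.2
  have e3 := h.dist_le_mul z hz.1.1 x hx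
  have e4 := h'.dist_le_mul y hy.1.2 x hx'
  have d1 : dist z x ≤ 1 := (Metric.mem_ball.1 hz.2).le
  have d2 : dist y x ≤ 1 := (Metric.mem_ball.1 hy.2).le
  have a3 : |w z| ≤ |w x| + C := by
    rw [Real.dist_eq] at e3
    have := abs_sub_abs_le_abs_sub (w z) (w x)
    have : (C : ℝ) * dist z x ≤ C := mul_le_of_le_one_right C.2 d1
    linarith
  have a4 : |v y| ≤ |v x| + D := by
    rw [Real.dist_eq] at e4
    have := abs_sub_abs_le_abs_sub (v y) (v x)
    have : (D : ℝ) * dist y x ≤ D := mul_le_of_le_one_right D.2 d2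
    linarith
  push_cast
  rw [Real.dist_eq] at *
  simp only [Real.norm_eq_abs]
  calc |w y * v y - w z * v z| = |(w y - w z) * v y + w z * (v y - v z)| := by ring_nf
    _ ≤ |w y - w z| * |v y| + |w z| * |v y - v z| := by
      rw [← abs_mul, ← abs_mul]; exact abs_add_le _ _
    _ ≤ (C * dist y z) * (|v x| + D) + (|w x| + C) * (D * dist y z) := by
      gcongr
    _ = _ := by ring

theorem LipAt.abs_fderiv_apply_le {w : E3 → ℝ} {C : ℝ≥0} {x v : E3} (h : LipAt C w x) :
    |fderiv ℝ w x v| ≤ C * ‖v‖ := by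
  obtain ⟨N, hN, h⟩ := h
  exact ((fderiv ℝ w x).le_opNorm v).trans
    (mul_le_mul_of_nonneg_right (norm_fderiv_le_of_lipschitzOn ℝ hN h) (norm_nonneg v))

/-- The fundamental theorem of calculus for locally Lipschitz functions. -/
theorem integral_deriv_of_lipAt {f : ℝ → ℝ} (hf : ∀ p, ∃ C, LipAt C f p) (a b : ℝ) :
    ∫ p in a..b, deriv f p = f b - f a := by
  have h : LocallyLipschitzOn (Set.uIcc a b) f := fun p _ => by
    obtain ⟨C, N, hN, h⟩ := hf p
    exact ⟨C, N, mem_nhdsWithin_of_mem_nhds hN, h⟩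
  obtain ⟨K, hK⟩ := h.exists_lipschitzOnWith_of_compact isCompact_uIcc
  exact hK.absolutelyContinuousOnInterval.integral_deriv_eq_sub

/-! ### The Gauss-Green formula on cylinders -/

theorem volume_eq_zero_of_finite_coordTangent {ν : E2} (hν : ‖ν‖ = 1) {S : Set E3}
    (hS : (coordTangent ν '' S).Finite) : volume S = 0 := by
  rw [← (measurePreserving_framePoint hν).measure_preimage_emb
    (frameHomeomorph_measurableEmbedding hν)]
  refine measure_mono_null (t := Prod.snd ⁻¹' (Prod.fst ⁻¹' (coordTangent ν '' S))) ?_ ?_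
  · intro q hq
    exact ⟨_, hq, coordTangent_framePoint hν ..⟩
  · exact Measure.quasiMeasurePreserving_snd.preimage_null
      (Measure.quasiMeasurePreserving_fst.preimage_null (hS.measure_zero volume))

theorem framePoint_add_smul (ν : E2) (p s z : ℝ) :
    framePoint ν p s z = framePoint ν 0 s z + p • framePoint ν 1 0 0 := by
  ext i; fin_cases i <;> simp <;> ring

/-- The divergence theorem in the normal direction, for functions that are locally Lipschitz
off finitely many vertical lines. -/
theorem integral_cylinder_fderiv_normal {ν : E2} (hν : ‖ν‖ = 1) {t : ℝ} (ht : 0 < t) {F : E3 → ℝ}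
    {S : Set E3} (hS : ∀ x ∉ S, ∃ C, LipAt C F x) (hfin : (coordTangent ν '' S).Finite)
    (hint : IntegrableOn (fun x => fderiv ℝ F x (framePoint ν 1 0 0)) (cylinder ν t)) :
    ∫ x in cylinder ν t, fderiv ℝ F x (framePoint ν 1 0 0) =
      ∫ y in Set.Ioo (-(t / 2)) (t / 2) ×ˢ Set.Ioo (-(1 / 2) : ℝ) (1 / 2),
        (F (framePoint ν (t / 2) y.1 y.2) - F (framePoint ν (-(t / 2)) y.1 y.2)) := by
  rw [setIntegral_cylinder hν]
  rw [← integrableOn_cylinder_iff hν, IntegrableOn, Measure.volume_eq_prod,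
    ← Measure.prod_restrict] at hint
  rw [Measure.volume_eq_prod, ← Measure.prod_restrict, integral_prod_symm _ hint]
  refine integral_congr_ae (ae_restrict_of_ae ?_)
  have hd := ae_differentiableAt_of_lipAt hS
  have hd' := (measurePreserving_framePoint hν).quasiMeasurePreserving.ae hd
  rw [Measure.volume_eq_prod] at hd'
  have hd'' := Measure.ae_ae_of_ae_prod
    ((Measure.measurePreserving_swap (μ := (volume : Measure (ℝ × ℝ)))
      (ν := (volume : Measure ℝ))).quasiMeasurePreserving.ae hd')
  have hn : ∀ᵐ y : ℝ × ℝ, y.1 ∉ coordTangent ν '' S :=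
    Measure.quasiMeasurePreserving_fst.ae (measure_eq_zero_iff_ae_notMem.1 (hfin.measure_zero volume))
  filter_upwards [hd'', hn] with y hy hyS
  have hline : ∀ p, framePoint ν p y.1 y.2 ∉ S := fun p hp =>
    hyS ⟨_, hp, coordTangent_framePoint hν ..⟩
  have hlip : LipschitzWith ‖framePoint ν 1 0 0‖₊ fun p : ℝ => framePoint ν p y.1 y.2 := by
    refine LipschitzWith.of_dist_le_mul fun p q => ?_
    rw [framePoint_add_smul ν p, framePoint_add_smul ν q, dist_add_left, dist_eq_norm, ← sub_smul,
      norm_smul, Real.dist_eq, Real.norm_eq_abs, mul_comm, coe_nnnorm]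
  have hftc := integral_deriv_of_lipAt (f := fun p => F (framePoint ν p y.1 y.2)) (fun p => by
    obtain ⟨C, hC⟩ := hS _ (hline p)
    exact ⟨_, LipAt.comp_lipschitz (g := fun p => framePoint ν p y.1 y.2) hC hlip⟩)
      (-(t / 2)) (t / 2)
  rw [← hftc, intervalIntegral.integral_of_le (by linarith), integral_Ioc_eq_integral_Ioo]
  refine integral_congr_ae (ae_restrict_of_ae ?_)
  filter_upwards [hy] with p hp
  have hp' : DifferentiableAt ℝ F (framePoint ν p y.1 y.2) := hp (hline p)
  have hder : HasDerivAt (fun p : ℝ => framePoint ν p y.1 y.2) (framePoint ν 1 0 0) p := by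
    have : (fun p : ℝ => framePoint ν p y.1 y.2) =
        fun p => framePoint ν 0 y.1 y.2 + p • framePoint ν 1 0 0 :=
      funext fun p => framePoint_add_smul ..
    rw [this]
    simpa using ((hasDerivAt_id p).smul_const (framePoint ν 1 0 0)).const_add
      (framePoint ν 0 y.1 y.2)
  exact (hp'.hasFDerivAt.comp_hasDerivAt p hder).deriv.symm

/-- The rotation of the unit vector `ν` by a right angle. -/
def perp (ν : E2) : E2 := !₂[-ν 1, ν 0]

@[simp] theorem perp_apply_zero (ν : E2) : perp ν 0 = -ν 1 := by simp [perp]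

@[simp] theorem perp_apply_one (ν : E2) : perp ν 1 = ν 0 := by simp [perp]

theorem norm_perp (ν : E2) : ‖perp ν‖ = ‖ν‖ := by
  simp [EuclideanSpace.norm_eq, Fin.sum_univ_two, add_comm]

theorem coordNormal_perp (ν : E2) (x : E3) : coordNormal (perp ν) x = coordTangent ν x := by
  simp [coordNormal, coordTangent]; ring

theorem coordTangent_perp (ν : E2) (x : E3) : coordTangent (perp ν) x = -coordNormal ν x := by
  simp [coordNormal, coordTangent]; ring

theorem cylinder_perp (ν : E2) (t : ℝ) : cylinder (perp ν) t = cylinder ν t := by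
  ext x
  simp only [cylinder, coordNormal_perp, coordTangent_perp, abs_neg, Set.mem_ofPred_eq]
  tauto

theorem framePoint_perp (ν : E2) (p s z : ℝ) :
    framePoint (perp ν) p s z = framePoint ν (-s) p z := by
  ext i; fin_cases i <;> simp <;> ring

/-- The divergence theorem in the tangential direction. -/
theorem integral_cylinder_fderiv_tangent {ν : E2} (hν : ‖ν‖ = 1) {t : ℝ} (ht : 0 < t) {F : E3 → ℝ}
    {S : Set E3} (hS : ∀ x ∉ S, ∃ C, LipAt C F x) (hfin : (coordNormal ν '' S).Finite)
    (hint : IntegrableOn (fun x => fderiv ℝ F x (framePoint ν 0 1 0)) (cylinder ν t)) :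
    ∫ x in cylinder ν t, fderiv ℝ F x (framePoint ν 0 1 0) =
      ∫ y in Set.Ioo (-(t / 2)) (t / 2) ×ˢ Set.Ioo (-(1 / 2) : ℝ) (1 / 2),
        (F (framePoint ν y.1 (t / 2) y.2) - F (framePoint ν y.1 (-(t / 2)) y.2)) := by
  have h := integral_cylinder_fderiv_normal (ν := perp ν) (by rwa [norm_perp]) ht hS (by
    have : coordTangent (perp ν) = (fun r => -r) ∘ coordNormal ν :=
      funext fun x => coordTangent_perp ν x
    rw [this, Set.image_comp]
    exact hfin.image _)
  simp only [framePoint_perp, cylinder_perp, neg_zero] at h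
  rw [h hint]
  have hm : MeasurePreserving (Prod.map (fun s : ℝ => -s) (id : ℝ → ℝ)) volume volume :=
    (Measure.measurePreserving_neg (volume : Measure ℝ)).prod (MeasurePreserving.id volume)
  have he : MeasurableEmbedding (Prod.map (fun s : ℝ => -s) (id : ℝ → ℝ)) :=
    ((MeasurableEquiv.neg ℝ).prodCongr (MeasurableEquiv.refl ℝ)).measurableEmbedding
  rw [← hm.setIntegral_preimage_emb he]
  have : Prod.map (fun s : ℝ => -s) (id : ℝ → ℝ) ⁻¹'
      (Set.Ioo (-(t / 2)) (t / 2) ×ˢ Set.Ioo (-(1 / 2) : ℝ) (1 / 2)) =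
      Set.Ioo (-(t / 2)) (t / 2) ×ˢ Set.Ioo (-(1 / 2) : ℝ) (1 / 2) := by
    ext ⟨s, z⟩
    simp only [Set.mem_preimage, Prod.map_apply, Set.mem_prod, Set.mem_Ioo, id]
    constructor <;> rintro ⟨⟨h1, h2⟩, h3⟩ <;> exact ⟨⟨by linarith, by linarith⟩, h3⟩
  rw [this]
  simp

theorem setIntegral_box_eq_intervalIntegral {t : ℝ} (ht : 0 < t) {H : ℝ × ℝ → ℝ}
    (hH : IntegrableOn H (Set.Ioo (-(t / 2)) (t / 2) ×ˢ Set.Ioo (-(1 / 2) : ℝ) (1 / 2))) :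
    ∫ y in Set.Ioo (-(t / 2)) (t / 2) ×ˢ Set.Ioo (-(1 / 2) : ℝ) (1 / 2), H y =
      ∫ s in (-(t / 2))..(t / 2), ∫ z in (-(1 / 2) : ℝ)..(1 / 2), H (s, z) := by
  rw [Measure.volume_eq_prod] at hH ⊢
  rw [setIntegral_prod _ hH, intervalIntegral.integral_of_le (by linarith),
    integral_Ioc_eq_integral_Ioo]
  refine integral_congr_ae (Eventually.of_forall fun s => ?_)
  simp only
  rw [intervalIntegral.integral_of_le (by norm_num), integral_Ioc_eq_integral_Ioo]

theorem IsTestFunction.eq_zero {U : Set E3} {ψ : E3 → ℝ} (hψ : IsTestFunction U ψ) {x : E3}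
    (hx : x ∉ U) : ψ x = 0 :=
  image_eq_zero_of_notMem_tsupport fun h => hx (hψ.2.2 h)

theorem cylinder_volume_lt_top {ν : E2} (hν : ‖ν‖ = 1) (t : ℝ) :
    volume (cylinder ν t) < ⊤ := by
  rw [← (measurePreserving_framePoint hν).measure_preimage_emb
    (frameHomeomorph_measurableEmbedding hν), framePoint_preimage_cylinder hν,
    Measure.volume_eq_prod, Measure.prod_prod, Measure.volume_eq_prod, Measure.prod_prod]
  simp only [Real.volume_Ioo]
  exact ENNReal.mul_lt_top ENNReal.ofReal_lt_top
    (ENNReal.mul_lt_top ENNReal.ofReal_lt_top ENNReal.ofReal_lt_top)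

theorem integrableOn_of_bounded {α : Type*} [MeasurableSpace α] {μ : Measure α} {s : Set α}
    (hs : μ s < ⊤) {H : α → ℝ} (hm : Measurable H) {B : ℝ} (hB : ∀ x, |H x| ≤ B) :
    IntegrableOn H s μ :=
  IntegrableOn.of_bound hs hm.aestronglyMeasurable B (Eventually.of_forall hB)

/-- For functions of the planar variable the transversal part of the divergence vanishes. -/
theorem integral_cylinder_transversal {ν : E2} (hν : ‖ν‖ = 1) {t : ℝ} {w : E3 → ℝ}
    (hw : Measurable w) {B : ℝ} (hB : ∀ x, |w x| ≤ B)
    (hplanar : ∀ x y : E3, x 0 = y 0 → x 1 = y 1 → w x = w y)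
    {ψ : E3 → ℝ} (hψ : IsTestFunction {x | |x 2| < 1 / 2} ψ) :
    ∫ x in cylinder ν t, w x * partialDeriv 2 ψ x = 0 := by
  have hψ1 : ContDiff ℝ 1 ψ := hψ.1.of_le (by norm_num)
  have hc : Continuous (partialDeriv 2 ψ) :=
    (hψ1.continuous_fderiv (by norm_num)).clm_apply continuous_const
  have hcs : HasCompactSupport (partialDeriv 2 ψ) := hψ.2.1.fderiv_apply (𝕜 := ℝ) _
  obtain ⟨D, hD⟩ := hcs.exists_bound_of_continuous hc
  have hint : IntegrableOn (fun x => w x * partialDeriv 2 ψ x) (cylinder ν t) := by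
    refine integrableOn_of_bounded (cylinder_volume_lt_top hν t) (hw.mul hc.measurable)
      (B := B * D) fun x => ?_
    rw [abs_mul]
    exact mul_le_mul (hB x) (hD x) (abs_nonneg _) ((abs_nonneg _).trans (hB x))
  rw [setIntegral_cylinder hν]
  rw [← integrableOn_cylinder_iff hν, IntegrableOn, Measure.volume_eq_prod,
    ← Measure.prod_restrict] at hint
  rw [Measure.volume_eq_prod, ← Measure.prod_restrict, integral_prod _ hint]
  refine integral_eq_zero_of_ae ?_
  filter_upwards [hint.prod_right_ae] with p hp
  rw [Measure.volume_eq_prod, ← Measure.prod_restrict] at hp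
  rw [Measure.volume_eq_prod, ← Measure.prod_restrict]
  rw [integral_prod _ hp]
  refine integral_eq_zero_of_ae (Eventually.of_forall fun s => ?_)
  have hw' : ∀ z, w (framePoint ν p s z) = w (framePoint ν p s 0) := fun z =>
    hplanar _ _ (by simp) (by simp)
  simp only [hw', Pi.zero_apply, integral_const_mul]
  rw [← integral_Ioc_eq_integral_Ioo, ← intervalIntegral.integral_of_le (by norm_num)]
  have hder : ∀ z : ℝ, HasDerivAt (fun z => ψ (framePoint ν p s z))
      (partialDeriv 2 ψ (framePoint ν p s z)) z := fun z => by
    have h1 : HasDerivAt (fun z : ℝ => framePoint ν p s z) (EuclideanSpace.single 2 1) z := by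
      have : (fun z : ℝ => framePoint ν p s z) =
          fun z => framePoint ν p s 0 + z • (EuclideanSpace.single 2 1 : E3) := by
        funext z; ext i; fin_cases i <;> simp
      rw [this]
      simpa using ((hasDerivAt_id z).smul_const (EuclideanSpace.single 2 1 : E3)).const_add
        (framePoint ν p s 0)
    exact ((hψ1.differentiable (by norm_num) _).hasFDerivAt).comp_hasDerivAt z h1
  rw [intervalIntegral.integral_eq_sub_of_hasDerivAt (fun z _ => hder z)]
  · rw [hψ.eq_zero, hψ.eq_zero]
    · simp
    all_goals simp [abs_of_pos]
  · refine Continuous.intervalIntegrable ?_ _ _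
    refine hc.comp ?_
    exact (continuous_framePoint ν).comp (by fun_prop : Continuous fun z : ℝ => (p, s, z))

/-- The Gauss-Green formula on a cylinder for bounded functions of the planar variable that are
locally Lipschitz off finitely many vertical lines. -/
theorem gaussGreen_cylinder {ν : E2} (hν : ‖ν‖ = 1) {t : ℝ} (ht : 0 < t) {w : E3 → ℝ}
    {S : Set E3} (hS : ∀ x ∉ S, ∃ C, LipAt C w x) (hSn : (coordNormal ν '' S).Finite)
    (hSt : (coordTangent ν '' S).Finite)
    (hw : Measurable w) {B : ℝ} (hB : ∀ x, |w x| ≤ B)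
    (hplanar : ∀ x y : E3, x 0 = y 0 → x 1 = y 1 → w x = w y)
    (hint : ∀ j, IntegrableOn (partialDeriv j w) (cylinder ν t))
    {ψ : E3 → ℝ} (hψ : IsTestFunction {x | |x 2| < 1 / 2} ψ) (j : Fin 3) :
    ∫ x in cylinder ν t, (w x * partialDeriv j ψ x + partialDeriv j w x * ψ x) =
      lateralIntegral ν t (fun x n => w x * ψ x * n j) := by
  have hψ1 : ContDiff ℝ 1 ψ := hψ.1.of_le (by norm_num)
  obtain ⟨D, hD⟩ := hψ.2.1.exists_bound_of_continuous hψ1.continuous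
  have hD' : ∀ x, |ψ x| ≤ D := hD
  have hcv : ∀ v, Continuous (fun x => fderiv ℝ ψ x v) := fun v =>
    (hψ1.continuous_fderiv (by norm_num)).clm_apply continuous_const
  set F : E3 → ℝ := fun x => w x * ψ x with hF
  have hFS : ∀ x ∉ S, ∃ C, LipAt C F x := fun x hx => by
    obtain ⟨C, hC⟩ := hS x hx
    obtain ⟨C', N, hN, hC'⟩ := hψ1.locallyLipschitz x
    exact hC.mul ⟨N, hN, hC'⟩
  have hFm : Measurable F := hw.mul hψ1.continuous.measurable
  have hFB : ∀ x, |F x| ≤ B * D := fun x => by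
    rw [hF, abs_mul]
    exact mul_le_mul (hB x) (hD' x) (abs_nonneg _) ((abs_nonneg _).trans (hB x))
  -- the gradient of `w ψ`
  have hFd : ∀ᵐ x, ∀ v, fderiv ℝ F x v = w x * fderiv ℝ ψ x v + fderiv ℝ w x v * ψ x := by
    have hS0 := measure_eq_zero_iff_ae_notMem.1 (volume_eq_zero_of_finite_coordTangent hν hSt)
    filter_upwards [ae_differentiableAt_of_lipAt hS, hS0] with x hx hxS v
    have := ((hx hxS).hasFDerivAt.mul (hψ1.differentiable (by norm_num) x).hasFDerivAt).fderiv
    have h' : fderiv ℝ F x = _ := this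
    rw [h']
    simp [mul_comm]
  have hwv : ∀ v : E3, IntegrableOn (fun x => fderiv ℝ w x v) (cylinder ν t) := fun v => by
    have : (fun x => fderiv ℝ w x v) = fun x => ∑ j, v j * partialDeriv j w x := by
      funext x
      conv_lhs => rw [← (EuclideanSpace.basisFun (Fin 3) ℝ).sum_repr v]
      simp [partialDeriv]
    rw [this]
    exact integrable_finsetSum _ fun j _ => (hint j).const_mul _
  have hwψ : ∀ v : E3, IntegrableOn (fun x => w x * fderiv ℝ ψ x v) (cylinder ν t) := fun v => by
    obtain ⟨D₁, hD₁⟩ := (hψ.2.1.fderiv_apply (𝕜 := ℝ) v).exists_bound_of_continuous (hcv v)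
    refine integrableOn_of_bounded (cylinder_volume_lt_top hν t) (hw.mul (hcv v).measurable)
      (B := B * D₁) fun x => ?_
    rw [abs_mul]
    exact mul_le_mul (hB x) (hD₁ x) (abs_nonneg _) ((abs_nonneg _).trans (hB x))
  have hdwψ : ∀ v : E3, IntegrableOn (fun x => fderiv ℝ w x v * ψ x) (cylinder ν t) := fun v =>
    (hwv v).mul_bdd (c := D) hψ1.continuous.aestronglyMeasurable (Eventually.of_forall hD)
  have hFv : ∀ v : E3, IntegrableOn (fun x => fderiv ℝ F x v) (cylinder ν t) := fun v => by
    refine ((hwψ v).add (hdwψ v)).congr (ae_restrict_of_ae ?_)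
    filter_upwards [hFd] with x hx
    exact (hx v).symm
  -- decomposition of the coordinate direction in the frame
  have hdec : (EuclideanSpace.single j 1 : E3) = (framePoint ν 1 0 0 j) • framePoint ν 1 0 0 +
      (framePoint ν 0 1 0 j) • framePoint ν 0 1 0 +
      (EuclideanSpace.single 2 1 : E3) j • (EuclideanSpace.single 2 1 : E3) := by
    have := sq_add_sq_of_norm_eq_one hν
    ext i
    fin_cases j <;> fin_cases i <;> simp <;> linarith
  have hw2 : ∀ x, fderiv ℝ w x (EuclideanSpace.single 2 1) = 0 := fun x => by
    by_cases hx : DifferentiableAt ℝ w x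
    · rw [← hx.lineDeriv_eq_fderiv, lineDeriv]
      have : (fun t : ℝ => w (x + t • (EuclideanSpace.single 2 1 : E3))) = fun _ => w x :=
        funext fun t => hplanar _ _ (by simp) (by simp)
      rw [this, deriv_const]
    · rw [fderiv_zero_of_not_differentiableAt hx]; rfl
  have h1 := integral_cylinder_fderiv_normal hν ht hFS hSt (hFv _)
  have h2 := integral_cylinder_fderiv_tangent hν ht hFS hSn (hFv _)
  have h3 := integral_cylinder_transversal hν (t := t) hw hB hplanar hψ
  have hsplit : ∫ x in cylinder ν t, (w x * partialDeriv j ψ x + partialDeriv j w x * ψ x) =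
      ∫ x in cylinder ν t, (framePoint ν 1 0 0 j * fderiv ℝ F x (framePoint ν 1 0 0) +
        framePoint ν 0 1 0 j * fderiv ℝ F x (framePoint ν 0 1 0) +
        (EuclideanSpace.single 2 1 : E3) j * (w x * partialDeriv 2 ψ x)) := by
    refine integral_congr_ae (ae_restrict_of_ae ?_)
    filter_upwards [hFd] with x hx
    have e : w x * partialDeriv j ψ x + partialDeriv j w x * ψ x =
        fderiv ℝ F x (EuclideanSpace.single j 1) := (hx _).symm
    rw [e, hdec, map_add, map_add, map_smul, map_smul, map_smul,
      hx (EuclideanSpace.single 2 1), hw2]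
    simp [partialDeriv]
  rw [hsplit, integral_add, integral_add, integral_const_mul, integral_const_mul,
    integral_const_mul, h1, h2, h3, mul_zero, add_zero]
  rotate_left
  · exact (hFv _).const_mul _
  · exact (hFv _).const_mul _
  · exact ((hFv _).const_mul _).add ((hFv _).const_mul _)
  · exact (hwψ _).const_mul _
  have hbox : (volume : Measure (ℝ × ℝ))
      (Set.Ioo (-(t / 2)) (t / 2) ×ˢ Set.Ioo (-(1 / 2) : ℝ) (1 / 2)) < ⊤ := by
    rw [Measure.volume_eq_prod, Measure.prod_prod]
    simp only [Real.volume_Ioo]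
    exact ENNReal.mul_lt_top ENNReal.ofReal_lt_top ENNReal.ofReal_lt_top
  have hi : ∀ g : ℝ × ℝ → E3, Continuous g → IntegrableOn (fun y => F (g y))
      (Set.Ioo (-(t / 2)) (t / 2) ×ˢ Set.Ioo (-(1 / 2) : ℝ) (1 / 2)) := fun g hg =>
    integrableOn_of_bounded hbox (hFm.comp hg.measurable) fun y => hFB (g y)
  have hfp := continuous_framePoint ν
  have g1 := hi (fun y => framePoint ν (t / 2) y.1 y.2)
    (hfp.comp (by fun_prop : Continuous fun y : ℝ × ℝ => (t / 2, y.1, y.2)))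
  have g2 := hi (fun y => framePoint ν (-(t / 2)) y.1 y.2)
    (hfp.comp (by fun_prop : Continuous fun y : ℝ × ℝ => (-(t / 2), y.1, y.2)))
  have g3 := hi (fun y => framePoint ν y.1 (t / 2) y.2)
    (hfp.comp (by fun_prop : Continuous fun y : ℝ × ℝ => (y.1, t / 2, y.2)))
  have g4 := hi (fun y => framePoint ν y.1 (-(t / 2)) y.2)
    (hfp.comp (by fun_prop : Continuous fun y : ℝ × ℝ => (y.1, -(t / 2), y.2)))
  rw [lateralIntegral]
  have hn1 : framePoint ν (-1) 0 0 j = -framePoint ν 1 0 0 j := by fin_cases j <;> simp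
  have hn2 : framePoint ν 0 (-1) 0 j = -framePoint ν 0 1 0 j := by fin_cases j <;> simp
  rw [← setIntegral_box_eq_intervalIntegral ht (H := fun y =>
    (F (framePoint ν (t / 2) y.1 y.2) * framePoint ν 1 0 0 j +
      F (framePoint ν (-(t / 2)) y.1 y.2) * framePoint ν (-1) 0 0 j +
      F (framePoint ν y.1 (t / 2) y.2) * framePoint ν 0 1 0 j +
      F (framePoint ν y.1 (-(t / 2)) y.2) * framePoint ν 0 (-1) 0 j)),
    ← integral_const_mul, ← integral_const_mul, ← integral_add]
  · refine integral_congr_ae (Eventually.of_forall fun y => ?_)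
    simp only [hn1, hn2]
    ring
  · exact (g1.sub g2).const_mul _
  · exact (g3.sub g4).const_mul _
  · exact (((g1.mul_const _).add (g2.mul_const _)).add (g3.mul_const _)).add (g4.mul_const _)

/-- A map with a lateral trace has a weak gradient: test functions supported in the cylinder do
not see the boundary values. -/
theorem HasLateralTrace.weak_grad {ν : E2} (hν : ‖ν‖ = 1) {t : ℝ} {φ : E3 → E3} {G : E3 → Mat3}
    {g : E3 → E3} (h : HasLateralTrace ν t φ G g) (hφ : IntegrableOn φ (cylinder ν t))
    (hG : ∀ i j, IntegrableOn (fun x => G x i j) (cylinder ν t))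
    {ψ : E3 → ℝ} (hψ : IsTestFunction (cylinder ν t) ψ) (i j : Fin 3) :
    ∫ x in cylinder ν t, φ x i * partialDeriv j ψ x = -∫ x in cylinder ν t, G x i j * ψ x := by
  have hψ1 : ContDiff ℝ 1 ψ := hψ.1.of_le (by norm_num)
  have hψ' : IsTestFunction {x | |x 2| < 1 / 2} ψ :=
    ⟨hψ.1, hψ.2.1, hψ.2.2.trans fun x hx => hx.2.2⟩
  have h0 := h ψ hψ' i j
  obtain ⟨D, hD⟩ := hψ.2.1.exists_bound_of_continuous hψ1.continuous
  have hc : Continuous (partialDeriv j ψ) :=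
    (hψ1.continuous_fderiv (by norm_num)).clm_apply continuous_const
  have hcs : HasCompactSupport (partialDeriv j ψ) := hψ.2.1.fderiv_apply (𝕜 := ℝ) _
  obtain ⟨D', hD'⟩ := hcs.exists_bound_of_continuous hc
  have hφi : IntegrableOn (fun x => φ x i) (cylinder ν t) :=
    (EuclideanSpace.proj (𝕜 := ℝ) i).integrable_comp hφ
  rw [integral_add (hφi.mul_bdd (c := D') hc.aestronglyMeasurable (Eventually.of_forall hD'))
    ((hG i j).mul_bdd (c := D) hψ1.continuous.aestronglyMeasurable (Eventually.of_forall hD))] at h0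
  have hz : ∀ p s z, (p ∉ Set.Ioo (-(t / 2)) (t / 2) ∨ s ∉ Set.Ioo (-(t / 2)) (t / 2)) →
      ψ (framePoint ν p s z) = 0 := fun p s z hps => hψ.eq_zero fun hm => by
    rw [framePoint_mem_cylinder hν] at hm
    tauto
  have hl : lateralIntegral ν t (fun x n => g x i * ψ x * n j) = 0 := by
    simp [lateralIntegral, hz]
  linarith

/-! ### Curves in the target manifold -/

/-- `a` and `b` are the end points of a curve in `M` with Lipschitz constant `C`; the curve is
parametrized by the real line and constant outside of the unit interval. -/
def LipJoined (M : Set E3) (C : ℝ≥0) (a b : E3) : Prop :=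
  ∃ Γ : ℝ → E3, LipschitzWith C Γ ∧ (∀ t ≤ 0, Γ t = a) ∧ (∀ t, 1 ≤ t → Γ t = b) ∧ ∀ t, Γ t ∈ M

theorem LipJoined.mono {M : Set E3} {C D : ℝ≥0} {a b : E3} (h : LipJoined M C a b) (hCD : C ≤ D) :
    LipJoined M D a b := by
  obtain ⟨Γ, h1, h2⟩ := h
  exact ⟨Γ, h1.weaken hCD, h2⟩

theorem LipJoined.symm {M : Set E3} {C : ℝ≥0} {a b : E3} (h : LipJoined M C a b) :
    LipJoined M C b a := by
  obtain ⟨Γ, h1, h2, h3, h4⟩ := h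
  refine ⟨fun t => Γ (1 - t), ?_, fun t ht => h3 _ (by linarith), fun t ht => h2 _ (by linarith),
    fun t => h4 _⟩
  have : LipschitzWith 1 fun t : ℝ => 1 - t :=
    LipschitzWith.of_dist_le_mul fun x y => by
      rw [Real.dist_eq, Real.dist_eq, NNReal.coe_one, one_mul, abs_sub_comm]
      exact le_of_eq (congrArg _ (by ring))
  have h := h1.comp this
  rw [mul_one] at h
  exact h

theorem LipJoined.trans {M : Set E3} {C D : ℝ≥0} {a b c : E3} (h : LipJoined M C a b)
    (h' : LipJoined M D b c) : LipJoined M (2 * C + 2 * D) a c := by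
  obtain ⟨Γ, h1, h2, h3, h4⟩ := h
  obtain ⟨Δ, k1, k2, k3, k4⟩ := h'
  -- the two curves run one after the other, so that in the sum one of them is always at `b`
  refine ⟨fun t => Γ (2 * t) + Δ (2 * t - 1) - b, ?_, fun t ht => ?_, fun t ht => ?_, fun t => ?_⟩
  · have e1 : LipschitzWith 2 fun t : ℝ => 2 * t :=
      LipschitzWith.of_dist_le_mul fun x y => by
        simp [Real.dist_eq, ← mul_sub, abs_mul]
    have e2 : LipschitzWith 2 fun t : ℝ => 2 * t - 1 :=
      LipschitzWith.of_dist_le_mul fun x y => by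
        simp [Real.dist_eq, ← mul_sub, abs_mul]
    have := ((h1.comp e1).add (k1.comp e2)).sub (LipschitzWith.const b)
    rw [add_zero, mul_comm C, mul_comm D] at this
    exact this
  · simp [h2 (2 * t) (by linarith), k2 (2 * t - 1) (by linarith)]
  · simp [h3 (2 * t) (by linarith), k3 (2 * t - 1) (by linarith)]
  · rcases le_total t (1 / 2) with ht | ht
    · simpa [k2 (2 * t - 1) (by linarith)] using h4 (2 * t)
    · simpa [h3 (2 * t) (by linarith)] using k4 (2 * t - 1)

theorem IsSmoothSubmanifold.locally_lipJoined {M : Set E3} (hM : IsSmoothSubmanifold M) {p : E3}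
    (hp : p ∈ M) : ∃ K : ℝ≥0, ∃ U ∈ 𝓝 p, ∀ a ∈ U, a ∈ M → ∀ b ∈ U, b ∈ M →
      LipJoined M (K * nndist a b) a b := by
  obtain ⟨d, -, hd⟩ := hM
  obtain ⟨e, hpe, he, hes, hiff⟩ := hd p hp
  have c1 : ContDiffAt ℝ 1 e p :=
    (he.contDiffAt (e.open_source.mem_nhds hpe)).of_le (by norm_num)
  have c2 : ContDiffAt ℝ 1 e.symm (e p) :=
    (hes.contDiffAt (e.open_target.mem_nhds (e.map_source hpe))).of_le (by norm_num)
  obtain ⟨K₁, N₁, hN₁, hK₁⟩ := c1.exists_lipschitzOnWith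
  obtain ⟨K₂, N₂, hN₂, hK₂⟩ := c2.exists_lipschitzOnWith
  obtain ⟨r, hr, hB⟩ := Metric.mem_nhds_iff.1
    (inter_mem hN₂ (e.open_target.mem_nhds (e.map_source hpe)))
  refine ⟨K₂ * K₁, N₁ ∩ (e.source ∩ e ⁻¹' Metric.ball (e p) r), inter_mem hN₁ (inter_mem
    (e.open_source.mem_nhds hpe) (c1.continuousAt.preimage_mem_nhds (Metric.ball_mem_nhds _ hr))),
    ?_⟩
  rintro a ⟨ha1, ha2, ha3⟩ haM b ⟨hb1, hb2, hb3⟩ hbM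
  -- the segment between the images in the chart stays in the coordinate plane
  let σ : ℝ → ℝ := fun t => max 0 (min t 1)
  have hσ : LipschitzWith 1 σ := (LipschitzWith.id.min_const 1).const_max 0
  let ℓ : ℝ → E3 := fun t => AffineMap.lineMap (e a) (e b) (σ t)
  have hℓB : ∀ t, ℓ t ∈ Metric.ball (e p) r := fun t =>
    (convex_ball (e p) r).lineMap_mem ha3 hb3
      ⟨le_max_left _ _, max_le zero_le_one (min_le_right _ _)⟩
  have hℓ : LipschitzWith (nndist (e a) (e b)) ℓ := by
    have h := (lipschitzWith_lineMap (𝕜 := ℝ) (e a) (e b)).comp hσ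
    rw [mul_one] at h
    exact h
  refine ⟨fun t => e.symm (ℓ t), ?_, fun t ht => ?_, fun t ht => ?_, fun t => ?_⟩
  · have h := (hK₂.mono (fun x hx => (hB hx).1 : Metric.ball (e p) r ⊆ N₂)).comp
      (hℓ.lipschitzOnWith (s := Set.univ)) (fun t _ => hℓB t)
    rw [lipschitzOnWith_univ] at h
    refine h.weaken ?_
    rw [mul_assoc]
    exact mul_le_mul_right (show nndist (e a) (e b) ≤ K₁ * nndist a b from
      NNReal.coe_le_coe.1 (by push_cast; exact hK₁.dist_le_mul a ha1 b hb1)) K₂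
  · have : σ t = 0 := max_eq_left (min_le_of_left_le ht)
    simp [ℓ, this, e.left_inv ha2]
  · have : σ t = 1 := by simp [σ, min_eq_right ht]
    simp [ℓ, this, e.left_inv hb2]
  · have ht := (hB (hℓB t)).2
    refine (hiff _ (e.map_target ht)).2 fun i hi => ?_
    rw [e.right_inv ht]
    have h1 := (hiff a ha2).1 haM i hi
    have h2 := (hiff b hb2).1 hbM i hi
    simp [ℓ, AffineMap.lineMap_apply, h1, h2]

theorem exists_lipJoined_of_isConnected {M : Set E3} (hM : IsSmoothSubmanifold M)
    (hMconn : IsConnected M) {a b : E3} (ha : a ∈ M) (hb : b ∈ M) : ∃ C, LipJoined M C a b := by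
  refine hMconn.isPreconnected.induction₂ (fun a b => ∃ C, LipJoined M C a b) ?_ ?_ ?_ ha hb
  · intro p hp
    obtain ⟨K, U, hU, h⟩ := hM.locally_lipJoined hp
    filter_upwards [mem_nhdsWithin_of_mem_nhds hU, self_mem_nhdsWithin] with b hb hbM
    exact ⟨_, h p (mem_of_mem_nhds hU) hp b hb hbM⟩
  · rintro x y z - - - ⟨C, h⟩ ⟨D, h'⟩
    exact ⟨_, h.trans h'⟩
  · rintro x y - - ⟨C, h⟩
    exact ⟨C, h.symm⟩

/-- On a compact connected submanifold the intrinsic distance is controlled by the Euclidean one: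
locally this is seen in a chart, and away from the diagonal lengths are bounded by compactness. -/
theorem exists_uniform_lipJoined {M : Set E3} (hM : IsSmoothSubmanifold M) (hMc : IsCompact M)
    (hMconn : IsConnected M) :
    ∃ K : ℝ≥0, ∀ a ∈ M, ∀ b ∈ M, LipJoined M (K * nndist a b) a b := by
  suffices h : ∃ K : ℝ≥0, ∀ q ∈ M ×ˢ M, LipJoined M (K * nndist q.1 q.2) q.1 q.2 by
    obtain ⟨K, hK⟩ := h
    exact ⟨K, fun a ha b hb => hK (a, b) ⟨ha, hb⟩⟩
  refine (hMc.prod hMc).induction_on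
    (p := fun s => ∃ K : ℝ≥0, ∀ q ∈ s, q ∈ M ×ˢ M → LipJoined M (K * nndist q.1 q.2) q.1 q.2)
    ⟨0, fun q hq => hq.elim⟩ ?_ ?_ ?_ |>.imp fun K hK q hq => hK q hq hq
  · rintro s t hst ⟨K, hK⟩
    exact ⟨K, fun q hq => hK q (hst hq)⟩
  · rintro s t ⟨K, hK⟩ ⟨L, hL⟩
    refine ⟨max K L, fun q hq hqM => ?_⟩
    rcases hq with hq | hq
    · exact (hK q hq hqM).mono (mul_le_mul_left (le_max_left _ _) _)
    · exact (hL q hq hqM).mono (mul_le_mul_left (le_max_right _ _) _)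
  · rintro ⟨a₀, b₀⟩ ⟨ha₀, hb₀⟩
    obtain ⟨K, U, hU, hK⟩ := hM.locally_lipJoined ha₀
    by_cases hab : a₀ = b₀
    · subst hab
      exact ⟨U ×ˢ U, mem_nhdsWithin_of_mem_nhds (prod_mem_nhds hU hU), K,
        fun q hq hqM => hK _ hq.1 hqM.1 _ hq.2 hqM.2⟩
    · obtain ⟨L, V, hV, hL⟩ := hM.locally_lipJoined hb₀
      obtain ⟨C, hC⟩ := exists_lipJoined_of_isConnected hM hMconn ha₀ hb₀
      have hr : 0 < dist a₀ b₀ / 4 := by have := dist_pos.2 hab; positivity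
      set r := dist a₀ b₀ / 4 with hr_def
      refine ⟨(U ∩ Metric.ball a₀ r) ×ˢ (V ∩ Metric.ball b₀ r), mem_nhdsWithin_of_mem_nhds
        (prod_mem_nhds (inter_mem hU (Metric.ball_mem_nhds _ hr))
          (inter_mem hV (Metric.ball_mem_nhds _ hr))), ?_⟩
      let R : ℝ≥0 := ⟨r, hr.le⟩
      have hR : 0 < R := hr
      let D : ℝ≥0 := 2 * (2 * (K * R) + 2 * C) + 2 * (L * R)
      refine ⟨D / R, ?_⟩
      rintro ⟨a, b⟩ ⟨⟨haU, har⟩, hbV, hbr⟩ ⟨haM, hbM⟩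
      have h1 := hK a haU haM a₀ (mem_of_mem_nhds hU) ha₀
      have h2 := hL b₀ (mem_of_mem_nhds hV) hb₀ b hbV hbM
      have d1 : nndist a a₀ ≤ R := NNReal.coe_le_coe.1
        (show dist a a₀ ≤ r from (Metric.mem_ball.1 har).le)
      have d2 : nndist b₀ b ≤ R := NNReal.coe_le_coe.1
        (show dist b₀ b ≤ r from (Metric.mem_ball'.1 hbr).le)
      refine (((h1.mono (mul_le_mul_right d1 K)).trans hC).trans
        (h2.mono (mul_le_mul_right d2 L))).mono ?_
      have d3 : R ≤ nndist a b := by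
        have t1 := dist_triangle4 a₀ a b b₀
        have t2 : dist a₀ a < r := Metric.mem_ball'.1 har
        have t3 : dist b b₀ < r := Metric.mem_ball.1 hbr
        exact NNReal.coe_le_coe.1 (show r ≤ dist a b by linarith)
      calc D = D / R * R := (div_mul_cancel₀ D hR.ne').symm
        _ ≤ _ := mul_le_mul_right d3 _

/-! ### The recession function -/

theorem matNorm_nonneg (ξ : Mat3) : 0 ≤ matNorm ξ := Real.sqrt_nonneg _

theorem matNorm_smul {t : ℝ} (ht : 0 ≤ t) (ξ : Mat3) : matNorm (t • ξ) = t * matNorm ξ := by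
  have : ∑ i, ∑ j, (t • ξ) i j ^ 2 = t ^ 2 * ∑ i, ∑ j, ξ i j ^ 2 := by
    simp only [Matrix.smul_apply, smul_eq_mul, mul_pow, Finset.mul_sum]
  rw [matNorm, this, Real.sqrt_mul (sq_nonneg t), Real.sqrt_sq ht, matNorm]

theorem continuous_matNorm : Continuous matNorm := by
  unfold matNorm
  refine Real.continuous_sqrt.comp (continuous_finsetSum _ fun i _ =>
    continuous_finsetSum _ fun j _ => ?_)
  exact (continuous_id.matrix_elem i j).pow 2

theorem matNorm_le_of_forall_abs_le {ξ : Mat3} {B : ℝ} (h : ∀ i j, |ξ i j| ≤ B) :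
    matNorm ξ ≤ 3 * B := by
  have hB : 0 ≤ B := (abs_nonneg _).trans (h 0 0)
  refine Real.sqrt_le_iff.2 ⟨by positivity, ?_⟩
  calc ∑ i, ∑ j, ξ i j ^ 2 ≤ ∑ _i : Fin 3, ∑ _j : Fin 3, B ^ 2 :=
        Finset.sum_le_sum fun i _ => Finset.sum_le_sum fun j _ => sq_le_sq.2 (by
          rw [abs_of_nonneg hB]; exact h i j)
    _ = (3 * B) ^ 2 := by simp; ring

theorem matNorm_le_sum (ξ : Mat3) : matNorm ξ ≤ ∑ i, ∑ j, |ξ i j| := by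
  refine Real.sqrt_le_iff.2 ⟨Finset.sum_nonneg fun i _ => Finset.sum_nonneg fun j _ => abs_nonneg _,
    ?_⟩
  have h1 : ∀ i, ∑ j, ξ i j ^ 2 ≤ (∑ j, |ξ i j|) ^ 2 := fun i => by
    simp_rw [← sq_abs (ξ i _)]
    exact Finset.sum_sq_le_sq_sum_of_nonneg fun j _ => abs_nonneg _
  exact (Finset.sum_le_sum fun i _ => h1 i).trans
    (Finset.sum_sq_le_sq_sum_of_nonneg fun i _ => Finset.sum_nonneg fun j _ => abs_nonneg _)

/-- The properties of the recession function that enter the cell problem: it is a non-negative,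
periodic Carathéodory integrand with growth constant `β`. -/
structure IsCellIntegrand (g : E3 → Mat3 → ℝ) (β : ℝ) : Prop where
  nonneg : ∀ᵐ x, ∀ ξ, 0 ≤ g x ξ
  le : ∀ᵐ x, ∀ ξ, g x ξ ≤ β * matNorm ξ
  continuous : ∀ᵐ x, Continuous (g x)
  aemeasurable : ∀ ξ, AEMeasurable (fun x => g x ξ) volume
  periodic : IsPlanarPeriodic g

section

variable {f : E3 → Mat3 → ℝ} {x : E3} {α β : ℝ}

theorem recession_bounds (hα : 0 < α) (hβ : 0 < β)
    (h : ∀ ξ, α * matNorm ξ ≤ f x ξ ∧ f x ξ ≤ β * (1 + matNorm ξ)) (ξ : Mat3) :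
    ∀ᶠ t : ℝ in atTop, 0 ≤ f x (t • ξ) / t ∧ f x (t • ξ) / t ≤ β * (1 / t + matNorm ξ) := by
  filter_upwards [eventually_gt_atTop 0] with t ht
  have h' := h (t • ξ)
  rw [matNorm_smul ht.le] at h'
  have := matNorm_nonneg ξ
  refine ⟨div_nonneg (le_trans (by positivity) h'.1) ht.le, ?_⟩
  rw [div_le_iff₀ ht]
  refine h'.2.trans (le_of_eq ?_)
  field_simp

theorem recession_smul (hα : 0 < α) (hβ : 0 < β)
    (h : ∀ ξ, α * matNorm ξ ≤ f x ξ ∧ f x ξ ≤ β * (1 + matNorm ξ)) {s : ℝ} (hs : 0 < s)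
    (ξ : Mat3) : recession f x (s • ξ) = s * recession f x ξ := by
  have hb := recession_bounds hα hβ h ξ
  have hle : IsBoundedUnder (· ≤ ·) atTop fun t : ℝ => f x (t • ξ) / t := by
    refine ⟨β * (1 + matNorm ξ), ?_⟩
    rw [eventually_map]
    filter_upwards [hb, eventually_ge_atTop 1] with t ht ht1
    refine ht.2.trans ?_
    have : 1 / t ≤ 1 := by rw [div_le_one (by linarith)]; exact ht1
    gcongr
  have hge : IsBoundedUnder (· ≥ ·) atTop fun t : ℝ => f x (t • ξ) / t :=
    ⟨0, by rw [eventually_map]; filter_upwards [hb] with t ht using ht.1⟩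
  have hmap : map (fun t : ℝ => t * s) atTop = atTop := (OrderIso.mulRight₀ s hs).map_atTop
  have e1 : recession f x (s • ξ) =
      limsup (fun t : ℝ => s * (f x ((t * s) • ξ) / (t * s))) atTop := by
    unfold recession
    refine limsup_congr ?_
    filter_upwards [eventually_gt_atTop 0] with t ht
    rw [smul_smul]
    field_simp
  have e2 : limsup (fun t : ℝ => s * (f x ((t * s) • ξ) / (t * s))) atTop =
      limsup (fun t : ℝ => s * (f x (t • ξ) / t)) atTop := by
    conv_rhs => rw [← hmap]
    rfl
  have hle' : IsBoundedUnder (· ≤ ·) atTop fun t : ℝ => s * (f x (t • ξ) / t) := by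
    obtain ⟨b, hb⟩ := hle
    refine ⟨s * b, ?_⟩
    rw [eventually_map] at hb ⊢
    filter_upwards [hb] with t ht using mul_le_mul_of_nonneg_left ht hs.le
  have hge' : IsBoundedUnder (· ≥ ·) atTop fun t : ℝ => s * (f x (t • ξ) / t) :=
    ⟨0, by rw [eventually_map]; filter_upwards [hb] with t ht using mul_nonneg hs.le ht.1⟩
  rw [e1, e2, recession]
  exact ((OrderIso.mulLeft₀ s hs).limsup_apply hle hge.isCoboundedUnder_le hle'
    hge'.isCoboundedUnder_le).symm

/-- Under the rate hypothesis the upper limit defining the recession function is a limit. -/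
theorem tendsto_recession (hα : 0 < α) (hβ : 0 < β)
    (h : ∀ ξ, α * matNorm ξ ≤ f x ξ ∧ f x ξ ≤ β * (1 + matNorm ξ)) {C q : ℝ} (hq : 0 < q)
    (hr : ∀ ξ, |f x ξ - recession f x ξ| ≤ C * (1 + matNorm ξ ^ (1 - q))) (ξ : Mat3) :
    Tendsto (fun t : ℝ => f x (t • ξ) / t) atTop (𝓝 (recession f x ξ)) := by
  rw [tendsto_iff_dist_tendsto_zero]
  have hlim : Tendsto (fun t : ℝ => C * (t⁻¹ + t ^ (-q) * matNorm ξ ^ (1 - q))) atTop (𝓝 0) := by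
    have h1 := tendsto_inv_atTop_zero (𝕜 := ℝ)
    have h2 := (tendsto_rpow_neg_atTop hq).mul_const (matNorm ξ ^ (1 - q))
    simpa using (h1.add h2).const_mul C
  refine squeeze_zero' (Eventually.of_forall fun _ => dist_nonneg) ?_ hlim
  filter_upwards [eventually_gt_atTop 0] with t ht
  have h1 := hr (t • ξ)
  rw [recession_smul hα hβ h ht, matNorm_smul ht.le,
    Real.mul_rpow ht.le (matNorm_nonneg ξ)] at h1
  rw [Real.dist_eq]
  have e : f x (t • ξ) / t - recession f x ξ = (f x (t • ξ) - t * recession f x ξ) / t := by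
    field_simp
  rw [e, abs_div, abs_of_pos ht, div_le_iff₀ ht]
  refine h1.trans (le_of_eq ?_)
  have e2 : t ^ (1 - q) = t ^ (-q) * t := by
    rw [← Real.rpow_add_one ht.ne']; ring_nf
  rw [e2]
  field_simp

end

theorem isCellIntegrand_recession {f : E3 → Mat3 → ℝ} (hf : IsCaratheodory f)
    (h1 : IsPlanarPeriodic f) (h2 : HasLinearGrowth f) (h3 : IsUniformlyLipschitz f)
    (h4 : HasRecessionRate f) : ∃ β : ℝ, 0 < β ∧ IsCellIntegrand (recession f) β := by
  obtain ⟨α, β, hα, hβ, hg⟩ := h2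
  obtain ⟨L, hL, hLip⟩ := h3
  obtain ⟨C, q, hC, hq, hq1, hr⟩ := h4
  have hlim : ∀ᵐ x, ∀ ξ,
      Tendsto (fun t : ℝ => f x (t • ξ) / t) atTop (𝓝 (recession f x ξ)) := by
    filter_upwards [hg, hr] with x hx hx'
    exact tendsto_recession hα hβ hx hq hx'
  refine ⟨β, hβ, ?_, ?_, ?_, fun ξ => ?_, fun x ξ => ?_⟩
  · filter_upwards [hg, hlim] with x hx hx' ξ
    refine ge_of_tendsto (hx' ξ) ?_
    filter_upwards [recession_bounds hα hβ hx ξ] with t ht using ht.1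
  · filter_upwards [hg, hlim] with x hx hx' ξ
    have hb : Tendsto (fun t : ℝ => β * (1 / t + matNorm ξ)) atTop (𝓝 (β * (0 + matNorm ξ))) := by
      simpa using (((tendsto_inv_atTop_zero (𝕜 := ℝ)).add_const (matNorm ξ)).const_mul β)
    rw [zero_add] at hb
    refine le_of_tendsto_of_tendsto (hx' ξ) hb ?_
    filter_upwards [recession_bounds hα hβ hx ξ] with t ht using ht.2
  · filter_upwards [hLip, hlim] with x hx hx'
    have hlip : ∀ ξ η, |recession f x ξ - recession f x η| ≤ L * matNorm (ξ - η) := fun ξ η => by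
      refine le_of_tendsto ((hx' ξ).sub (hx' η)).abs ?_
      filter_upwards [eventually_gt_atTop 0] with t ht
      rw [← sub_div, abs_div, abs_of_pos ht, div_le_iff₀ ht]
      refine (hx _ _).trans (le_of_eq ?_)
      rw [← smul_sub, matNorm_smul ht.le]
      ring
    refine continuous_iff_continuousAt.2 fun η => ?_
    rw [ContinuousAt, tendsto_iff_dist_tendsto_zero]
    have h0 : Tendsto (fun ξ => L * matNorm (ξ - η)) (𝓝 η) (𝓝 0) := by
      have : Continuous fun ξ => L * matNorm (ξ - η) :=
        continuous_const.mul (continuous_matNorm.comp (continuous_id.sub continuous_const))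
      have h := this.tendsto η
      simpa [matNorm] using h
    exact squeeze_zero (fun _ => dist_nonneg) (fun ξ => hlip ξ η) h0
  · refine aemeasurable_of_tendsto_metrizable_ae atTop
      (f := fun (n : ℕ) x => f x ((n : ℝ) • ξ) / n) (fun n => (hf.1 _).div_const _) ?_
    filter_upwards [hlim] with x hx
    exact (hx ξ).comp tendsto_natCast_atTop_atTop
  · have e1 := fun t : ℝ => (h1 x (t • ξ)).1
    have e2 := fun t : ℝ => (h1 x (t • ξ)).2
    simp only [recession, e1, e2, and_self]

namespace IsCellIntegrand

variable {g : E3 → Mat3 → ℝ} {β : ℝ}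

theorem aemeasurable_comp_simpleFunc (hg : IsCellIntegrand g β) (G : SimpleFunc E3 Mat3) :
    AEMeasurable (fun x => g x (G x)) volume := by
  classical
  have : (fun x => g x (G x)) =
      fun x => ∑ c ∈ G.range, (G ⁻¹' {c}).indicator (fun x => g x c) x := by
    funext x
    rw [Finset.sum_eq_single (G x)]
    · exact (Set.indicator_of_mem (s := G ⁻¹' {G x}) rfl (fun x => g x (G x))).symm
    · intro c _ hc
      refine Set.indicator_of_notMem (s := G ⁻¹' {c}) ?_ (fun x => g x c)
      exact fun h => hc (Set.mem_singleton_iff.1 h).symm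
    · intro h
      exact absurd (G.mem_range_self x) h
  rw [this]
  exact Finset.aemeasurable_fun_sum _ fun c _ =>
    (hg.aemeasurable c).indicator (G.measurableSet_fiber c)

/-- Composition of the integrand with a measurable matrix field. -/
theorem aemeasurable_comp (hg : IsCellIntegrand g β) {A : Set E3} {G : E3 → Mat3}
    (hG : ∀ i j, AEStronglyMeasurable (fun x => G x i j) (volume.restrict A)) :
    AEMeasurable (fun x => g x (G x)) (volume.restrict A) := by
  have hG' : AEStronglyMeasurable G (volume.restrict A) := by
    have : G = fun x => ∑ i, ∑ j, G x i j • (Matrix.single i j 1 : Mat3) := by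
      funext x
      conv_lhs => rw [Matrix.matrix_eq_sum_single (G x)]
      simp [Matrix.smul_single]
    rw [this]
    exact Finset.aestronglyMeasurable_fun_sum _ fun i _ =>
      Finset.aestronglyMeasurable_fun_sum _ fun j _ => (hG i j).smul_const _
  have hm := hG'.stronglyMeasurable_mk
  have h1 : AEMeasurable (fun x => g x (hG'.mk G x)) (volume.restrict A) := by
    refine aemeasurable_of_tendsto_metrizable_ae atTop
      (f := fun (n : ℕ) x => g x (hm.approx n x))
      (fun n => (hg.aemeasurable_comp_simpleFunc _).restrict) (ae_restrict_of_ae ?_)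
    filter_upwards [hg.continuous] with x hx
    exact (hx.tendsto _).comp (hm.tendsto_approx x)
  refine h1.congr ?_
  filter_upwards [hG'.ae_eq_mk] with x hx
  rw [hx]

theorem integrableOn_comp (hg : IsCellIntegrand g β) {A : Set E3} {G : E3 → Mat3}
    (hG : ∀ i j, IntegrableOn (fun x => G x i j) A) :
    IntegrableOn (fun x => g x (G x)) A := by
  have hm := hg.aemeasurable_comp fun i j => (hG i j).aestronglyMeasurable
  have hb : IntegrableOn (fun x => |β| * ∑ i, ∑ j, |G x i j|) A :=
    (integrable_finsetSum _ fun i _ => integrable_finsetSum _ fun j _ => (hG i j).abs).const_mul _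
  refine hb.mono' hm.aestronglyMeasurable (ae_restrict_of_ae ?_)
  filter_upwards [hg.nonneg, hg.le] with x hx hx'
  rw [Real.norm_eq_abs, abs_of_nonneg (hx _)]
  refine (hx' _).trans ?_
  exact mul_le_mul (le_abs_self β) (matNorm_le_sum _) (matNorm_nonneg _) (abs_nonneg _)

theorem add_planar (hg : IsCellIntegrand g β) {c : E3}
    (hc : ∃ m n : ℤ, c = !₂[(m : ℝ), (n : ℝ), 0]) (x : E3) (ξ : Mat3) : g (x + c) ξ = g x ξ := by
  obtain ⟨m, n, rfl⟩ := hc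
  have key : ∀ e : E3, (∀ x, g (x + e) ξ = g x ξ) → ∀ (m : ℤ) x, g (x + m • e) ξ = g x ξ := by
    intro e he m
    induction m using Int.induction_on with
    | zero => simp
    | succ k ih =>
      intro x
      rw [add_smul, one_smul, ← add_assoc, he, ih]
    | pred k ih =>
      intro x
      rw [← he, sub_smul, one_smul, add_assoc, sub_add_cancel, ih]
  have e : (!₂[(m : ℝ), (n : ℝ), 0] : E3) =
      m • EuclideanSpace.single 0 1 + n • EuclideanSpace.single 1 1 := by
    ext i; fin_cases i <;> simp
  rw [e, ← add_assoc, key _ fun x => (hg.periodic x ξ).2, key _ fun x => (hg.periodic x ξ).1]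

end IsCellIntegrand

/-! ### Planar profiles -/

/-- The classical gradient of a map, `grad W x i j = ∂_j W_i (x)`. -/
noncomputable def grad (W : E3 → E3) (x : E3) : Mat3 :=
  Matrix.of fun i j => partialDeriv j (fun y => W y i) x

/-- A bounded map `W` of the planar variables that is, near each point `x` off the set `S`,
Lipschitz with constant `σ x`. The set `S` consists of finitely many vertical lines, which is
expressed through its projections to horizontal axes. -/
structure IsPlanarProfile (W : E3 → E3) (S : Set E3) (σ : E3 → ℝ≥0) : Prop where
  measurable : Measurable W
  bounded : ∃ B, ∀ x, ‖W x‖ ≤ B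
  planar : ∀ x y : E3, x 0 = y 0 → x 1 = y 1 → W x = W y
  lipAt : ∀ x ∉ S, LipAt (σ x) W x
  finite : ∀ ν : E2, ‖ν‖ = 1 → (coordNormal ν '' S).Finite
  measurable_slope : Measurable σ

theorem coordNormal_add (ν : E2) (x y : E3) :
    coordNormal ν (x + y) = coordNormal ν x + coordNormal ν y := by
  simp [coordNormal]; ring

theorem coordTangent_add (ν : E2) (x y : E3) :
    coordTangent ν (x + y) = coordTangent ν x + coordTangent ν y := by
  simp [coordTangent]; ring

theorem lipschitzWith_apply (i : Fin 3) : LipschitzWith 1 fun x : E3 => x i :=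
  LipschitzWith.of_dist_le_mul fun x y => by
    rw [NNReal.coe_one, one_mul, dist_eq_norm, dist_eq_norm]
    exact PiLp.norm_apply_le (x - y) i

namespace IsPlanarProfile

variable {W : E3 → E3} {S : Set E3} {σ : E3 → ℝ≥0}

theorem finite_tangent (h : IsPlanarProfile W S σ) {ν : E2} (hν : ‖ν‖ = 1) :
    (coordTangent ν '' S).Finite := by
  have := h.finite (perp ν) (by rwa [norm_perp])
  rwa [show coordNormal (perp ν) = coordTangent ν from funext fun x => coordNormal_perp ν x] at this

theorem shift (h : IsPlanarProfile W S σ) (c : E3) :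
    IsPlanarProfile (fun x => W (x + c)) ((fun x => x + c) ⁻¹' S) (fun x => σ (x + c)) where
  measurable := h.measurable.comp (measurable_add_const c)
  bounded := h.bounded.imp fun B hB x => hB _
  planar x y h0 h1 := h.planar _ _ (by simp [h0]) (by simp [h1])
  lipAt x hx := by
    have h1 : LipschitzWith 1 fun x : E3 => x + c :=
      LipschitzWith.of_dist_le_mul fun x y => by simp
    have h2 := (h.lipAt (x + c) hx).comp_lipschitz (g := fun x => x + c) h1
    rwa [mul_one] at h2
  measurable_slope := h.measurable_slope.comp (measurable_add_const c)
  finite ν hν := by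
    refine ((h.finite ν hν).image fun r => r - coordNormal ν c).subset ?_
    rintro _ ⟨x, hx, rfl⟩
    exact ⟨_, ⟨_, hx, rfl⟩, by simp only [coordNormal_add]; ring⟩

theorem grad_shift (W : E3 → E3) (c x : E3) :
    grad (fun x => W (x + c)) x = grad W (x + c) := by
  ext i j
  simp only [grad, Matrix.of_apply, partialDeriv]
  rw [fderiv_comp_add_right (f := fun y => W y i)]

theorem abs_grad_le (h : IsPlanarProfile W S σ) {x : E3} (hx : x ∉ S) (i j : Fin 3) :
    |grad W x i j| ≤ σ x := by
  have h1 := LipAt.lipschitz_comp (lipschitzWith_apply i) (h.lipAt x hx)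
  rw [one_mul] at h1
  have h2 := h1.abs_fderiv_apply_le (v := EuclideanSpace.single j 1)
  rw [PiLp.norm_single, norm_one, mul_one] at h2
  exact h2

theorem ae_notMem (h : IsPlanarProfile W S σ) : ∀ᵐ x, x ∉ S := by
  have hν : ‖(EuclideanSpace.single 0 1 : E2)‖ = 1 := by simp
  exact measure_eq_zero_iff_ae_notMem.1
    (volume_eq_zero_of_finite_coordTangent hν (h.finite_tangent hν))

theorem matNorm_grad_le (h : IsPlanarProfile W S σ) : ∀ᵐ x, matNorm (grad W x) ≤ 3 * σ x := by
  filter_upwards [h.ae_notMem] with x hx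
  exact matNorm_le_of_forall_abs_le (h.abs_grad_le hx)

theorem integrableOn_grad (h : IsPlanarProfile W S σ) {A : Set E3}
    (hσ : ∫⁻ x in A, σ x < ⊤) (i j : Fin 3) : IntegrableOn (fun x => grad W x i j) A := by
  refine ⟨(measurable_fderiv_apply_const ℝ _ _).aestronglyMeasurable, ?_⟩
  refine lt_of_le_of_lt (lintegral_mono_ae (ae_restrict_of_ae ?_)) hσ
  filter_upwards [h.ae_notMem] with x hx
  rw [← ofReal_norm, Real.norm_eq_abs, ← ENNReal.ofReal_coe_nnreal]
  exact ENNReal.ofReal_le_ofReal (h.abs_grad_le hx i j)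

theorem integrableOn (h : IsPlanarProfile W S σ) {A : Set E3} (hA : volume A < ⊤) :
    IntegrableOn W A := by
  obtain ⟨B, hB⟩ := h.bounded
  exact IntegrableOn.of_bound hA h.measurable.aestronglyMeasurable B (Eventually.of_forall hB)

/-- The trace of a planar profile is given by its values on the lateral boundary; the corner
lines `p = 0` may be disregarded. -/
theorem hasLateralTrace (h : IsPlanarProfile W S σ) {ν : E2} (hν : ‖ν‖ = 1) {t : ℝ} (ht : 0 < t)
    (hσ : ∫⁻ x in cylinder ν t, σ x < ⊤) {g : E3 → E3}
    (hg : ∀ p s z, (|p| = t / 2 ∧ |s| < t / 2 ∨ p ≠ 0 ∧ |p| < t / 2 ∧ |s| = t / 2) →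
      W (framePoint ν p s z) = g (framePoint ν p s z)) :
    HasLateralTrace ν t W (grad W) g := by
  intro ψ hψ i j
  obtain ⟨B, hB⟩ := h.bounded
  have hS : ∀ x ∉ S, ∃ C, LipAt C (fun y => W y i) x := fun x hx =>
    ⟨_, LipAt.lipschitz_comp (lipschitzWith_apply i) (h.lipAt x hx)⟩
  have key := gaussGreen_cylinder hν ht (w := fun x => W x i) hS (h.finite ν hν)
    (h.finite_tangent hν) ((by fun_prop : Measurable fun x : E3 => x i).comp h.measurable)
    (fun x => (PiLp.norm_apply_le (W x) i).trans (hB x))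
    (fun x y h0 h1 => by rw [h.planar x y h0 h1]) (fun j => h.integrableOn_grad hσ i j) hψ j
  refine key.trans ?_
  unfold lateralIntegral
  refine intervalIntegral.integral_congr_ae ?_
  have hne : ∀ r : ℝ, ∀ᵐ s : ℝ, s ≠ r := fun r => measure_eq_zero_iff_ae_notMem.1
    (measure_singleton r)
  filter_upwards [hne 0, hne (t / 2)] with s hs0 hst hs
  rw [Set.uIoc_of_le (by linarith)] at hs
  have hs' : |s| < t / 2 := abs_lt.2 ⟨hs.1, lt_of_le_of_ne hs.2 hst⟩
  have ht2 : |t / 2| = t / 2 := abs_of_pos (by linarith)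
  refine intervalIntegral.integral_congr fun z _ => ?_
  beta_reduce
  rw [hg (t / 2) s z (Or.inl ⟨ht2, hs'⟩), hg (-(t / 2)) s z (Or.inl ⟨by rw [abs_neg, ht2], hs'⟩),
    hg s (t / 2) z (Or.inr ⟨hs0, hs', ht2⟩),
    hg s (-(t / 2)) z (Or.inr ⟨hs0, hs', by rw [abs_neg, ht2]⟩)]

end IsPlanarProfile

/-! ### Transition profiles -/

/-- The profile that jumps from `0` to `1` across the graph `p = η s`, linearly over the
distance `h s` to both sides. Where `h` vanishes the jump is sharp. -/
noncomputable def transition (η h : ℝ → ℝ) (p s : ℝ) : ℝ :=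
  if h s ≤ p - η s then 1 else if p - η s ≤ -h s then 0 else (p - η s + h s) / (2 * h s)

/-- A bound for the slope of a transition profile whose graph `η` and half-width `h` have Lipschitz
constants `2` and `1`: near a point of the layer these contribute `3 / h` and `4 / h`. -/
noncomputable def transitionSlope (η h : ℝ → ℝ) (p s : ℝ) : ℝ≥0 :=
  if |p - η s| ≤ h s then 7 / (h s).toNNReal else 0

section

variable {η h : ℝ → ℝ} {p s : ℝ}

theorem transition_eq_one (h1 : h s ≤ p - η s) : transition η h p s = 1 := if_pos h1

theorem transition_eq_zero (h1 : p - η s < h s) (h2 : p - η s ≤ -h s) :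
    transition η h p s = 0 := by
  rw [transition, if_neg (not_le.2 h1), if_pos h2]

theorem transition_eq_clamp (hs : 0 < h s) :
    transition η h p s = max 0 (min 1 ((p - η s) / h s / 2 + 1 / 2)) := by
  have e : (p - η s) / h s / 2 + 1 / 2 = (p - η s + h s) / (2 * h s) := by field_simp
  rw [e]
  unfold transition
  split_ifs with h1 h2
  · rw [min_eq_left, max_eq_right zero_le_one]
    rw [le_div_iff₀ (by positivity)]; linarith
  · rw [max_eq_left]
    exact (min_le_right _ _).trans (div_nonpos_of_nonpos_of_nonneg (by linarith) (by positivity))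
  · push Not at h1 h2
    rw [min_eq_right, max_eq_right]
    · exact div_nonneg (by linarith) (by positivity)
    · rw [div_le_one (by positivity)]; linarith

theorem measurable_transition (hη : Continuous η) (hh : Continuous h) :
    Measurable fun q : ℝ × ℝ => transition η h q.1 q.2 := by
  unfold transition
  refine Measurable.ite (measurableSet_le ?_ ?_) measurable_const
    (Measurable.ite (measurableSet_le ?_ ?_) measurable_const ?_) <;> fun_prop

theorem measurable_transitionSlope (hη : Continuous η) (hh : Continuous h) :
    Measurable fun q : ℝ × ℝ => transitionSlope η h q.1 q.2 := by
  unfold transitionSlope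
  refine Measurable.ite (measurableSet_le ?_ ?_) ?_ measurable_const <;> fun_prop

theorem lipAt_transition (hη : LipschitzWith 2 η) (hh : LipschitzWith 1 h) (hh0 : ∀ s, 0 ≤ h s)
    (hps : ¬ (h s = 0 ∧ p = η s)) :
    LipAt (transitionSlope η h p s) (fun q : ℝ × ℝ => transition η h q.1 q.2) (p, s) := by
  have hηc := hη.continuous
  have hhc := hh.continuous
  by_cases hc : |p - η s| ≤ h s
  · have hpos : 0 < h s := (hh0 s).lt_of_ne fun h0 => hps ⟨h0.symm, by
      rw [← h0] at hc
      exact sub_eq_zero.1 (abs_nonpos_iff.1 hc)⟩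
    rw [transitionSlope, if_pos hc]
    refine ⟨{q | h s / 2 < h q.2 ∧ |q.1 - η q.2| < 2 * h s}, ?_, ?_⟩
    · refine IsOpen.mem_nhds ?_ ?_
      · have o1 : IsOpen {q : ℝ × ℝ | h s / 2 < h q.2} := isOpen_lt (by fun_prop) (by fun_prop)
        have o2 : IsOpen {q : ℝ × ℝ | |q.1 - η q.2| < 2 * h s} :=
          isOpen_lt (by fun_prop) (by fun_prop)
        exact o1.inter o2
      · exact ⟨by simp; linarith, by simp only; linarith⟩
    · refine LipschitzOnWith.of_dist_le_mul ?_
      rintro ⟨p₁, s₁⟩ ⟨h1, h2⟩ ⟨p₂, s₂⟩ ⟨k1, k2⟩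
      simp only at h1 h2 k1 k2 ⊢
      have hp1 : 0 < h s₁ := by linarith
      have hp2 : 0 < h s₂ := by linarith
      rw [transition_eq_clamp hp1, transition_eq_clamp hp2]
      have hcl : LipschitzWith 1 fun r : ℝ => max 0 (min 1 r) :=
        (LipschitzWith.id.const_min 1).const_max 0
      refine (hcl.dist_le_mul _ _).trans ?_
      rw [NNReal.coe_one, one_mul, Real.dist_eq, NNReal.coe_div, Real.coe_toNNReal _ hpos.le]
      set D := dist (p₁, s₁) (p₂, s₂) with hD
      have d1 : |p₁ - p₂| ≤ D := le_max_left _ _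
      have d2 : |s₁ - s₂| ≤ D := le_max_right _ _
      have e1 : |η s₁ - η s₂| ≤ 2 * D := by
        have := hη.dist_le_mul s₁ s₂
        rw [NNReal.coe_ofNat] at this
        exact this.trans (mul_le_mul_of_nonneg_left d2 zero_le_two)
      have e2 : |h s₂ - h s₁| ≤ D := by
        have := hh.dist_le_mul s₂ s₁
        rw [NNReal.coe_one, one_mul, dist_comm s₂] at this
        exact this.trans d2
      have hv : |(p₁ - η s₁) - (p₂ - η s₂)| ≤ 3 * D := by
        have : (p₁ - η s₁) - (p₂ - η s₂) = (p₁ - p₂) - (η s₁ - η s₂) := by ring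
        rw [this]
        exact (abs_sub _ _).trans (by linarith)
      have hD0 : 0 ≤ D := dist_nonneg
      have e : (p₁ - η s₁) / h s₁ / 2 + 1 / 2 - ((p₂ - η s₂) / h s₂ / 2 + 1 / 2) =
          ((p₁ - η s₁) - (p₂ - η s₂)) / h s₁ / 2 +
            (p₂ - η s₂) * (h s₂ - h s₁) / (h s₁ * h s₂) / 2 := by
        field_simp; ring
      rw [e]
      refine (abs_add_le _ _).trans ?_
      have t1 : |((p₁ - η s₁) - (p₂ - η s₂)) / h s₁ / 2| ≤ 3 * D / (h s / 2) / 2 := by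
        rw [abs_div, abs_div, abs_of_pos hp1, abs_two]
        gcongr
      have t2 : |(p₂ - η s₂) * (h s₂ - h s₁) / (h s₁ * h s₂) / 2| ≤
          2 * h s * D / (h s / 2 * (h s / 2)) / 2 := by
        rw [abs_div, abs_div, abs_of_pos (mul_pos hp1 hp2), abs_two, abs_mul]
        gcongr
      refine (add_le_add t1 t2).trans (le_of_eq ?_)
      push_cast
      field_simp
      ring
  · rw [transitionSlope, if_neg hc]
    push Not at hc
    rcases lt_abs.1 hc with h1 | h1
    · refine ⟨{q | h q.2 < q.1 - η q.2}, (isOpen_lt (by fun_prop) (by fun_prop)).mem_nhds h1, ?_⟩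
      refine LipschitzOnWith.of_dist_le_mul fun q hq r hr => ?_
      rw [transition_eq_one (le_of_lt hq), transition_eq_one (le_of_lt hr)]
      simp
    · have hq0 : ∀ q : ℝ × ℝ, q.1 - η q.2 < -h q.2 → transition η h q.1 q.2 = 0 := fun q hq =>
        transition_eq_zero (by have := hh0 q.2; linarith) hq.le
      refine ⟨{q | q.1 - η q.2 < -h q.2}, (isOpen_lt (by fun_prop) (by fun_prop)).mem_nhds
        (by show p - η s < -h s; linarith), ?_⟩
      refine LipschitzOnWith.of_dist_le_mul fun q hq r hr => ?_
      rw [hq0 q hq, hq0 r hr]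
      simp

/-- Across the interface the slope integrates to a universal constant. -/
theorem lintegral_transitionSlope_le (η h : ℝ → ℝ) (s : ℝ) :
    ∫⁻ p, transitionSlope η h p s ≤ 14 := by
  rcases le_or_gt (h s) 0 with hs | hs
  · have : ∀ p, transitionSlope η h p s = 0 := fun p => by
      simp [transitionSlope, Real.toNNReal_of_nonpos hs]
    simp [this]
  · have : ∀ p, (transitionSlope η h p s : ℝ≥0∞) =
        (Set.Icc (η s - h s) (η s + h s)).indicator
          (fun _ => ((7 / (h s).toNNReal : ℝ≥0) : ℝ≥0∞)) p := fun p => by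
      have : |p - η s| ≤ h s ↔ p ∈ Set.Icc (η s - h s) (η s + h s) := by
        rw [abs_le, Set.mem_Icc]; constructor <;> rintro ⟨h1, h2⟩ <;> constructor <;> linarith
      rw [transitionSlope, Set.indicator_apply]
      simp only [this]
      split_ifs <;> simp
    simp_rw [this]
    rw [lintegral_indicator measurableSet_Icc, setLIntegral_const, Real.volume_Icc,
      ENNReal.ofReal, ← ENNReal.coe_mul]
    have e : η s + h s - (η s - h s) = 2 * h s := by ring
    rw [e]
    have : (7 / (h s).toNNReal * (2 * h s).toNNReal : ℝ≥0) = 14 := by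
      rw [← NNReal.coe_inj]
      push_cast
      rw [Real.coe_toNNReal _ hs.le, Real.coe_toNNReal _ (by positivity)]
      field_simp; norm_num
    rw [this]
    norm_num

end

theorem coordNormal_sq_add (ν : E2) (hν : ‖ν‖ = 1) (x : E3) :
    coordNormal ν x ^ 2 + coordTangent ν x ^ 2 = x 0 ^ 2 + x 1 ^ 2 := by
  have := sq_add_sq_of_norm_eq_one hν
  simp only [coordNormal, coordTangent]
  linear_combination (x 0 ^ 2 + x 1 ^ 2) * this

theorem abs_coordNormal_le {ν : E2} (hν : ‖ν‖ = 1) (x : E3) : |coordNormal ν x| ≤ ‖x‖ := by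
  have h := coordNormal_sq_add ν hν x
  refine abs_le_of_sq_le_sq ?_ (norm_nonneg x)
  rw [EuclideanSpace.norm_sq_eq, Fin.sum_univ_three]
  simp only [Real.norm_eq_abs, sq_abs]
  nlinarith [sq_nonneg (coordTangent ν x), sq_nonneg (x 2)]

theorem abs_coordTangent_le {ν : E2} (hν : ‖ν‖ = 1) (x : E3) : |coordTangent ν x| ≤ ‖x‖ := by
  rw [← coordNormal_perp]
  exact abs_coordNormal_le (by rwa [norm_perp]) x

theorem lipschitzWith_coords {ν : E2} (hν : ‖ν‖ = 1) :
    LipschitzWith 1 fun x : E3 => (coordNormal ν x, coordTangent ν x) := by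
  refine LipschitzWith.of_dist_le_mul fun x y => ?_
  rw [NNReal.coe_one, one_mul, dist_eq_norm x y]
  have e1 : coordNormal ν x - coordNormal ν y = coordNormal ν (x - y) := by
    simp [coordNormal]; ring
  have e2 : coordTangent ν x - coordTangent ν y = coordTangent ν (x - y) := by
    simp [coordTangent]; ring
  refine max_le ?_ ?_
  · simp only [Real.dist_eq, e1]
    exact abs_coordNormal_le hν _
  · simp only [Real.dist_eq, e2]
    exact abs_coordTangent_le hν _

theorem setLIntegral_transitionSlope_le {ν : E2} (hν : ‖ν‖ = 1) {η h : ℝ → ℝ}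
    (hη : Continuous η) (hh : Continuous h) (A : Set ℝ) :
    ∫⁻ x in {x : E3 | coordTangent ν x ∈ A ∧ |x 2| < 1 / 2},
      transitionSlope η h (coordNormal ν x) (coordTangent ν x) ≤ 14 * volume A := by
  have hpre : (fun q : ℝ × ℝ × ℝ => framePoint ν q.1 q.2.1 q.2.2) ⁻¹'
      {x : E3 | coordTangent ν x ∈ A ∧ |x 2| < 1 / 2} =
      Set.univ ×ˢ A ×ˢ Set.Ioo (-(1 / 2) : ℝ) (1 / 2) := by
    ext ⟨p, s, z⟩
    simp [coordTangent_framePoint hν, abs_lt]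
  rw [← (measurePreserving_framePoint hν).setLIntegral_comp_preimage_emb
    (frameHomeomorph_measurableEmbedding hν), hpre]
  simp only [coordNormal_framePoint hν, coordTangent_framePoint hν]
  have hm := measurable_transitionSlope hη hh
  rw [Measure.volume_eq_prod, ← Measure.prod_restrict, lintegral_prod_symm]
  · simp only [Measure.restrict_univ]
    refine (lintegral_mono fun y : ℝ × ℝ => lintegral_transitionSlope_le η h y.1).trans ?_
    rw [lintegral_const, Measure.restrict_apply_univ, Measure.volume_eq_prod, Measure.prod_prod]
    simp only [Real.volume_Ioo]
    norm_num
  · exact (measurable_coe_nnreal_ennreal.comp (hm.comp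
      (by fun_prop : Measurable fun q : ℝ × ℝ × ℝ => (q.1, q.2.1)))).aemeasurable

/-! ### Interface maps -/

/-- A graph `p = η s` together with a half-width `h s` of the layer around it and a distance `k s`
to two further graphs `p = η s ± k s`. The layers of half-widths `h`, `k / 4`, `k / 4` around the
three graphs are disjoint where `k` is positive; they shrink to points where `h` and `k` vanish. -/
structure Interface where
  /-- The middle graph. -/
  η : ℝ → ℝ
  /-- The half-width of the middle layer. -/
  h : ℝ → ℝ
  /-- The distance of the outer graphs to the middle one. -/
  k : ℝ → ℝ
  lip_η : LipschitzWith 1 η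
  lip_h : LipschitzWith 1 h
  lip_k : LipschitzWith 1 k
  h_nonneg : ∀ s, 0 ≤ h s
  h_le : ∀ s, h s ≤ k s / 4
  finite : {s | h s = 0}.Finite

namespace Interface

variable (I : Interface)

theorem k_nonneg (s : ℝ) : 0 ≤ I.k s := by
  have := I.h_nonneg s
  have := I.h_le s
  linarith

/-- The slope of the three layers, weighted by Lipschitz constants `C₀`, `C₁`, `C₂` of the curves
along which the values run. -/
noncomputable def slope (ν : E2) (C₀ C₁ C₂ : ℝ≥0) (x : E3) : ℝ≥0 :=
  C₀ * transitionSlope I.η I.h (coordNormal ν x) (coordTangent ν x) +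
    C₁ * transitionSlope (fun s => I.η s + I.k s) (fun s => I.k s / 4)
      (coordNormal ν x) (coordTangent ν x) +
    C₂ * transitionSlope (fun s => I.η s - I.k s) (fun s => I.k s / 4)
      (coordNormal ν x) (coordTangent ν x)

/-- The map whose value runs along `Γ₂`, `Γ₀`, `Γ₁` across the lower, the middle and the upper
layer. The curves are joined at `b = Γ₂ 1 = Γ₀ 0` and `a = Γ₀ 1 = Γ₁ 0`. -/
noncomputable def map (ν : E2) (Γ₀ Γ₁ Γ₂ : ℝ → E3) (x : E3) : E3 :=
  Γ₀ (transition I.η I.h (coordNormal ν x) (coordTangent ν x)) +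
    (Γ₁ (transition (fun s => I.η s + I.k s) (fun s => I.k s / 4)
      (coordNormal ν x) (coordTangent ν x)) - Γ₁ 0) +
    (Γ₂ (transition (fun s => I.η s - I.k s) (fun s => I.k s / 4)
      (coordNormal ν x) (coordTangent ν x)) - Γ₂ 1)

/-- The vertical lines along which an interface map may be discontinuous. -/
def singularSet (ν : E2) : Set E3 :=
  {x | I.h (coordTangent ν x) = 0 ∧ coordNormal ν x = I.η (coordTangent ν x)}

theorem lip_k_div : LipschitzWith 1 fun s => I.k s / 4 :=
  LipschitzWith.of_dist_le_mul fun x y => by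
    have := I.lip_k.dist_le_mul x y
    rw [Real.dist_eq] at this ⊢
    rw [← sub_div, abs_div, abs_of_pos (by norm_num : (0 : ℝ) < 4)]
    have := abs_nonneg (I.k x - I.k y)
    linarith

theorem lip_add : LipschitzWith 2 fun s => I.η s + I.k s := by
  have := I.lip_η.add I.lip_k
  rwa [one_add_one_eq_two] at this

theorem lip_sub : LipschitzWith 2 fun s => I.η s - I.k s := by
  have := I.lip_η.sub I.lip_k
  rwa [one_add_one_eq_two] at this

variable {I} {ν : E2} {Γ₀ Γ₁ Γ₂ : ℝ → E3} {x : E3}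

theorem map_mem {M : Set E3} (h₀ : ∀ r, Γ₀ r ∈ M) (h₁ : ∀ r, Γ₁ r ∈ M) (h₂ : ∀ r, Γ₂ r ∈ M)
    (ha : Γ₁ 0 = Γ₀ 1) (hb : Γ₂ 1 = Γ₀ 0) : I.map ν Γ₀ Γ₁ Γ₂ x ∈ M := by
  set p := coordNormal ν x with hp
  set s := coordTangent ν x with hs
  have n1 := I.h_nonneg s
  have n2 := I.h_le s
  -- the layers are disjoint, hence at most one of the three values is inside of its curve
  rcases le_or_gt (I.h s) (p - I.η s) with c1 | c1
  · rw [map, ← hp, ← hs, transition_eq_one c1,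
      transition_eq_one (η := fun s => I.η s - I.k s) (h := fun s => I.k s / 4) (by linarith), ha]
    simpa using h₁ _
  have e1 : transition (fun s => I.η s + I.k s) (fun s => I.k s / 4) p s = 0 :=
    transition_eq_zero (by linarith) (by linarith)
  rcases le_or_gt (p - I.η s) (-I.h s) with c2 | c2
  · rw [map, ← hp, ← hs, transition_eq_zero c1 c2, e1, hb]
    simpa using h₂ _
  · rw [map, ← hp, ← hs, e1, transition_eq_one (h := fun s => I.k s / 4) (by linarith)]
    simpa using h₀ _

theorem map_eq_upper (ha : Γ₁ 0 = Γ₀ 1)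
    (hx : I.η (coordTangent ν x) + 5 / 4 * I.k (coordTangent ν x) ≤ coordNormal ν x) :
    I.map ν Γ₀ Γ₁ Γ₂ x = Γ₁ 1 := by
  set s := coordTangent ν x with hs
  have n1 := I.h_nonneg s
  have n2 := I.h_le s
  rw [map, ← hs, transition_eq_one (by linarith),
    transition_eq_one (h := fun s => I.k s / 4) (by linarith),
    transition_eq_one (h := fun s => I.k s / 4) (by linarith), ha]
  abel

theorem map_eq_lower (hb : Γ₂ 1 = Γ₀ 0)
    (hx : coordNormal ν x ≤ I.η (coordTangent ν x) - 5 / 4 * I.k (coordTangent ν x))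
    (hx' : coordNormal ν x < I.η (coordTangent ν x)) :
    I.map ν Γ₀ Γ₁ Γ₂ x = Γ₂ 0 := by
  set s := coordTangent ν x with hs
  have n1 := I.h_nonneg s
  have n2 := I.h_le s
  rw [map, ← hs, transition_eq_zero (by linarith) (by linarith),
    transition_eq_zero (h := fun s => I.k s / 4) (by linarith) (by linarith),
    transition_eq_zero (h := fun s => I.k s / 4) (by linarith) (by linarith), hb]
  abel

theorem map_eq_middle_upper
    (hk : 0 < I.k (coordTangent ν x))
    (hx : I.η (coordTangent ν x) + I.h (coordTangent ν x) ≤ coordNormal ν x)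
    (hx' : coordNormal ν x ≤ I.η (coordTangent ν x) + 3 / 4 * I.k (coordTangent ν x)) :
    I.map ν Γ₀ Γ₁ Γ₂ x = Γ₀ 1 := by
  set s := coordTangent ν x with hs
  have n1 := I.h_nonneg s
  rw [map, ← hs, transition_eq_one (by linarith),
    transition_eq_zero (h := fun s => I.k s / 4) (by linarith) (by linarith),
    transition_eq_one (h := fun s => I.k s / 4) (by linarith)]
  abel

theorem map_eq_middle_lower
    (hx : coordNormal ν x ≤ I.η (coordTangent ν x) - I.h (coordTangent ν x))
    (hx0 : coordNormal ν x < I.η (coordTangent ν x))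
    (hx' : I.η (coordTangent ν x) - 3 / 4 * I.k (coordTangent ν x) ≤ coordNormal ν x) :
    I.map ν Γ₀ Γ₁ Γ₂ x = Γ₀ 0 := by
  set s := coordTangent ν x with hs
  have n1 := I.h_nonneg s
  rw [map, ← hs, transition_eq_zero (by linarith) (by linarith),
    transition_eq_zero (h := fun s => I.k s / 4) (by linarith) (by linarith),
    transition_eq_one (h := fun s => I.k s / 4) (by linarith)]
  abel

theorem transition_mem_Icc {η h : ℝ → ℝ} {p s : ℝ} (hh : 0 ≤ h s) :
    transition η h p s ∈ Set.Icc (0 : ℝ) 1 := by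
  rcases hh.eq_or_lt with h0 | h0
  · unfold transition
    rw [← h0]
    split_ifs
    · simp
    · simp
    · simp
  · rw [transition_eq_clamp h0]
    exact ⟨le_max_left _ _, max_le zero_le_one (min_le_left _ _)⟩

theorem isPlanarProfile (hν : ‖ν‖ = 1) {C₀ C₁ C₂ : ℝ≥0} (h₀ : LipschitzWith C₀ Γ₀)
    (h₁ : LipschitzWith C₁ Γ₁) (h₂ : LipschitzWith C₂ Γ₂) :
    IsPlanarProfile (I.map ν Γ₀ Γ₁ Γ₂) (I.singularSet ν) (I.slope ν C₀ C₁ C₂) where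
  measurable := by
    have hc : Measurable fun x : E3 => (coordNormal ν x, coordTangent ν x) :=
      (lipschitzWith_coords hν).continuous.measurable
    have m0 := (measurable_transition I.lip_η.continuous I.lip_h.continuous).comp hc
    have m1 := (measurable_transition I.lip_add.continuous I.lip_k_div.continuous).comp hc
    have m2 := (measurable_transition I.lip_sub.continuous I.lip_k_div.continuous).comp hc
    exact ((h₀.continuous.measurable.comp m0).add
      ((h₁.continuous.measurable.comp m1).sub_const _)).add
      ((h₂.continuous.measurable.comp m2).sub_const _)
  bounded := by
    have hb : ∀ {C : ℝ≥0} {Γ : ℝ → E3}, LipschitzWith C Γ → ∀ r ∈ Set.Icc (0 : ℝ) 1,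
        ‖Γ r - Γ 0‖ ≤ C ∧ ‖Γ r - Γ 1‖ ≤ C := fun {C Γ} h r hr => by
      have e0 := h.dist_le_mul r 0
      have e1 := h.dist_le_mul r 1
      rw [dist_eq_norm, Real.dist_eq] at e0 e1
      have a0 : |r - 0| ≤ 1 := abs_le.2 ⟨by linarith [hr.1], by linarith [hr.2]⟩
      have a1 : |r - 1| ≤ 1 := abs_le.2 ⟨by linarith [hr.1], by linarith [hr.2]⟩
      exact ⟨e0.trans (mul_le_of_le_one_right C.2 a0), e1.trans (mul_le_of_le_one_right C.2 a1)⟩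
    refine ⟨‖Γ₀ 0‖ + C₀ + C₁ + C₂, fun x => ?_⟩
    set s := coordTangent ν x
    set p := coordNormal ν x
    have k0 := I.k_nonneg s
    have e0 := (hb h₀ _ (transition_mem_Icc (η := I.η) (p := p) (I.h_nonneg s))).1
    have e1 := (hb h₁ _ (transition_mem_Icc (η := fun s => I.η s + I.k s)
      (h := fun s => I.k s / 4) (p := p) (s := s) (by positivity))).1
    have e2 := (hb h₂ _ (transition_mem_Icc (η := fun s => I.η s - I.k s)
      (h := fun s => I.k s / 4) (p := p) (s := s) (by positivity))).2
    have e3 := norm_le_norm_add_norm_sub' (Γ₀ (transition I.η I.h p s)) (Γ₀ 0)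
    refine (norm_add₃_le).trans ?_
    linarith
  planar x y hx hy := by
    simp only [map, coordNormal, coordTangent, hx, hy]
  lipAt x hx := by
    have hc := lipschitzWith_coords hν
    have key : ∀ {C : ℝ≥0} {Γ : ℝ → E3} {η h : ℝ → ℝ}, LipschitzWith C Γ → LipschitzWith 2 η →
        LipschitzWith 1 h → (∀ s, 0 ≤ h s) →
        ¬ (h (coordTangent ν x) = 0 ∧ coordNormal ν x = η (coordTangent ν x)) → ∀ v : E3,
        LipAt (C * transitionSlope η h (coordNormal ν x) (coordTangent ν x))
          (fun x => Γ (transition η h (coordNormal ν x) (coordTangent ν x)) - v) x := by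
      intro C Γ η h hΓ hη hh hh0 hx v
      have e1 := (lipAt_transition hη hh hh0 hx).comp_lipschitz
        (g := fun x : E3 => (coordNormal ν x, coordTangent ν x)) hc
      rw [mul_one] at e1
      obtain ⟨N, hN, e2⟩ := e1.lipschitz_comp hΓ
      exact ⟨N, hN, by simpa using e2.sub (LipschitzWith.const v).lipschitzOnWith⟩
    have hk : I.k (coordTangent ν x) / 4 = 0 → I.h (coordTangent ν x) = 0 := fun h =>
      le_antisymm ((I.h_le _).trans h.le) (I.h_nonneg _)
    have k0 : ∀ s, 0 ≤ I.k s / 4 := fun s => by have := I.k_nonneg s; positivity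
    have l0 := key h₀ (I.lip_η.weaken one_le_two) I.lip_h I.h_nonneg hx 0
    have l1 := key h₁ I.lip_add I.lip_k_div k0 (fun h => hx ⟨hk h.1, by
      have h1 := h.1; have h2 := h.2; linarith⟩) (Γ₁ 0)
    have l2 := key h₂ I.lip_sub I.lip_k_div k0 (fun h => hx ⟨hk h.1, by
      have h1 := h.1; have h2 := h.2; linarith⟩) (Γ₂ 1)
    simp only [sub_zero] at l0
    exact (l0.add l1).add l2
  finite μ _ := by
    refine (I.finite.image fun s => coordNormal μ (framePoint ν (I.η s) s 0)).subset ?_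
    rintro _ ⟨x, hx, rfl⟩
    refine ⟨coordTangent ν x, hx.1, ?_⟩
    have e := framePoint_coord hν x
    rw [hx.2] at e
    conv_rhs => rw [← e]
    simp [coordNormal]
  measurable_slope := by
    have hc : Measurable fun x : E3 => (coordNormal ν x, coordTangent ν x) :=
      (lipschitzWith_coords hν).continuous.measurable
    have m0 := (measurable_transitionSlope I.lip_η.continuous I.lip_h.continuous).comp hc
    have m1 := (measurable_transitionSlope I.lip_add.continuous I.lip_k_div.continuous).comp hc
    have m2 := (measurable_transitionSlope I.lip_sub.continuous I.lip_k_div.continuous).comp hc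
    exact ((m0.const_mul C₀).add (m1.const_mul C₁)).add (m2.const_mul C₂)

/-- The integral of the slope of an interface map. The set `A` contains the tangential
coordinates that are met by the middle layer, the set `B` those met by the outer ones. -/
theorem lintegral_slope_le (I : Interface) (hν : ‖ν‖ = 1) (C₀ C₁ C₂ : ℝ≥0) {R : Set E3}
    {A B : Set ℝ}
    (hA : ∀ x ∈ R, |coordNormal ν x - I.η (coordTangent ν x)| ≤ I.h (coordTangent ν x) →
      coordTangent ν x ∈ A)
    (hB : ∀ x ∈ R, coordTangent ν x ∈ B) (hR : ∀ x ∈ R, |x 2| < 1 / 2)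
    (hAm : MeasurableSet A) (hRm : MeasurableSet R) :
    ∫⁻ x in R, I.slope ν C₀ C₁ C₂ x ≤ 14 * (C₀ * volume A + (C₁ + C₂) * volume B) := by
  have hc : Measurable fun x : E3 => (coordNormal ν x, coordTangent ν x) :=
    (lipschitzWith_coords hν).continuous.measurable
  have m0 : Measurable fun x : E3 =>
      (transitionSlope I.η I.h (coordNormal ν x) (coordTangent ν x) : ℝ≥0∞) :=
    measurable_coe_nnreal_ennreal.comp
    ((measurable_transitionSlope I.lip_η.continuous I.lip_h.continuous).comp hc)
  have m1 : Measurable fun x : E3 => (transitionSlope (fun s => I.η s + I.k s) (fun s => I.k s / 4)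
      (coordNormal ν x) (coordTangent ν x) : ℝ≥0∞) := measurable_coe_nnreal_ennreal.comp
    ((measurable_transitionSlope I.lip_add.continuous I.lip_k_div.continuous).comp hc)
  have m2 : Measurable fun x : E3 => (transitionSlope (fun s => I.η s - I.k s) (fun s => I.k s / 4)
      (coordNormal ν x) (coordTangent ν x) : ℝ≥0∞) := measurable_coe_nnreal_ennreal.comp
    ((measurable_transitionSlope I.lip_sub.continuous I.lip_k_div.continuous).comp hc)
  have i0 : ∫⁻ x in R, transitionSlope I.η I.h (coordNormal ν x) (coordTangent ν x) ≤
      14 * volume A := by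
    refine le_trans ?_ (setLIntegral_transitionSlope_le hν I.lip_η.continuous
      I.lip_h.continuous A)
    have hmS : MeasurableSet {x : E3 | coordTangent ν x ∈ A ∧ |x 2| < 1 / 2} :=
      ((continuous_coordTangent ν).measurable hAm).inter
        (isOpen_lt (by fun_prop : Continuous fun x : E3 => |x 2|) continuous_const).measurableSet
    rw [← lintegral_indicator hRm, ← lintegral_indicator hmS]
    refine lintegral_mono fun x => ?_
    by_cases hx : x ∈ R
    · rw [Set.indicator_of_mem hx]
      by_cases hx' : |coordNormal ν x - I.η (coordTangent ν x)| ≤ I.h (coordTangent ν x)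
      · rw [Set.indicator_of_mem (show x ∈ {x : E3 | coordTangent ν x ∈ A ∧ |x 2| < 1 / 2} from
          ⟨hA x hx hx', hR x hx⟩)]
      · simp [transitionSlope, hx']
    · rw [Set.indicator_of_notMem hx]
      exact zero_le
  have hsub : R ⊆ {x : E3 | coordTangent ν x ∈ B ∧ |x 2| < 1 / 2} := fun x hx =>
    ⟨hB x hx, hR x hx⟩
  have i1 := (lintegral_mono_set hsub).trans (setLIntegral_transitionSlope_le hν
    I.lip_add.continuous I.lip_k_div.continuous B)
  have i2 := (lintegral_mono_set hsub).trans (setLIntegral_transitionSlope_le hν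
    I.lip_sub.continuous I.lip_k_div.continuous B)
  unfold slope
  push_cast
  rw [lintegral_add_right _ (m2.const_mul _),
    lintegral_add_left (m0.const_mul _), lintegral_const_mul _ m0, lintegral_const_mul _ m1,
    lintegral_const_mul _ m2]
  refine (add_le_add_three (mul_le_mul_right i0 (C₀ : ℝ≥0∞)) (mul_le_mul_right i1 (C₁ : ℝ≥0∞))
    (mul_le_mul_right i2 (C₂ : ℝ≥0∞))).trans (le_of_eq ?_)
  ring

end Interface

/-! ### Replacing a map in disjoint cylinders -/

theorem integrableOn_mul_add_mul {A : Set E3} {φ : E3 → E3} {G : E3 → Mat3}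
    (hφ : IntegrableOn φ A) (hG : ∀ i j, IntegrableOn (fun x => G x i j) A)
    {U : Set E3} {ψ : E3 → ℝ} (hψ : IsTestFunction U ψ) (i j : Fin 3) :
    IntegrableOn (fun x => φ x i * partialDeriv j ψ x + G x i j * ψ x) A := by
  have hψ1 : ContDiff ℝ 1 ψ := hψ.1.of_le (by norm_num)
  obtain ⟨D, hD⟩ := hψ.2.1.exists_bound_of_continuous hψ1.continuous
  have hc : Continuous (partialDeriv j ψ) :=
    (hψ1.continuous_fderiv (by norm_num)).clm_apply continuous_const
  have hcs : HasCompactSupport (partialDeriv j ψ) := hψ.2.1.fderiv_apply (𝕜 := ℝ) _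
  obtain ⟨D', hD'⟩ := hcs.exists_bound_of_continuous hc
  have hφi : IntegrableOn (fun x => φ x i) A := (EuclideanSpace.proj (𝕜 := ℝ) i).integrable_comp hφ
  exact (hφi.mul_bdd (c := D') hc.aestronglyMeasurable (Eventually.of_forall hD')).add
    ((hG i j).mul_bdd (c := D) hψ1.continuous.aestronglyMeasurable (Eventually.of_forall hD))

theorem partialDeriv_shift (ψ : E3 → ℝ) (c : E3) (j : Fin 3) (x : E3) :
    partialDeriv j (fun y => ψ (y + c)) x = partialDeriv j ψ (x + c) := by
  rw [partialDeriv, partialDeriv, fderiv_comp_add_right]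

/-- Horizontal translations preserve test functions on the slab. -/
theorem IsTestFunction.shift {ψ : E3 → ℝ} (hψ : IsTestFunction {x | |x 2| < 1 / 2} ψ) {c : E3}
    (hc : c 2 = 0) : IsTestFunction {x | |x 2| < 1 / 2} fun x => ψ (x + c) := by
  refine ⟨hψ.1.comp (contDiff_id.add contDiff_const),
    hψ.2.1.comp_homeomorph (Homeomorph.addRight c), ?_⟩
  intro x hx
  have h1 : x + c ∈ tsupport ψ :=
    tsupport_comp_subset_preimage (f := fun x : E3 => x + c) ψ (by fun_prop) hx
  have h2 := hψ.2.2 h1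
  simpa [hc] using h2

theorem setIntegral_translate (A : Set E3) (c : E3) (H : E3 → ℝ) :
    ∫ x in (fun x => x - c) ⁻¹' A, H x = ∫ y in A, H (y + c) := by
  have h := (measurePreserving_add_right (volume : Measure E3) c).setIntegral_preimage_emb
    (MeasurableEquiv.addRight c).measurableEmbedding H ((fun x => x - c) ⁻¹' A)
  rw [← h]
  congr 2
  ext x
  simp

theorem integrableOn_translate {A : Set E3} {F : Type*} [NormedAddCommGroup F] (c : E3) {H : E3 → F}
    (hH : IntegrableOn H A) : IntegrableOn (fun x => H (x - c)) ((fun x => x - c) ⁻¹' A) :=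
  ((measurePreserving_sub_right (volume : Measure E3) c).integrableOn_comp_preimage
    (MeasurableEquiv.subRight c).measurableEmbedding).2 hH

open Classical in
/-- The map that equals a translate of `φ` in each of the translates of `A` by `c k`, `k ∈ F`,
and `W` elsewhere. -/
noncomputable def patch {ι V : Type*} (A : Set E3) (F : Finset ι) (c : ι → E3) (φ W : E3 → V)
    (x : E3) : V :=
  if h : ∃ k ∈ F, x - c k ∈ A then φ (x - c h.choose) else W x

section Patch

variable {ι V : Type*} {A : Set E3} {F : Finset ι} {c : ι → E3}

theorem patch_of_mem (hd : ∀ k ∈ F, ∀ l ∈ F, k ≠ l → ∀ x, x - c k ∈ A → x - c l ∉ A)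
    (φ W : E3 → V) {k : ι} (hk : k ∈ F) {x : E3} (hx : x - c k ∈ A) :
    patch A F c φ W x = φ (x - c k) := by
  have h : ∃ k ∈ F, x - c k ∈ A := ⟨k, hk, hx⟩
  rw [patch, dif_pos h]
  by_contra hne
  exact hd k hk _ h.choose_spec.1 (fun e => hne (by rw [← e])) x hx h.choose_spec.2

theorem patch_of_notMem (φ W : E3 → V) {x : E3} (hx : ∀ k ∈ F, x - c k ∉ A) :
    patch A F c φ W x = W x :=
  dif_neg fun ⟨k, hk, h⟩ => hx k hk h

/-- A quantity that is local in the map and its gradient splits into its value for the unpatched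
map and corrections in the translates. -/
theorem patch_eq_add_sum (hd : ∀ k ∈ F, ∀ l ∈ F, k ≠ l → ∀ x, x - c k ∈ A → x - c l ∉ A)
    {V' : Type*} (φ W : E3 → V) (G GW : E3 → V') (Q : E3 → V → V' → ℝ) (x : E3) :
    Q x (patch A F c φ W x) (patch A F c G GW x) = Q x (W x) (GW x) +
      ∑ k ∈ F, ((fun x => x - c k) ⁻¹' A).indicator
        (fun x => Q x (φ (x - c k)) (G (x - c k)) - Q x (W x) (GW x)) x := by
  by_cases h : ∃ k ∈ F, x - c k ∈ A
  · obtain ⟨k, hk, hx⟩ := h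
    rw [patch_of_mem hd _ _ hk hx, patch_of_mem hd _ _ hk hx, Finset.sum_eq_single_of_mem k hk,
      Set.indicator_of_mem (by exact hx)]
    · ring
    · intro l hl hlk
      exact Set.indicator_of_notMem (s := (fun x => x - c l) ⁻¹' A)
        (hd k hk l hl hlk.symm x hx) _
  · push Not at h
    rw [patch_of_notMem _ _ h, patch_of_notMem _ _ h, Finset.sum_eq_zero, add_zero]
    intro l hl
    exact Set.indicator_of_notMem (s := (fun x => x - c l) ⁻¹' A) (h l hl) _

end Patch

/-- The horizontal translates by `c k`, `k ∈ F`, of a cylinder are disjoint and contained in a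
larger cylinder. -/
structure IsPacking {ι : Type*} (ν : E2) (t : ℝ) (ν' : E2) (T : ℝ) (F : Finset ι)
    (c : ι → E3) : Prop where
  horizontal : ∀ k ∈ F, c k 2 = 0
  subset : ∀ k ∈ F, ∀ y ∈ cylinder ν t, y + c k ∈ cylinder ν' T
  disjoint : ∀ k ∈ F, ∀ l ∈ F, k ≠ l → ∀ x, x - c k ∈ cylinder ν t → x - c l ∉ cylinder ν t

namespace IsPacking

variable {ι : Type*} {ν ν' : E2} {t T : ℝ} {F : Finset ι} {c : ι → E3}

theorem preimage_subset (hp : IsPacking ν t ν' T F c) {k : ι} (hk : k ∈ F) :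
    (fun x => x - c k) ⁻¹' cylinder ν t ⊆ cylinder ν' T := fun x hx => by
  simpa using hp.subset k hk _ hx

theorem measurableSet_preimage (ν : E2) (t : ℝ) (c : E3) :
    MeasurableSet ((fun x => x - c) ⁻¹' cylinder ν t) :=
  ((isOpen_cylinder ν t).preimage (by fun_prop)).measurableSet

theorem integrableOn_patch {V : Type*} [NormedAddCommGroup V] (hp : IsPacking ν t ν' T F c)
    {φ W : E3 → V} (hφ : IntegrableOn φ (cylinder ν t)) (hW : IntegrableOn W (cylinder ν' T)) :
    IntegrableOn (patch (cylinder ν t) F c φ W) (cylinder ν' T) := by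
  set K : ι → Set E3 := fun k => (fun x => x - c k) ⁻¹' cylinder ν t with hK
  have hKm : MeasurableSet (⋃ k ∈ F, K k) :=
    Finset.measurableSet_biUnion _ fun k _ => measurableSet_preimage ν t (c k)
  have h1 : IntegrableOn (patch (cylinder ν t) F c φ W) (⋃ k ∈ F, K k) := by
    rw [integrableOn_finset_iUnion]
    intro k hk
    refine (integrableOn_translate (c k) hφ).congr_fun (fun x hx => ?_)
      (measurableSet_preimage ν t (c k))
    exact (patch_of_mem hp.disjoint φ W hk hx).symm
  have h2 : IntegrableOn (patch (cylinder ν t) F c φ W) (cylinder ν' T \ ⋃ k ∈ F, K k) := by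
    refine (hW.mono_set Set.sdiff_subset).congr_fun (fun x hx => ?_)
      ((isOpen_cylinder ν' T).measurableSet.diff hKm)
    refine (patch_of_notMem φ W fun k hk h => hx.2 ?_).symm
    exact Set.mem_biUnion hk h
  refine (h1.union h2).mono_set fun x hx => ?_
  by_cases h : x ∈ ⋃ k ∈ F, K k
  · exact Or.inl h
  · exact Or.inr ⟨hx, h⟩

/-- Maps with equal traces may be exchanged in the cylinders of a packing. -/
theorem hasLateralTrace_patch (hp : IsPacking ν t ν' T F c) {φ W g g' : E3 → E3}
    {G GW : E3 → Mat3} (hφi : IntegrableOn φ (cylinder ν t))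
    (hGi : ∀ i j, IntegrableOn (fun x => G x i j) (cylinder ν t))
    (hWi : IntegrableOn W (cylinder ν' T))
    (hGWi : ∀ i j, IntegrableOn (fun x => GW x i j) (cylinder ν' T))
    (hφ : HasLateralTrace ν t φ G g) (hW : HasLateralTrace ν' T W GW g')
    (hWk : ∀ k ∈ F, HasLateralTrace ν t (fun x => W (x + c k)) (fun x => GW (x + c k)) g) :
    HasLateralTrace ν' T (patch (cylinder ν t) F c φ W) (patch (cylinder ν t) F c G GW) g' := by
  intro ψ hψ i j
  rw [← hW ψ hψ i j]
  let Q : E3 → E3 → Mat3 → ℝ := fun x y ξ => y i * partialDeriv j ψ x + ξ i j * ψ x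
  have hsplit := fun x => patch_eq_add_sum hp.disjoint φ W G GW Q x
  simp only [Q] at hsplit
  simp only [hsplit]
  have hbase := integrableOn_mul_add_mul hWi hGWi hψ i j
  have htr : ∀ k ∈ F, IntegrableOn (fun x => φ (x - c k) i * partialDeriv j ψ x +
      G (x - c k) i j * ψ x) ((fun x => x - c k) ⁻¹' cylinder ν t) := fun k _ =>
    integrableOn_mul_add_mul (integrableOn_translate (c k) hφi)
      (fun i j => integrableOn_translate (c k) (hGi i j)) hψ i j
  have hdiff : ∀ k ∈ F, IntegrableOn (fun x => φ (x - c k) i * partialDeriv j ψ x +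
      G (x - c k) i j * ψ x - (W x i * partialDeriv j ψ x + GW x i j * ψ x))
      ((fun x => x - c k) ⁻¹' cylinder ν t) := fun k hk =>
    (htr k hk).sub (hbase.mono_set (hp.preimage_subset hk))
  have hind : ∀ k ∈ F, IntegrableOn (((fun x => x - c k) ⁻¹' cylinder ν t).indicator fun x =>
      φ (x - c k) i * partialDeriv j ψ x + G (x - c k) i j * ψ x -
        (W x i * partialDeriv j ψ x + GW x i j * ψ x)) (cylinder ν' T) := fun k hk =>
    ((integrable_indicator_iff (measurableSet_preimage ν t (c k))).2 (hdiff k hk)).integrableOn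
  rw [integral_add hbase (integrable_finsetSum _ hind), integral_finsetSum _ hind,
    Finset.sum_eq_zero, add_zero]
  intro k hk
  rw [setIntegral_indicator (measurableSet_preimage ν t (c k)),
    Set.inter_eq_self_of_subset_right (hp.preimage_subset hk),
    integral_sub (htr k hk) (hbase.mono_set (hp.preimage_subset hk)),
    setIntegral_translate, setIntegral_translate]
  have e1 := hφ _ (hψ.shift (hp.horizontal k hk)) i j
  have e2 := hWk k hk _ (hψ.shift (hp.horizontal k hk)) i j
  simp only [partialDeriv_shift] at e1 e2
  simp only [add_sub_cancel_right]
  rw [e1, e2, sub_self]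

end IsPacking

/-! ### Energy estimates -/

namespace IsCellIntegrand

variable {g : E3 → Mat3 → ℝ} {β : ℝ}

/-- The energy of a planar profile is controlled by its slope. -/
theorem setIntegral_grad_le (hg : IsCellIntegrand g β) (hβ : 0 ≤ β) {W : E3 → E3} {S : Set E3}
    {σ : E3 → ℝ≥0} (hW : IsPlanarProfile W S σ) {R : Set E3} {D : ℝ} (hD : 0 ≤ D)
    (hσ : ∫⁻ x in R, σ x ≤ ENNReal.ofReal D) :
    ∫ x in R, g x (grad W x) ≤ 3 * β * D := by
  have hm : AEStronglyMeasurable (fun x => (σ x : ℝ)) (volume.restrict R) :=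
    (measurable_coe_nnreal_real.comp hW.measurable_slope).aestronglyMeasurable
  have hint : IntegrableOn (fun x => (σ x : ℝ)) R := by
    refine ⟨hm, ?_⟩
    simp only [HasFiniteIntegral, Real.enorm_of_nonneg (NNReal.coe_nonneg _),
      ENNReal.ofReal_coe_nnreal]
    exact hσ.trans_lt ENNReal.ofReal_lt_top
  have h1 : ∫ x in R, g x (grad W x) ≤ ∫ x in R, 3 * β * (σ x : ℝ) := by
    refine integral_mono_of_nonneg (ae_restrict_of_ae ?_) (hint.const_mul _) (ae_restrict_of_ae ?_)
    · filter_upwards [hg.nonneg] with x hx using hx _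
    · filter_upwards [hg.le, hW.matNorm_grad_le] with x hx hx'
      refine (hx _).trans ?_
      have := mul_le_mul_of_nonneg_left hx' hβ
      linarith
  refine h1.trans ?_
  rw [integral_const_mul]
  refine mul_le_mul_of_nonneg_left ?_ (by positivity)
  rw [integral_eq_lintegral_of_nonneg_ae (Eventually.of_forall fun x => NNReal.coe_nonneg _) hm]
  simp only [ENNReal.ofReal_coe_nnreal]
  exact ENNReal.toReal_le_of_le_ofReal hD hσ

/-- The energy of a patched map, for a packing by translates that preserve the integrand. -/
theorem setIntegral_patch_le (hg : IsCellIntegrand g β) {ι : Type*} {ν ν' : E2} {t T : ℝ}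
    {F : Finset ι} {c : ι → E3} (hp : IsPacking ν t ν' T F c)
    (hc : ∀ k ∈ F, ∃ m n : ℤ, c k = !₂[(m : ℝ), (n : ℝ), 0]) {G GW : E3 → Mat3}
    (hGi : ∀ i j, IntegrableOn (fun x => G x i j) (cylinder ν t))
    (hGWi : ∀ i j, IntegrableOn (fun x => GW x i j) (cylinder ν' T)) :
    ∫ x in cylinder ν' T, g x (patch (cylinder ν t) F c G GW x) ≤
      F.card * (∫ x in cylinder ν t, g x (G x)) +
        ∫ x in cylinder ν' T \ ⋃ k ∈ F, (fun x => x - c k) ⁻¹' cylinder ν t, g x (GW x) := by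
  have hKm := fun k => IsPacking.measurableSet_preimage ν t (c k)
  have hUm : MeasurableSet (⋃ k ∈ F, (fun x => x - c k) ⁻¹' cylinder ν t) :=
    Finset.measurableSet_biUnion _ fun k _ => hKm k
  have hT := (isOpen_cylinder ν' T).measurableSet
  have hper : ∀ k ∈ F, ∀ x ξ, g (x + c k) ξ = g x ξ := fun k hk x ξ => hg.add_planar (hc k hk) x ξ
  have hGk : ∀ k ∈ F, IntegrableOn (fun x => g x (G (x - c k)))
      ((fun x => x - c k) ⁻¹' cylinder ν t) := fun k hk =>
    hg.integrableOn_comp fun i j => integrableOn_translate (c k) (hGi i j)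
  have hpi : ∀ k ∈ F, IntegrableOn (fun x => g x (patch (cylinder ν t) F c G GW x))
      ((fun x => x - c k) ⁻¹' cylinder ν t) := fun k hk =>
    (hGk k hk).congr_fun (fun x hx => by
      simp only [patch_of_mem hp.disjoint G GW hk hx]) (hKm k)
  have hrest : IntegrableOn (fun x => g x (patch (cylinder ν t) F c G GW x))
      (cylinder ν' T \ ⋃ k ∈ F, (fun x => x - c k) ⁻¹' cylinder ν t) := by
    refine ((hg.integrableOn_comp hGWi).mono_set Set.sdiff_subset).congr_fun (fun x hx => ?_)
      (hT.diff hUm)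
    beta_reduce
    rw [patch_of_notMem (A := cylinder ν t) G GW fun k hk h => hx.2 (Set.mem_biUnion hk h)]
  have hsub : (⋃ k ∈ F, (fun x => x - c k) ⁻¹' cylinder ν t) ⊆ cylinder ν' T :=
    Set.iUnion₂_subset fun k hk => hp.preimage_subset hk
  have hUi : IntegrableOn (fun x => g x (patch (cylinder ν t) F c G GW x))
      (⋃ k ∈ F, (fun x => x - c k) ⁻¹' cylinder ν t) := integrableOn_finset_iUnion.2 hpi
  rw [← Set.union_sdiff_cancel hsub, setIntegral_union Set.disjoint_sdiff_right (hT.diff hUm) hUi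
    hrest, Set.union_sdiff_cancel hsub]
  refine add_le_add (le_of_eq ?_) (le_of_eq ?_)
  · rw [integral_biUnion_finset F (fun k _ => hKm k) ?_ hpi, ← nsmul_eq_mul, ← Finset.sum_const]
    · refine Finset.sum_congr rfl fun k hk => ?_
      rw [setIntegral_congr_fun (hKm k) (g := fun x => g x (G (x - c k))) fun x hx => by
        simp only [patch_of_mem hp.disjoint G GW hk hx], setIntegral_translate]
      simp only [add_sub_cancel_right, hper k hk]
    · intro k hk l hl hkl
      exact Set.disjoint_left.2 fun x hx => hp.disjoint k hk l hl hkl x hx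
  · refine setIntegral_congr_fun (hT.diff hUm) fun x hx => ?_
    rw [patch_of_notMem (A := cylinder ν t) G GW fun k hk h => hx.2 (Set.mem_biUnion hk h)]

end IsCellIntegrand

/-! ### Interfaces with prescribed singular points -/

/-- A Lipschitz function that takes prescribed values on prescribed intervals. -/
theorem exists_lipschitz_eq_on_intervals {ι : Type*} (σ y r : ι → ℝ)
    (h : ∀ i j, i ≠ j → |y i - y j| ≤ (|σ i - σ j| - r i - r j) / 4) :
    ∃ η : ℝ → ℝ, LipschitzWith (1 / 4) η ∧ ∀ i s, |s - σ i| ≤ r i → η s = y i := by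
  classical
  have key : ∀ i j s s', |s - σ i| ≤ r i → |s' - σ j| ≤ r j → |y i - y j| ≤ |s - s'| / 4 := by
    intro i j s s' hi hj
    rcases eq_or_ne i j with rfl | hij
    · rw [sub_self, abs_zero]; positivity
    · have e := h i j hij
      have t1 : |σ i - σ j| ≤ |s - σ i| + |s - s'| + |s' - σ j| := by
        have : σ i - σ j = -(s - σ i) + (s - s') + (s' - σ j) := by ring
        rw [this]
        refine (abs_add_three _ _ _).trans ?_
        rw [abs_neg]
      linarith
  let f : ℝ → ℝ := fun s => if hs : ∃ i, |s - σ i| ≤ r i then y hs.choose else 0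
  have hf : ∀ i s, |s - σ i| ≤ r i → f s = y i := fun i s hs => by
    have hs' : ∃ i, |s - σ i| ≤ r i := ⟨i, hs⟩
    have := key _ i s s hs'.choose_spec hs
    rw [sub_self, abs_zero, zero_div] at this
    rw [show f s = y hs'.choose from dif_pos hs']
    exact sub_eq_zero.1 (abs_nonpos_iff.1 this)
  have hL : LipschitzOnWith (1 / 4) f {s | ∃ i, |s - σ i| ≤ r i} := by
    refine LipschitzOnWith.of_dist_le_mul ?_
    rintro s ⟨i, hi⟩ s' ⟨j, hj⟩
    rw [hf i s hi, hf j s' hj, Real.dist_eq, Real.dist_eq]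
    refine (key i j s s' hi hj).trans (le_of_eq ?_)
    push_cast; ring
  obtain ⟨η, hη, heq⟩ := hL.extend_real
  exact ⟨η, hη, fun i s hs => (heq ⟨i, hs⟩).symm.trans (hf i s hs)⟩

/-- The interface along the graph of `η` whose middle layer shrinks to a point exactly at the
tangential coordinates in `Z`, and whose outer layers shrink at those in `E`. -/
noncomputable def Interface.ofFinite (η : ℝ → ℝ) (hη : LipschitzWith 1 η) {t : ℝ} (ht : 0 < t)
    {Z E : Set ℝ} (hZ : Z.Finite) (hEZ : E ⊆ Z) (hE : E.Nonempty) : Interface where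
  η := η
  h s := min t (Metric.infDist s Z) / 4
  k s := min t (Metric.infDist s E)
  lip_η := hη
  lip_h := by
    have h1 := (Metric.lipschitz_infDist_pt Z).const_min t
    refine LipschitzWith.of_dist_le_mul fun x y => ?_
    have := h1.dist_le_mul x y
    rw [Real.dist_eq] at this ⊢
    rw [← sub_div, abs_div, abs_of_pos (by norm_num : (0 : ℝ) < 4)]
    have := abs_nonneg (min t (Metric.infDist x Z) - min t (Metric.infDist y Z))
    linarith
  lip_k := (Metric.lipschitz_infDist_pt E).const_min t
  h_nonneg s := by
    have := le_min ht.le (Metric.infDist_nonneg (x := s) (s := Z))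
    positivity
  h_le s := by
    have := min_le_min_left t (Metric.infDist_le_infDist_of_subset (x := s) hEZ hE)
    linarith
  finite := by
    refine hZ.subset fun s hs => ?_
    have h0 : min t (Metric.infDist s Z) = 0 := by
      have : min t (Metric.infDist s Z) / 4 = 0 := hs
      linarith
    have h1 : Metric.infDist s Z = 0 := by
      rcases min_choice t (Metric.infDist s Z) with h | h <;> linarith
    exact (hZ.isClosed.mem_iff_infDist_zero (hE.mono hEZ)).2 h1

/-! ### Tilings along a line -/

/-- The cosine of the angle between two unit vectors. -/
def cosAngle (ν ν' : E2) : ℝ := ν 0 * ν' 0 + ν 1 * ν' 1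

/-- The sine of the angle between two unit vectors. -/
def sinAngle (ν ν' : E2) : ℝ := ν 1 * ν' 0 - ν 0 * ν' 1

theorem coordNormal_eq (ν : E2) {ν' : E2} (hν' : ‖ν'‖ = 1) (x : E3) :
    coordNormal ν x = cosAngle ν ν' * coordNormal ν' x + sinAngle ν ν' * coordTangent ν' x := by
  have := sq_add_sq_of_norm_eq_one hν'
  simp only [coordNormal, coordTangent, cosAngle, sinAngle]
  linear_combination -(x 0 * ν 0 + x 1 * ν 1) * this

theorem coordTangent_eq (ν : E2) {ν' : E2} (hν' : ‖ν'‖ = 1) (x : E3) :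
    coordTangent ν x = -sinAngle ν ν' * coordNormal ν' x + cosAngle ν ν' * coordTangent ν' x := by
  have := sq_add_sq_of_norm_eq_one hν'
  simp only [coordNormal, coordTangent, cosAngle, sinAngle]
  linear_combination (x 0 * ν 1 - x 1 * ν 0) * this

theorem cosAngle_comm (ν ν' : E2) : cosAngle ν' ν = cosAngle ν ν' := by
  simp only [cosAngle]; ring

theorem sinAngle_comm (ν ν' : E2) : sinAngle ν' ν = -sinAngle ν ν' := by
  simp only [sinAngle]; ring

/-- The spacing of the cells of size `t` in a tiling along a line, when the angle between the line
and the sides of the cells is of order `δ`. The summand `15` and the factor `5` leave room for the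
rounding of the centres and for a graph of slope `1 / 4` between neighbouring cells. -/
noncomputable def spacing (δ t : ℝ) : ℝ := (t + 15) / (1 - 5 * δ)

/-- The `k`-th centre of the tiling: the integer point nearest to the point at distance `k τ` from
the origin on the line orthogonal to `ν'`. -/
noncomputable def center (ν' : E2) (τ : ℝ) (k : ℤ) : E3 :=
  !₂[((round (-(k * τ * ν' 1)) : ℤ) : ℝ), ((round (k * τ * ν' 0) : ℤ) : ℝ), 0]

theorem abs_apply_le_one {ν : E2} (hν : ‖ν‖ = 1) (i : Fin 2) : |ν i| ≤ 1 := by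
  have := PiLp.norm_apply_le ν i
  rwa [hν] at this

theorem abs_coordNormal_center_sub_le {ν : E2} (hν : ‖ν‖ = 1) (ν' : E2)
    (τ : ℝ) (k : ℤ) : |coordNormal ν (center ν' τ k) - sinAngle ν ν' * (k * τ)| ≤ 1 := by
  have e0 := abs_sub_round (-(k * τ * ν' 1))
  have e1 := abs_sub_round (k * τ * ν' 0)
  have n0 := abs_apply_le_one hν 0
  have n1 := abs_apply_le_one hν 1
  set a := ((round (-(k * τ * ν' 1)) : ℤ) : ℝ) with ha
  set b := ((round (k * τ * ν' 0) : ℤ) : ℝ) with hb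
  have e : coordNormal ν (center ν' τ k) - sinAngle ν ν' * (k * τ) =
      -((-(k * τ * ν' 1) - a) * ν 0) - (k * τ * ν' 0 - b) * ν 1 := by
    simp only [coordNormal, center, sinAngle, PiLp.toLp_apply, Matrix.cons_val_zero,
      Matrix.cons_val_one, ← ha, ← hb]
    ring
  rw [e]
  refine (abs_sub _ _).trans ?_
  rw [abs_neg, abs_mul, abs_mul]
  have h0 := mul_le_mul e0 n0 (abs_nonneg _) (by norm_num)
  have h1 := mul_le_mul e1 n1 (abs_nonneg _) (by norm_num)
  linarith

theorem abs_coordTangent_center_sub_le {ν : E2} (hν : ‖ν‖ = 1) (ν' : E2)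
    (τ : ℝ) (k : ℤ) : |coordTangent ν (center ν' τ k) - cosAngle ν ν' * (k * τ)| ≤ 1 := by
  have h := abs_coordNormal_center_sub_le (ν := perp ν) (by rwa [norm_perp]) ν' τ k
  rw [coordNormal_perp] at h
  have : sinAngle (perp ν) ν' = cosAngle ν ν' := by
    simp [sinAngle, cosAngle]
  rwa [this] at h

/-- The parameters of a tiling of a large cylinder of size `T` and normal `ν'` by `2 n + 1` small
cylinders of size `t` and normal `ν`, where the angle between the normals is of order `δ`. The length `T / 2` is
between `n + 2` and `n + 3` spacings, so that the small cells stay away from the ends. -/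
structure Tiling (ν ν' : E2) (δ t T : ℝ) (n : ℕ) : Prop where
  norm_eq : ‖ν‖ = 1
  norm_eq' : ‖ν'‖ = 1
  nonneg : 0 ≤ δ
  small : δ ≤ 1 / 20
  abs_sin_le : |sinAngle ν ν'| ≤ δ
  le_cos : 1 - δ ≤ cosAngle ν ν'
  cos_le : cosAngle ν ν' ≤ 1
  pos : 0 < t
  large : 8 * t ≤ T
  le_size : (n + 2) * spacing δ t ≤ T / 2
  size_le : T / 2 ≤ (n + 3) * spacing δ t

namespace Tiling

variable {ν ν' : E2} {δ t T : ℝ} {n : ℕ}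

theorem spacing_mul (D : Tiling ν ν' δ t T n) : spacing δ t * (1 - 5 * δ) = t + 15 := by
  have := D.small
  rw [spacing, div_mul_cancel₀]
  linarith

theorem le_spacing (D : Tiling ν ν' δ t T n) : t + 15 ≤ spacing δ t := by
  have h := D.spacing_mul
  have h1 := D.small
  have h2 := D.nonneg
  have h3 := D.pos
  have : 0 < spacing δ t := by
    rw [spacing]; exact div_pos (by linarith) (by linarith)
  nlinarith

/-- The index range of the tiling. -/
noncomputable def index (n : ℕ) : Finset ℤ := Finset.Icc (-(n : ℤ)) n

theorem mem_index {n : ℕ} {k : ℤ} : k ∈ index n ↔ |k| ≤ n := by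
  rw [index, Finset.mem_Icc, abs_le]

theorem card_index (n : ℕ) : ((index n).card : ℝ) = 2 * n + 1 := by
  have : (index n).card = 2 * n + 1 := by
    simp [index]; omega
  rw [this]; push_cast; ring

theorem abs_mul_spacing_le (D : Tiling ν ν' δ t T n) {k : ℤ} (hk : k ∈ index n) :
    |(k : ℝ) * spacing δ t| ≤ n * spacing δ t := by
  have h1 := D.le_spacing
  have h2 := D.pos
  rw [abs_mul, abs_of_pos (by linarith : 0 < spacing δ t)]
  refine mul_le_mul_of_nonneg_right ?_ (by linarith)
  have := mem_index.1 hk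
  exact_mod_cast this

/-- The tangential coordinates of different centres are separated. -/
theorem lt_abs_sub (D : Tiling ν ν' δ t T n) {k l : ℤ} (hkl : k ≠ l) :
    t < |coordTangent ν (center ν' (spacing δ t) k) -
      coordTangent ν (center ν' (spacing δ t) l)| := by
  have e1 := abs_coordTangent_center_sub_le D.norm_eq ν' (spacing δ t) k
  have e2 := abs_coordTangent_center_sub_le D.norm_eq ν' (spacing δ t) l
  set τ := spacing δ t
  set x := coordTangent ν (center ν' τ k)
  set y := coordTangent ν (center ν' τ l)
  have h1 := D.le_spacing
  have h2 := D.pos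
  have h3 := D.spacing_mul
  have h4 := D.le_cos
  have h5 := D.nonneg
  have h6 : (1 : ℝ) ≤ |(k : ℝ) - l| := by
    have : (1 : ℤ) ≤ |k - l| := Int.one_le_abs (sub_ne_zero.2 hkl)
    exact_mod_cast this
  have h7 : t + 15 ≤ cosAngle ν ν' * (|(k : ℝ) - l| * τ) := by
    have e3 : t + 15 ≤ cosAngle ν ν' * τ := by nlinarith
    have e4 : 0 ≤ cosAngle ν ν' * τ := by linarith
    nlinarith
  have h8 : |cosAngle ν ν' * (k * τ) - cosAngle ν ν' * (l * τ)| =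
      cosAngle ν ν' * (|(k : ℝ) - l| * τ) := by
    rw [← mul_sub, ← sub_mul, abs_mul, abs_mul,
      abs_of_pos (by linarith [D.small] : 0 < cosAngle ν ν'),
      abs_of_pos (by linarith : 0 < τ)]
  have h9 : |cosAngle ν ν' * (k * τ) - cosAngle ν ν' * (l * τ)| ≤
      |x - cosAngle ν ν' * (k * τ)| + |x - y| + |y - cosAngle ν ν' * (l * τ)| := by
    have : cosAngle ν ν' * (k * τ) - cosAngle ν ν' * (l * τ) =
        -(x - cosAngle ν ν' * (k * τ)) + (x - y) + (y - cosAngle ν ν' * (l * τ)) := by ring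
    rw [this]
    refine (abs_add_three _ _ _).trans ?_
    rw [abs_neg]
  linarith

theorem isPacking (D : Tiling ν ν' δ t T n) :
    IsPacking ν t ν' T (index n) (center ν' (spacing δ t)) where
  horizontal k _ := by simp [center]
  subset k hk y hy := by
    have h1 := D.le_spacing
    have h2 := D.pos
    have e1 := abs_coordNormal_center_sub_le D.norm_eq' ν' (spacing δ t) k
    have e2 := abs_coordTangent_center_sub_le D.norm_eq' ν' (spacing δ t) k
    have c1 : cosAngle ν' ν' = 1 := by
      have := sq_add_sq_of_norm_eq_one D.norm_eq'
      rw [cosAngle]; linarith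
    have c2 : sinAngle ν' ν' = 0 := by rw [sinAngle]; ring
    rw [c1, one_mul] at e2
    rw [c2, zero_mul, sub_zero] at e1
    have e3 := D.abs_mul_spacing_le hk
    have e4 := D.le_size
    obtain ⟨y1, y2, y3⟩ := hy
    have cs : |cosAngle ν' ν| ≤ 1 := by
      rw [cosAngle_comm, abs_le]
      exact ⟨by linarith [D.le_cos, D.small], D.cos_le⟩
    have sn : |sinAngle ν' ν| ≤ 1 := by
      rw [sinAngle_comm, abs_neg]
      linarith [D.abs_sin_le, D.small]
    have b : ∀ c s : ℝ, |c| ≤ 1 → |s| ≤ 1 →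
        |c * coordNormal ν y + s * coordTangent ν y| ≤ t := fun c s hc hs => by
      refine (abs_add_le _ _).trans ?_
      rw [abs_mul, abs_mul]
      have := mul_le_of_le_one_left (abs_nonneg (coordNormal ν y)) hc
      have := mul_le_of_le_one_left (abs_nonneg (coordTangent ν y)) hs
      linarith
    have n0 : (0 : ℝ) ≤ n * spacing δ t := mul_nonneg (Nat.cast_nonneg n) (by linarith)
    refine ⟨?_, ?_, ?_⟩
    · rw [coordNormal_add, coordNormal_eq ν' D.norm_eq]
      refine (abs_add_le _ _).trans_lt ?_
      have := b _ _ cs sn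
      linarith
    · rw [coordTangent_add, coordTangent_eq ν' D.norm_eq]
      refine (abs_add_le _ _).trans_lt ?_
      have := b _ _ (by rwa [abs_neg] : |-sinAngle ν' ν| ≤ 1) cs
      have e5 := abs_add_le (coordTangent ν' (center ν' (spacing δ t) k) - k * spacing δ t)
        (k * spacing δ t)
      rw [sub_add_cancel] at e5
      linarith
    · simpa [center] using y3
  disjoint k _ l _ hkl x hx hx' := by
    have h := D.lt_abs_sub hkl
    have e1 := hx.2.1
    have e2 := hx'.2.1
    have s1 : ∀ c : E3, coordTangent ν (x - c) = coordTangent ν x - coordTangent ν c := fun c => by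
      simp [coordTangent]; ring
    rw [s1] at e1 e2
    have := abs_sub_le (coordTangent ν (center ν' (spacing δ t) k)) (coordTangent ν x)
      (coordTangent ν (center ν' (spacing δ t) l))
    rw [abs_sub_comm _ (coordTangent ν x)] at this
    linarith

end Tiling

/-! ### The interface of a tiling -/

namespace Tiling

variable {ν ν' : E2} {δ t T : ℝ} {n : ℕ}

/-- The position along the line: the centres of the tiling, and beyond them the end points
`±T / 2`. -/
noncomputable def siteParam (T τ : ℝ) (n : ℕ) (j : ℤ) : ℝ :=
  if j ∈ index n then j * τ else if 0 < j then T / 2 else -(T / 2)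

theorem siteParam_separated (D : Tiling ν ν' δ t T n) {i j : ℤ} (hij : i ≠ j) :
    (i ∉ index n ∧ j ∉ index n ∧
      siteParam T (spacing δ t) n i = siteParam T (spacing δ t) n j) ∨
    spacing δ t ≤ |siteParam T (spacing δ t) n i - siteParam T (spacing δ t) n j| := by
  have h1 := D.le_spacing
  have h2 := D.pos
  have h3 := D.le_size
  have h4 : (0 : ℝ) ≤ n * spacing δ t := mul_nonneg (Nat.cast_nonneg n) (by linarith)
  have hin : ∀ i ∈ index n, -(n * spacing δ t) ≤ i * spacing δ t ∧
      i * spacing δ t ≤ n * spacing δ t := fun i hi => abs_le.1 (D.abs_mul_spacing_le hi)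
  unfold siteParam
  by_cases hi : i ∈ index n <;> by_cases hj : j ∈ index n
  · right
    rw [if_pos hi, if_pos hj, ← sub_mul, abs_mul, abs_of_pos (by linarith : 0 < spacing δ t)]
    have : (1 : ℝ) ≤ |(i : ℝ) - j| := by
      have : (1 : ℤ) ≤ |i - j| := Int.one_le_abs (sub_ne_zero.2 hij)
      exact_mod_cast this
    nlinarith
  · right
    have := hin i hi
    rw [if_pos hi, if_neg hj, le_abs]
    split_ifs
    · right; linarith
    · left; linarith
  · right
    have := hin j hj
    rw [if_neg hi, if_pos hj, le_abs]
    split_ifs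
    · left; linarith
    · right; linarith
  · rw [if_neg hi, if_neg hj]
    split_ifs
    · exact Or.inl ⟨hi, hj, rfl⟩
    · right; rw [le_abs]; left; linarith
    · right; rw [le_abs]; right; linarith
    · exact Or.inl ⟨hi, hj, rfl⟩

theorem abs_sinAngle_mul_le (D : Tiling ν ν' δ t T n) (r : ℝ) :
    |sinAngle ν ν' * r| ≤ δ * |r| := by
  rw [abs_mul]; exact mul_le_mul_of_nonneg_right D.abs_sin_le (abs_nonneg r)

theorem le_abs_cosAngle_mul (D : Tiling ν ν' δ t T n) (r : ℝ) :
    (1 - δ) * |r| ≤ |cosAngle ν ν' * r| := by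
  rw [abs_mul, abs_of_pos (by linarith [D.le_cos, D.small] : 0 < cosAngle ν ν')]
  exact mul_le_mul_of_nonneg_right D.le_cos (abs_nonneg r)

/-- There is a graph of small slope through all small cells, along their middle lines, that ends
in the middles of the tangential faces of the large cell. -/
theorem exists_graph (D : Tiling ν ν' δ t T n) :
    ∃ η : ℝ → ℝ, LipschitzWith (1 / 4) η ∧
      (∀ k ∈ index n, ∀ s, |s - coordTangent ν (center ν' (spacing δ t) k)| ≤ t / 2 →
        η s = coordNormal ν (center ν' (spacing δ t) k)) ∧
      η (cosAngle ν ν' * (T / 2)) = sinAngle ν ν' * (T / 2) ∧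
      η (-(cosAngle ν ν' * (T / 2))) = -(sinAngle ν ν' * (T / 2)) := by
  set τ := spacing δ t with hτ
  set κ := siteParam T τ n with hκ
  let σ : ℤ → ℝ := fun j => if j ∈ index n then coordTangent ν (center ν' τ j) else
    cosAngle ν ν' * κ j
  let y : ℤ → ℝ := fun j => if j ∈ index n then coordNormal ν (center ν' τ j) else
    sinAngle ν ν' * κ j
  let r : ℤ → ℝ := fun j => if j ∈ index n then t / 2 else 0
  have hσ : ∀ j, |σ j - cosAngle ν ν' * κ j| ≤ 1 := fun j => by
    by_cases hj : j ∈ index n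
    · simp only [σ, κ, siteParam, if_pos hj]
      exact abs_coordTangent_center_sub_le D.norm_eq ν' τ j
    · simp [σ, if_neg hj]
  have hy : ∀ j, |y j - sinAngle ν ν' * κ j| ≤ 1 := fun j => by
    by_cases hj : j ∈ index n
    · simp only [y, κ, siteParam, if_pos hj]
      exact abs_coordNormal_center_sub_le D.norm_eq ν' τ j
    · simp [y, if_neg hj]
  have hr : ∀ j, r j ≤ t / 2 := fun j => by
    have := D.pos
    by_cases hj : j ∈ index n
    · simp [r, if_pos hj]
    · simp only [r, if_neg hj]; linarith
  obtain ⟨η, hη, h⟩ := exists_lipschitz_eq_on_intervals σ y r (fun i j hij => by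
    rcases D.siteParam_separated hij with ⟨hi, hj, e⟩ | e
    · simp only [σ, y, r, if_neg hi, if_neg hj, hκ, hτ, e]
      simp
    · have e1 := D.abs_sinAngle_mul_le (κ i - κ j)
      have e2 := D.le_abs_cosAngle_mul (κ i - κ j)
      have e3 := hσ i
      have e4 := hσ j
      have e5 := hy i
      have e6 := hy j
      have e7 := hr i
      have e8 := hr j
      have e9 := D.spacing_mul
      have e10 := D.small
      have e11 : (1 - 5 * δ) * τ ≤ (1 - 5 * δ) * |κ i - κ j| :=
        mul_le_mul_of_nonneg_left e (by linarith)
      have f1 : |y i - y j| ≤ |y i - sinAngle ν ν' * κ i| + |sinAngle ν ν' * (κ i - κ j)| +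
          |y j - sinAngle ν ν' * κ j| := by
        have : y i - y j = (y i - sinAngle ν ν' * κ i) + sinAngle ν ν' * (κ i - κ j) +
          -(y j - sinAngle ν ν' * κ j) := by ring
        rw [this]
        refine (abs_add_three _ _ _).trans ?_
        rw [abs_neg]
      have f2 : |cosAngle ν ν' * (κ i - κ j)| ≤ |σ i - cosAngle ν ν' * κ i| + |σ i - σ j| +
          |σ j - cosAngle ν ν' * κ j| := by
        have : cosAngle ν ν' * (κ i - κ j) = -(σ i - cosAngle ν ν' * κ i) + (σ i - σ j) +
          (σ j - cosAngle ν ν' * κ j) := by ring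
        rw [this]
        refine (abs_add_three _ _ _).trans ?_
        rw [abs_neg]
      linarith)
  refine ⟨η, hη, fun k hk s hs => ?_, ?_, ?_⟩
  · have := h k s (by simpa [σ, r, if_pos hk] using hs)
    simpa [y, if_pos hk] using this
  · obtain ⟨j, hn, hp⟩ : ∃ j : ℤ, j ∉ index n ∧ 0 < j :=
      ⟨n + 1, by simp [index], by positivity⟩
    have := h j (cosAngle ν ν' * (T / 2)) (by simp [σ, r, hκ, siteParam, hn, hp])
    simpa [y, hκ, siteParam, hn, hp] using this
  · obtain ⟨j, hn, hp⟩ : ∃ j : ℤ, j ∉ index n ∧ ¬ 0 < j :=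
      ⟨-(n + 1), by simp [index], by omega⟩
    have := h j (-(cosAngle ν ν' * (T / 2))) (by simp [σ, r, hκ, siteParam, hn, hp])
    simpa [y, hκ, siteParam, hn, hp] using this

/-- The interface of a tiling. In the small cells it is flat, its middle layer lies inside of the
cell, and its outer layers lie outside; all layers shrink to a point in the middles of the
tangential faces of the large cell. -/
structure IsTilingInterface (ν ν' : E2) (δ t T : ℝ) (n : ℕ) (I : Interface) : Prop where
  cell : ∀ k ∈ index n, ∀ s, |s - coordTangent ν (center ν' (spacing δ t) k)| ≤ t / 2 →
    I.η s = coordNormal ν (center ν' (spacing δ t) k) ∧ I.k s = t ∧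
      I.h s ≤ (t / 2 - |s - coordTangent ν (center ν' (spacing δ t) k)|) / 4
  k_le : ∀ s, I.k s ≤ t
  right : ∀ s, |I.η s - sinAngle ν ν' * (T / 2)| ≤ |s - cosAngle ν ν' * (T / 2)| / 4 ∧
    I.k s ≤ |s - cosAngle ν ν' * (T / 2)|
  left : ∀ s, |I.η s + sinAngle ν ν' * (T / 2)| ≤ |s + cosAngle ν ν' * (T / 2)| / 4 ∧
    I.k s ≤ |s + cosAngle ν ν' * (T / 2)|

theorem exists_interface (D : Tiling ν ν' δ t T n) :
    ∃ I : Interface, IsTilingInterface ν ν' δ t T n I := by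
  obtain ⟨η, hη, h1, h2, h3⟩ := D.exists_graph
  have ht := D.pos
  set σ : ℤ → ℝ := fun k => coordTangent ν (center ν' (spacing δ t) k) with hσ
  let E : Set ℝ := {cosAngle ν ν' * (T / 2), -(cosAngle ν ν' * (T / 2))}
  let Z : Set ℝ := (fun k => σ k - t / 2) '' index n ∪ (fun k => σ k + t / 2) '' index n ∪ E
  have hE : E.Finite := Set.toFinite _
  have hZ : Z.Finite := (((index n).finite_toSet.image _).union
    ((index n).finite_toSet.image _)).union hE
  have hE0 : E.Nonempty := ⟨_, Set.mem_insert _ _⟩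
  have hEr : cosAngle ν ν' * (T / 2) ∈ E := Set.mem_insert _ _
  have hEl : -(cosAngle ν ν' * (T / 2)) ∈ E := Set.mem_insert_of_mem _ rfl
  refine ⟨Interface.ofFinite η (hη.weaken (by
    rw [← NNReal.coe_le_coe]; norm_num)) ht hZ Set.subset_union_right hE0, ?_, ?_, ?_, ?_⟩
  · intro k hk s hs
    refine ⟨h1 k hk s hs, min_eq_left ?_, ?_⟩
    · have e1 : |σ k - cosAngle ν ν' * (k * spacing δ t)| ≤ 1 :=
        abs_coordTangent_center_sub_le D.norm_eq ν' (spacing δ t) k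
      have e2 := D.abs_mul_spacing_le hk
      have e3 := D.le_size
      have e4 := D.le_spacing
      have e5 := D.le_cos
      have e6 := D.small
      have e7 := D.nonneg
      have e8 : |cosAngle ν ν' * (k * spacing δ t)| ≤ cosAngle ν ν' * (n * spacing δ t) := by
        rw [abs_mul, abs_of_pos (by linarith : 0 < cosAngle ν ν')]
        exact mul_le_mul_of_nonneg_left e2 (by linarith)
      have e9 : cosAngle ν ν' * ((n + 2) * spacing δ t) ≤ cosAngle ν ν' * (T / 2) :=
        mul_le_mul_of_nonneg_left e3 (by linarith)
      have e10 : 9 / 10 * (t + 15) ≤ cosAngle ν ν' * spacing δ t :=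
        mul_le_mul (by linarith) e4 (by linarith) (by linarith)
      rw [abs_le] at hs e1 e8
      refine (Metric.le_infDist hE0).2 fun z hz => ?_
      rw [Real.dist_eq]
      rcases hz with rfl | hz
      · rw [abs_sub_comm]
        refine le_trans ?_ (le_abs_self _)
        linarith
      · rw [Set.mem_singleton_iff.1 hz]
        refine le_trans ?_ (le_abs_self _)
        linarith
    · have e : min t (Metric.infDist s Z) ≤ t / 2 - |s - σ k| := by
        refine (min_le_right _ _).trans ?_
        rcases le_total (σ k) s with hs' | hs'
        · have := Metric.infDist_le_dist_of_mem (x := s) (s := Z) (y := σ k + t / 2)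
            (Or.inl (Or.inr ⟨k, hk, rfl⟩))
          rw [Real.dist_eq] at this
          refine this.trans (le_of_eq ?_)
          rw [abs_of_nonneg (by linarith : 0 ≤ s - σ k)] at hs ⊢
          rw [abs_of_nonpos (by linarith)]
          ring
        · have := Metric.infDist_le_dist_of_mem (x := s) (s := Z) (y := σ k - t / 2)
            (Or.inl (Or.inl ⟨k, hk, rfl⟩))
          rw [Real.dist_eq] at this
          refine this.trans (le_of_eq ?_)
          rw [abs_of_nonpos (by linarith : s - σ k ≤ 0)] at hs ⊢
          rw [abs_of_nonneg (by linarith)]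
          ring
      exact div_le_div_of_nonneg_right e (by norm_num)
  · exact fun s => min_le_left _ _
  · intro s
    have e := hη.dist_le_mul s (cosAngle ν ν' * (T / 2))
    rw [Real.dist_eq, Real.dist_eq, h2] at e
    refine ⟨e.trans (le_of_eq (by push_cast; ring)), (min_le_right _ _).trans ?_⟩
    have := Metric.infDist_le_dist_of_mem (x := s) hEr
    rwa [Real.dist_eq] at this
  · intro s
    have e := hη.dist_le_mul s (-(cosAngle ν ν' * (T / 2)))
    rw [Real.dist_eq, Real.dist_eq, h3, sub_neg_eq_add, sub_neg_eq_add] at e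
    refine ⟨e.trans (le_of_eq (by push_cast; ring)), (min_le_right _ _).trans ?_⟩
    have := Metric.infDist_le_dist_of_mem (x := s) hEl
    rwa [Real.dist_eq, sub_neg_eq_add] at this

end Tiling

/-! ### Boundary values and slope of the interface map of a tiling -/

theorem jumpDatum_framePoint {ν : E2} (hν : ‖ν‖ = 1) (a b : E3) (p s z : ℝ) :
    jumpDatum a b ν (framePoint ν p s z) = if 0 < p then a else b := by
  rw [jumpDatum, coordNormal_framePoint hν]

theorem setLIntegral_translate (A : Set E3) (c : E3) (H : E3 → ℝ≥0∞) :
    ∫⁻ y in A, H (y + c) = ∫⁻ x in (fun x => x - c) ⁻¹' A, H x := by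
  have h := (measurePreserving_add_right (volume : Measure E3) c).setLIntegral_comp_preimage_emb
    (MeasurableEquiv.addRight c).measurableEmbedding H ((fun x => x - c) ⁻¹' A)
  rw [← h]
  congr 2
  ext x
  simp

namespace Tiling

variable {ν ν' : E2} {δ t T : ℝ} {n : ℕ} {I : Interface}

namespace IsTilingInterface

/-- In the frame of `ν`, a lateral boundary point of the large cell lies above all three layers or
below all of them, according to the sign of its normal coordinate `p` in the frame of `ν'`. -/
theorem layers_lateral (hI : IsTilingInterface ν ν' δ t T n I) (D : Tiling ν ν' δ t T n) {p s : ℝ}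
    (h : |p| = T / 2 ∧ |s| < T / 2 ∨ p ≠ 0 ∧ |p| < T / 2 ∧ |s| = T / 2) :
    let N := cosAngle ν ν' * p + sinAngle ν ν' * s
    let S := -sinAngle ν ν' * p + cosAngle ν ν' * s
    (0 < p → I.η S + 5 / 4 * I.k S ≤ N) ∧
      (p ≤ 0 → N ≤ I.η S - 5 / 4 * I.k S ∧ N < I.η S) := by
  intro N S
  obtain ⟨r1, r2⟩ := hI.right S
  obtain ⟨l1, l2⟩ := hI.left S
  have k1 := hI.k_le S
  have k0 := I.k_nonneg S
  have hδ := D.nonneg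
  have hδ' := D.small
  have hc := D.le_cos
  have hc' := D.cos_le
  have ht := D.pos
  have hT := D.large
  rcases h with ⟨hp, hs⟩ | ⟨hp0, hp, hs⟩
  · have e1 := D.abs_sinAngle_mul_le s
    have e2 : δ * |s| ≤ δ * (T / 2) := mul_le_mul_of_nonneg_left hs.le hδ
    have e3 := D.abs_sinAngle_mul_le p
    have e4 := D.abs_sinAngle_mul_le (T / 2)
    rw [abs_of_pos (by linarith : 0 < T / 2)] at e4
    rw [hp] at e3
    have e5 : δ * (T / 2) ≤ 1 / 20 * (T / 2) := mul_le_mul_of_nonneg_right hδ' (by linarith)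
    have e6 : (1 - δ) * (T / 2) ≤ cosAngle ν ν' * (T / 2) :=
      mul_le_mul_of_nonneg_right hc (by linarith)
    have e7 : |S - cosAngle ν ν' * (T / 2)| ≤ δ * (T / 2) + T := by
      have : S - cosAngle ν ν' * (T / 2) = -(sinAngle ν ν' * p) + cosAngle ν ν' * (s - T / 2) := by
        simp only [S]; ring
      rw [this]
      refine (abs_add_le _ _).trans (add_le_add (by rwa [abs_neg]) ?_)
      rw [abs_mul, abs_of_pos (by linarith : 0 < cosAngle ν ν')]
      have : |s - T / 2| ≤ T := by
        rw [abs_le]; rw [abs_lt] at hs; constructor <;> linarith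
      nlinarith [abs_nonneg (s - T / 2)]
    rw [abs_le] at e1 e4 r1
    constructor
    · intro hp0
      rw [abs_of_pos hp0] at hp
      have : N = cosAngle ν ν' * (T / 2) + sinAngle ν ν' * s := by simp only [N, hp]
      linarith
    · intro hp0
      have hp' : p = -(T / 2) := by rw [abs_of_nonpos hp0] at hp; linarith
      have : N = -(cosAngle ν ν' * (T / 2)) + sinAngle ν ν' * s := by simp only [N, hp']; ring
      constructor <;> linarith
  · have e1 := D.abs_sinAngle_mul_le p
    have e2 : (1 - δ) * |p| ≤ cosAngle ν ν' * |p| := mul_le_mul_of_nonneg_right hc (abs_nonneg p)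
    have e3 : δ * |p| ≤ 1 / 20 * |p| := mul_le_mul_of_nonneg_right hδ' (abs_nonneg p)
    have e4 := abs_pos.2 hp0
    -- the interface ends at the end point of the tangential face that contains the point
    have key : ∃ e, |I.η S - e| ≤ δ * |p| / 4 ∧ I.k S ≤ δ * |p| ∧ N = cosAngle ν ν' * p + e := by
      rcases abs_eq (by linarith) |>.1 hs with rfl | rfl
      · refine ⟨sinAngle ν ν' * (T / 2), ?_, ?_, rfl⟩
        all_goals
          have : |S - cosAngle ν ν' * (T / 2)| ≤ δ * |p| := by
            have : S - cosAngle ν ν' * (T / 2) = -(sinAngle ν ν' * p) := by simp only [S]; ring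
            rwa [this, abs_neg]
          linarith
      · refine ⟨-(sinAngle ν ν' * (T / 2)), ?_, ?_, by simp only [N]; ring⟩
        all_goals
          have : |S + cosAngle ν ν' * (T / 2)| ≤ δ * |p| := by
            have : S + cosAngle ν ν' * (T / 2) = -(sinAngle ν ν' * p) := by simp only [S]; ring
            rwa [this, abs_neg]
          first
          | (rw [sub_neg_eq_add]; linarith)
          | linarith
    obtain ⟨e, he, hk, hN⟩ := key
    rw [abs_le] at he
    constructor
    · intro hp1
      rw [abs_of_pos hp1] at *
      linarith
    · intro hp1
      rw [abs_of_nonpos hp1] at *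
      constructor <;> linarith

variable {Γ₀ Γ₁ Γ₂ : ℝ → E3}

theorem map_eq_jumpDatum (hI : IsTilingInterface ν ν' δ t T n I) (D : Tiling ν ν' δ t T n)
    (ha : Γ₁ 0 = Γ₀ 1) (hb : Γ₂ 1 = Γ₀ 0) (p s z : ℝ)
    (h : |p| = T / 2 ∧ |s| < T / 2 ∨ p ≠ 0 ∧ |p| < T / 2 ∧ |s| = T / 2) :
    I.map ν Γ₀ Γ₁ Γ₂ (framePoint ν' p s z) =
      jumpDatum (Γ₁ 1) (Γ₂ 0) ν' (framePoint ν' p s z) := by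
  obtain ⟨h1, h2⟩ := hI.layers_lateral D h
  rw [jumpDatum_framePoint D.norm_eq']
  split_ifs with hp
  · refine Interface.map_eq_upper ha ?_
    rw [coordTangent_eq ν D.norm_eq', coordNormal_eq ν D.norm_eq',
      coordNormal_framePoint D.norm_eq', coordTangent_framePoint D.norm_eq']
    exact h1 hp
  · refine Interface.map_eq_lower hb ?_ ?_
    all_goals rw [coordTangent_eq ν D.norm_eq', coordNormal_eq ν D.norm_eq',
      coordNormal_framePoint D.norm_eq', coordTangent_framePoint D.norm_eq']
    · exact (h2 (not_lt.1 hp)).1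
    · exact (h2 (not_lt.1 hp)).2

theorem map_eq_jumpDatum_cell (hI : IsTilingInterface ν ν' δ t T n I) (D : Tiling ν ν' δ t T n)
    {k : ℤ} (hk : k ∈ index n) (p s z : ℝ)
    (h : |p| = t / 2 ∧ |s| < t / 2 ∨ p ≠ 0 ∧ |p| < t / 2 ∧ |s| = t / 2) :
    I.map ν Γ₀ Γ₁ Γ₂ (framePoint ν p s z + center ν' (spacing δ t) k) =
      jumpDatum (Γ₀ 1) (Γ₀ 0) ν (framePoint ν p s z) := by
  have ht := D.pos
  have hN : coordNormal ν (framePoint ν p s z + center ν' (spacing δ t) k) =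
      p + coordNormal ν (center ν' (spacing δ t) k) := by
    rw [coordNormal_add, coordNormal_framePoint D.norm_eq]
  have hS : coordTangent ν (framePoint ν p s z + center ν' (spacing δ t) k) =
      s + coordTangent ν (center ν' (spacing δ t) k) := by
    rw [coordTangent_add, coordTangent_framePoint D.norm_eq]
  have hs : |s| ≤ t / 2 := by
    rcases h with ⟨_, h⟩ | ⟨_, _, h⟩
    exacts [h.le, h.le]
  obtain ⟨e1, e2, e3⟩ := hI.cell k hk (s + coordTangent ν (center ν' (spacing δ t) k))
    (by rwa [add_sub_cancel_right])
  rw [add_sub_cancel_right] at e3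
  have hp : p ≠ 0 ∧ |p| ≤ t / 2 ∧ (t / 2 - |s|) / 4 ≤ |p| := by
    rcases h with ⟨h1, h2⟩ | ⟨h0, h1, h2⟩
    · refine ⟨fun h0 => ?_, h1.le, by have := abs_nonneg s; linarith⟩
      rw [h0, abs_zero] at h1; linarith
    · exact ⟨h0, h1.le, by rw [h2, sub_self, zero_div]; exact abs_nonneg p⟩
  obtain ⟨hp0, hp1, hp2⟩ := hp
  rw [jumpDatum_framePoint D.norm_eq]
  split_ifs with hp
  · rw [abs_of_pos hp] at hp1 hp2
    refine Interface.map_eq_middle_upper ?_ ?_ ?_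
    all_goals rw [hS]
    · rw [e2]; exact ht
    · rw [hN, e1]; linarith
    · rw [hN, e1, e2]; linarith
  · have hp' : p < 0 := lt_of_le_of_ne (not_lt.1 hp) hp0
    rw [abs_of_neg hp'] at hp1 hp2
    refine Interface.map_eq_middle_lower ?_ ?_ ?_
    all_goals rw [hS]
    · rw [hN, e1]; linarith
    · rw [hN, e1]; linarith
    · rw [hN, e1, e2]; linarith

end IsTilingInterface

/-- The large cell, seen in the frame of `ν`, is hardly longer than `T`. -/
theorem abs_coordTangent_le (D : Tiling ν ν' δ t T n) {x : E3} (hx : x ∈ cylinder ν' T) :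
    |coordTangent ν x| ≤ T / 2 * (1 + δ) := by
  rw [coordTangent_eq ν D.norm_eq']
  obtain ⟨h1, h2, -⟩ := hx
  refine (abs_add_le _ _).trans ?_
  rw [neg_mul, abs_neg]
  have e1 := D.abs_sinAngle_mul_le (coordNormal ν' x)
  have e2 := mul_le_mul_of_nonneg_left h1.le D.nonneg
  have e3 : |cosAngle ν ν' * coordTangent ν' x| ≤ |coordTangent ν' x| := by
    rw [abs_mul, abs_of_pos (by linarith [D.le_cos, D.small] : 0 < cosAngle ν ν')]
    exact mul_le_of_le_one_left (abs_nonneg _) D.cos_le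
  linarith

/-- The tangential coordinates in the range of the large cell that no small cell covers. -/
def uncovered (ν ν' : E2) (δ t T : ℝ) (n : ℕ) : Set ℝ :=
  Set.Icc (-(T / 2 * (1 + δ))) (T / 2 * (1 + δ)) \
    ⋃ k ∈ index n, Set.Ioo (coordTangent ν (center ν' (spacing δ t) k) - t / 2)
      (coordTangent ν (center ν' (spacing δ t) k) + t / 2)

theorem volume_uncovered_le (D : Tiling ν ν' δ t T n) :
    volume (uncovered ν ν' δ t T n) ≤ ENNReal.ofReal (T * (6 * δ + 15 / t) + 5 * t) := by
  have ht := D.pos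
  have hT := D.large
  have hδ := D.nonneg
  have hτ := D.le_spacing
  have hτ' := D.spacing_mul
  have hm : ∀ k ∈ index n, MeasurableSet (Set.Ioo
      (coordTangent ν (center ν' (spacing δ t) k) - t / 2)
      (coordTangent ν (center ν' (spacing δ t) k) + t / 2)) := fun k _ => measurableSet_Ioo
  have hd : (↑(index n) : Set ℤ).PairwiseDisjoint fun k =>
      Set.Ioo (coordTangent ν (center ν' (spacing δ t) k) - t / 2)
        (coordTangent ν (center ν' (spacing δ t) k) + t / 2) := by
    intro k _ l _ hkl
    refine Set.disjoint_left.2 fun s hs hs' => ?_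
    have := D.lt_abs_sub hkl
    rcases lt_abs.1 this with h | h <;> linarith [hs.1, hs.2, hs'.1, hs'.2]
  have hsub : (⋃ k ∈ index n, Set.Ioo (coordTangent ν (center ν' (spacing δ t) k) - t / 2)
      (coordTangent ν (center ν' (spacing δ t) k) + t / 2)) ⊆
      Set.Icc (-(T / 2 * (1 + δ))) (T / 2 * (1 + δ)) := by
    refine Set.iUnion₂_subset fun k hk s hs => ?_
    have e1 := abs_coordTangent_center_sub_le D.norm_eq ν' (spacing δ t) k
    have e2 := D.abs_mul_spacing_le hk
    have e3 := D.le_size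
    have e4 : |cosAngle ν ν' * (k * spacing δ t)| ≤ n * spacing δ t := by
      rw [abs_mul, abs_of_pos (by linarith [D.le_cos, D.small] : 0 < cosAngle ν ν')]
      exact (mul_le_of_le_one_left (abs_nonneg _) D.cos_le).trans e2
    rw [abs_le] at e1 e4
    have e5 : 0 ≤ T / 2 * δ := mul_nonneg (by linarith) hδ
    constructor <;> linarith [hs.1, hs.2]
  rw [uncovered, measure_sdiff hsub (Finset.measurableSet_biUnion _ hm).nullMeasurableSet
    (measure_ne_top_of_subset hsub (by simp)), measure_biUnion_finset hd hm]
  have e : ∀ k : ℤ, coordTangent ν (center ν' (spacing δ t) k) + t / 2 -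
      (coordTangent ν (center ν' (spacing δ t) k) - t / 2) = t := fun k => by ring
  simp only [Real.volume_Ioo, Real.volume_Icc, e]
  rw [Finset.sum_const, nsmul_eq_mul, ← ENNReal.ofReal_natCast, card_index,
    ← ENNReal.ofReal_mul (by positivity), ← ENNReal.ofReal_sub _ (by positivity)]
  refine ENNReal.ofReal_le_ofReal ?_
  -- the number of cells is at least `T / τ - 5`
  have h1 : T * t ≤ (2 * n + 6) * (spacing δ t * t) := by nlinarith [D.size_le]
  have h2 : spacing δ t * (1 - 5 * δ - 15 / t) ≤ t := by
    have : 15 ≤ spacing δ t * (15 / t) := by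
      rw [mul_div_assoc', le_div_iff₀ ht]
      nlinarith
    linarith
  have hτ0 : 0 < spacing δ t := by linarith
  have h3 : spacing δ t * (T * (1 - 5 * δ - 15 / t)) ≤ spacing δ t * ((2 * n + 6) * t) := by
    have := mul_le_mul_of_nonneg_left h2 (by linarith : 0 ≤ T)
    linarith
  have h4 := le_of_mul_le_mul_left h3 hτ0
  linarith

/-- The slope of the interface map outside of the small cells. The middle layer is inside of the
small cells wherever it passes through one of them, so that only the uncovered part of it counts. -/
theorem lintegral_slope_le (D : Tiling ν ν' δ t T n) (hI : IsTilingInterface ν ν' δ t T n I)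
    (C₀ C₁ C₂ : ℝ≥0) :
    ∫⁻ x in cylinder ν' T \ ⋃ k ∈ index n,
        (fun x => x - center ν' (spacing δ t) k) ⁻¹' cylinder ν t, I.slope ν C₀ C₁ C₂ x ≤
      ENNReal.ofReal (14 * (C₀ * (T * (6 * δ + 15 / t) + 5 * t) + (C₁ + C₂) * (2 * T))) := by
  have ht := D.pos
  have hT := D.large
  have hδ := D.nonneg
  have hδ' := D.small
  have hA : MeasurableSet (uncovered ν ν' δ t T n) :=
    measurableSet_Icc.diff (Finset.measurableSet_biUnion _ fun k _ => measurableSet_Ioo)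
  have hR : MeasurableSet (cylinder ν' T \ ⋃ k ∈ index n,
      (fun x => x - center ν' (spacing δ t) k) ⁻¹' cylinder ν t) :=
    (isOpen_cylinder ν' T).measurableSet.diff (Finset.measurableSet_biUnion _ fun k _ =>
      IsPacking.measurableSet_preimage ν t _)
  refine (I.lintegral_slope_le D.norm_eq C₀ C₁ C₂ (A := uncovered ν ν' δ t T n)
    (B := Set.Icc (-(T / 2 * (1 + δ))) (T / 2 * (1 + δ))) ?_ ?_ ?_ hA hR).trans ?_
  · rintro x ⟨hx, hx'⟩ hlayer
    refine ⟨abs_le.1 (D.abs_coordTangent_le hx), fun hu => hx' ?_⟩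
    obtain ⟨k, hk, hs⟩ := Set.mem_iUnion₂.1 hu
    have hs' : |coordTangent ν x - coordTangent ν (center ν' (spacing δ t) k)| < t / 2 :=
      abs_lt.2 ⟨by linarith [hs.1], by linarith [hs.2]⟩
    obtain ⟨e1, -, e3⟩ := hI.cell k hk _ hs'.le
    refine Set.mem_iUnion₂.2 ⟨k, hk, ?_⟩
    have s1 : coordNormal ν (x - center ν' (spacing δ t) k) =
        coordNormal ν x - coordNormal ν (center ν' (spacing δ t) k) := by
      simp [coordNormal]; ring
    have s2 : coordTangent ν (x - center ν' (spacing δ t) k) =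
        coordTangent ν x - coordTangent ν (center ν' (spacing δ t) k) := by
      simp [coordTangent]; ring
    refine ⟨?_, by rwa [s2], ?_⟩
    · rw [s1, ← e1]
      have := abs_nonneg (coordTangent ν x - coordTangent ν (center ν' (spacing δ t) k))
      linarith
    · simpa [center] using hx.2.2
  · exact fun x hx => abs_le.1 (D.abs_coordTangent_le hx.1)
  · exact fun x hx => hx.1.2.2
  · have hB : volume (Set.Icc (-(T / 2 * (1 + δ))) (T / 2 * (1 + δ))) ≤ ENNReal.ofReal (2 * T) := by
      rw [Real.volume_Icc]
      refine ENNReal.ofReal_le_ofReal ?_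
      nlinarith
    have h15 : 0 ≤ 15 / t := by positivity
    have hp1 : 0 ≤ T * (6 * δ + 15 / t) + 5 * t :=
      add_nonneg (mul_nonneg (by linarith) (by linarith)) (by linarith)
    rw [ENNReal.ofReal_mul (by norm_num), ENNReal.ofReal_add (mul_nonneg C₀.coe_nonneg hp1)
      (mul_nonneg (add_nonneg C₁.coe_nonneg C₂.coe_nonneg) (by linarith)),
      ENNReal.ofReal_mul C₀.coe_nonneg,
      ENNReal.ofReal_mul (add_nonneg C₁.coe_nonneg C₂.coe_nonneg),
      ENNReal.ofReal_add C₁.coe_nonneg C₂.coe_nonneg,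
      ENNReal.ofReal_coe_nnreal, ENNReal.ofReal_coe_nnreal, ENNReal.ofReal_coe_nnreal,
      ENNReal.ofReal_ofNat]
    gcongr
    exact D.volume_uncovered_le

theorem lintegral_slope_lt_top (D : Tiling ν ν' δ t T n) (I : Interface) (C₀ C₁ C₂ : ℝ≥0) :
    ∫⁻ x in cylinder ν' T, I.slope ν C₀ C₁ C₂ x < ⊤ := by
  refine (I.lintegral_slope_le D.norm_eq C₀ C₁ C₂
    (A := Set.Icc (-(T / 2 * (1 + δ))) (T / 2 * (1 + δ)))
    (B := Set.Icc (-(T / 2 * (1 + δ))) (T / 2 * (1 + δ)))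
    (fun x hx _ => abs_le.1 (D.abs_coordTangent_le hx))
    (fun x hx => abs_le.1 (D.abs_coordTangent_le hx)) (fun x hx => hx.2.2) measurableSet_Icc
    (isOpen_cylinder ν' T).measurableSet).trans_lt ?_
  rw [Real.volume_Icc]
  refine ENNReal.mul_lt_top (by simp) (ENNReal.add_lt_top.2
    ⟨ENNReal.mul_lt_top ENNReal.coe_lt_top ENNReal.ofReal_lt_top,
      ENNReal.mul_lt_top (by simp) ENNReal.ofReal_lt_top⟩)

end Tiling

/-! ### Competitors -/

theorem patch_comp {ι V V' : Type*} (A : Set E3) (F : Finset ι) (c : ι → E3) (φ W : E3 → V)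
    (L : V → V') (x : E3) :
    patch A F c (fun y => L (φ y)) (fun y => L (W y)) x = L (patch A F c φ W x) := by
  unfold patch
  split_ifs <;> rfl

/-- A planar profile with values in `M` and the right values on the lateral boundary is
admissible. -/
theorem IsPlanarProfile.mem_admissible {M : Set E3} {a b : E3} {ν : E2} {t : ℝ} {W : E3 → E3}
    {S : Set E3} {σ : E3 → ℝ≥0} (hW : IsPlanarProfile W S σ) (hν : ‖ν‖ = 1) (ht : 0 < t)
    (hM : ∀ x, W x ∈ M) (hσ : ∫⁻ x in cylinder ν t, σ x < ⊤)
    (hg : ∀ p s z, (|p| = t / 2 ∧ |s| < t / 2 ∨ p ≠ 0 ∧ |p| < t / 2 ∧ |s| = t / 2) →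
      W (framePoint ν p s z) = jumpDatum a b ν (framePoint ν p s z)) :
    (W, grad W) ∈ admissible M a b ν t := by
  have htr := hW.hasLateralTrace hν ht hσ hg
  have hi := hW.integrableOn (cylinder_volume_lt_top hν t)
  have hgi := hW.integrableOn_grad hσ
  exact ⟨⟨hi, hgi, fun ψ hψ i j => htr.weak_grad hν hi hgi hψ i j, Eventually.of_forall hM⟩, htr⟩

section Energy

variable {f : E3 → Mat3 → ℝ} {β : ℝ} {M : Set E3} {K : ℝ≥0}

theorem cellEnergy_nonneg (hg : IsCellIntegrand (recession f) β) (ν : E2) {t : ℝ} (ht : 0 < t)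
    (G : E3 → Mat3) : 0 ≤ cellEnergy f ν t G := by
  refine mul_nonneg (by positivity) (integral_nonneg_of_ae (ae_restrict_of_ae ?_))
  filter_upwards [hg.nonneg] with x hx using hx _

theorem cellInf_nonneg (hg : IsCellIntegrand (recession f) β) (a b : E3) (ν : E2) {t : ℝ}
    (ht : 0 < t) : 0 ≤ cellInf f M a b ν t := by
  refine Real.sInf_nonneg ?_
  rintro _ ⟨u, -, rfl⟩
  exact cellEnergy_nonneg hg ν ht _

theorem cellInf_le_cellEnergy (hg : IsCellIntegrand (recession f) β) {a b : E3} {ν : E2} {t : ℝ}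
    (ht : 0 < t) {u : (E3 → E3) × (E3 → Mat3)} (hu : u ∈ admissible M a b ν t) :
    cellInf f M a b ν t ≤ cellEnergy f ν t u.2 :=
  csInf_le ⟨0, by rintro _ ⟨u, -, rfl⟩; exact cellEnergy_nonneg hg ν ht _⟩ ⟨u, hu, rfl⟩

/-- The energy of an interface map with a straight interface and no outer transitions. The constant
is the product of the total slope `14` of a layer and the factor `3` between the norm of a matrix
and its entries. -/
theorem exists_admissible_cellEnergy_le (hg : IsCellIntegrand (recession f) β) (hβ : 0 ≤ β)
    (hK : ∀ a ∈ M, ∀ b ∈ M, LipJoined M (K * nndist a b) a b) {a b : E3} (ha : a ∈ M) (hb : b ∈ M)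
    {ν : E2} (hν : ‖ν‖ = 1) {t : ℝ} (ht : 0 < t) :
    ∃ u ∈ admissible M a b ν t, cellEnergy f ν t u.2 ≤ 42 * β * K * ‖a - b‖ := by
  obtain ⟨Γ, hΓ, h0, h1, hM⟩ := hK b hb a ha
  have e0 := h0 0 le_rfl
  have e1 := h1 1 le_rfl
  let E : Set ℝ := {t / 2, -(t / 2)}
  have hE : E.Finite := Set.toFinite _
  let I : Interface := Interface.ofFinite (fun _ => 0) (LipschitzWith.const' 0)
    (show 0 < t / 4 by positivity) hE Set.Subset.rfl ⟨t / 2, Set.mem_insert _ _⟩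
  have hη : ∀ s, I.η s = 0 := fun s => rfl
  have hk : ∀ s, I.k s ≤ t / 4 := fun s => min_le_left _ _
  have hk0 : ∀ s, |s| = t / 2 → I.k s = 0 := fun s hs => by
    have : s ∈ E := by
      rcases abs_eq (by positivity) |>.1 hs with rfl | rfl
      · exact Set.mem_insert _ _
      · exact Set.mem_insert_of_mem _ rfl
    have h : Metric.infDist s E = 0 := Metric.infDist_zero_of_mem this
    show min (t / 4) (Metric.infDist s E) = 0
    rw [h, min_eq_right (by positivity)]
  have hW := I.isPlanarProfile hν (C₁ := 0) (C₂ := 0) hΓ (LipschitzWith.const' a)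
    (LipschitzWith.const' b)
  have hσ : ∫⁻ x in cylinder ν t, I.slope ν (K * nndist b a) 0 0 x ≤
      ENNReal.ofReal (14 * (K * ‖a - b‖ * t)) := by
    refine (I.lintegral_slope_le hν _ 0 0 (A := Set.Icc (-(t / 2)) (t / 2)) (B := Set.univ)
      (fun x hx _ => abs_le.1 hx.2.1.le) (fun x _ => Set.mem_univ _) (fun x hx => hx.2.2)
      measurableSet_Icc (isOpen_cylinder ν t).measurableSet).trans (le_of_eq ?_)
    have e : t / 2 - -(t / 2) = t := by ring
    rw [Real.volume_Icc, e, ENNReal.ofReal_mul (by norm_num), ENNReal.ofReal_mul (by positivity),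
      ENNReal.ofReal_mul (by positivity), ← dist_eq_norm, dist_comm, ← coe_nndist,
      ENNReal.ofReal_coe_nnreal, ENNReal.ofReal_coe_nnreal]
    simp
  refine ⟨_, hW.mem_admissible hν ht (M := M) (a := a) (b := b)
    (fun x => I.map_mem hM (fun _ => ha) (fun _ => hb) e1.symm e0.symm)
    (hσ.trans_lt ENNReal.ofReal_lt_top) fun p s z h => ?_, ?_⟩
  · have hs : 5 / 4 * I.k s ≤ |p| ∧ p ≠ 0 := by
      rcases h with ⟨hp, -⟩ | ⟨hp, -, hs⟩
      · have := hk s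
        exact ⟨by linarith, fun h0 => by rw [h0, abs_zero] at hp; linarith⟩
      · rw [hk0 s hs, mul_zero]
        exact ⟨abs_nonneg p, hp⟩
    rw [jumpDatum_framePoint hν]
    split_ifs with hp
    · rw [abs_of_pos hp] at hs
      refine Interface.map_eq_upper e1.symm ?_
      rw [coordNormal_framePoint hν, coordTangent_framePoint hν, hη]
      linarith
    · have hp' : p < 0 := lt_of_le_of_ne (not_lt.1 hp) hs.2
      rw [abs_of_neg hp'] at hs
      refine Interface.map_eq_lower e0.symm ?_ ?_
      all_goals rw [coordNormal_framePoint hν, coordTangent_framePoint hν, hη]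
      · linarith
      · exact hp'
  · have := hg.setIntegral_grad_le hβ hW (by positivity) hσ
    rw [cellEnergy, one_div, inv_mul_le_iff₀ ht]
    refine this.trans (le_of_eq ?_)
    ring

theorem cellInf_le_mul_norm (hg : IsCellIntegrand (recession f) β) (hβ : 0 ≤ β)
    (hK : ∀ a ∈ M, ∀ b ∈ M, LipJoined M (K * nndist a b) a b) {a b : E3} (ha : a ∈ M) (hb : b ∈ M)
    {ν : E2} (hν : ‖ν‖ = 1) {t : ℝ} (ht : 0 < t) :
    cellInf f M a b ν t ≤ 42 * β * K * ‖a - b‖ := by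
  obtain ⟨u, hu, h⟩ := exists_admissible_cellEnergy_le hg hβ hK ha hb hν ht
  exact (cellInf_le_cellEnergy hg ht hu).trans h

namespace Tiling

variable {ν ν' : E2} {δ t T : ℝ} {n : ℕ}

/-- The competitor in the large cell that repeats an admissible map `u` of the small cell in all
cells of the tiling and uses an interface map between them. -/
theorem cellInf_le_cellEnergy (D : Tiling ν ν' δ t T n) (hg : IsCellIntegrand (recession f) β)
    (hβ : 0 ≤ β) (hK : ∀ a ∈ M, ∀ b ∈ M, LipJoined M (K * nndist a b) a b) {a₁ b₁ a₂ b₂ : E3}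
    (ha₁ : a₁ ∈ M) (hb₁ : b₁ ∈ M) (ha₂ : a₂ ∈ M) (hb₂ : b₂ ∈ M)
    {u : (E3 → E3) × (E3 → Mat3)} (hu : u ∈ admissible M a₂ b₂ ν t) :
    cellInf f M a₁ b₁ ν' T ≤ cellEnergy f ν t u.2 +
      42 * β * K * (‖a₂ - b₂‖ * (6 * δ + 15 / t + 5 * t / T) + 2 * (‖a₁ - a₂‖ + ‖b₁ - b₂‖)) := by
  obtain ⟨φ, G⟩ := u
  obtain ⟨hφ, hφt⟩ := hu
  simp only at hφ hφt ⊢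
  have ht := D.pos
  have hT : 0 < T := by linarith [D.large]
  obtain ⟨I, hI⟩ := D.exists_interface
  obtain ⟨Γ₀, hΓ₀, e00, e01, hM₀⟩ := hK b₂ hb₂ a₂ ha₂
  obtain ⟨Γ₁, hΓ₁, e10, e11, hM₁⟩ := hK a₂ ha₂ a₁ ha₁
  obtain ⟨Γ₂, hΓ₂, e20, e21, hM₂⟩ := hK b₁ hb₁ b₂ hb₂
  replace e00 := e00 0 le_rfl
  replace e01 := e01 1 le_rfl
  replace e10 := e10 0 le_rfl
  replace e11 := e11 1 le_rfl
  replace e20 := e20 0 le_rfl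
  replace e21 := e21 1 le_rfl
  have ha : Γ₁ 0 = Γ₀ 1 := by rw [e10, e01]
  have hb : Γ₂ 1 = Γ₀ 0 := by rw [e21, e00]
  set W := I.map ν Γ₀ Γ₁ Γ₂ with hWdef
  set c := center ν' (spacing δ t) with hc
  have hp := D.isPacking
  have hW : IsPlanarProfile W _ _ := I.isPlanarProfile D.norm_eq hΓ₀ hΓ₁ hΓ₂
  have hWM : ∀ x, W x ∈ M := fun x => I.map_mem hM₀ hM₁ hM₂ ha hb
  have hσ := D.lintegral_slope_lt_top I (K * nndist b₂ a₂) (K * nndist a₂ a₁) (K * nndist b₁ b₂)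
  have hWi := hW.integrableOn (cylinder_volume_lt_top D.norm_eq' T)
  have hGWi := hW.integrableOn_grad hσ
  have hWt : HasLateralTrace ν' T W (grad W) (jumpDatum a₁ b₁ ν') := by
    refine hW.hasLateralTrace D.norm_eq' hT hσ fun p s z h => ?_
    rw [hWdef, hI.map_eq_jumpDatum D ha hb p s z h, e11, e20]
  have hWk : ∀ k ∈ index n, HasLateralTrace ν t (fun x => W (x + c k))
      (fun x => grad W (x + c k)) (jumpDatum a₂ b₂ ν) := fun k hk => by
    have h := (hW.shift (c k)).hasLateralTrace D.norm_eq ht (g := jumpDatum a₂ b₂ ν)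
      (by
        rw [setLIntegral_translate (cylinder ν t) (c k) (fun x => (I.slope ν (K * nndist b₂ a₂)
          (K * nndist a₂ a₁) (K * nndist b₁ b₂) x : ℝ≥0∞))]
        exact (lintegral_mono_set (hp.preimage_subset hk)).trans_lt hσ)
      (fun p s z h => by
        rw [hWdef, hI.map_eq_jumpDatum_cell D hk p s z h, e00, e01])
    have hgrad : grad (fun x => W (x + c k)) = fun x => grad W (x + c k) :=
      funext fun x => IsPlanarProfile.grad_shift W (c k) x
    rwa [hgrad] at h
  have hΦi := hp.integrableOn_patch hφ.integrable hWi
  have hGi : ∀ i j, IntegrableOn (fun x => patch (cylinder ν t) (index n) c G (grad W) x i j)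
      (cylinder ν' T) := fun i j => by
    have h := hp.integrableOn_patch (hφ.integrable_grad i j) (hGWi i j)
    refine h.congr_fun (fun x _ => ?_) (isOpen_cylinder ν' T).measurableSet
    exact patch_comp _ _ _ G (grad W) (fun ξ : Mat3 => ξ i j) x
  have hΦt := hp.hasLateralTrace_patch hφ.integrable hφ.integrable_grad hWi hGWi hφt hWt hWk
  have hΦM : ∀ᵐ x ∂(volume.restrict (cylinder ν' T)),
      patch (cylinder ν t) (index n) c φ W x ∈ M := by
    have h1 := (ae_restrict_iff' (isOpen_cylinder ν t).measurableSet).1 hφ.mem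
    have h2 : ∀ᵐ x : E3, ∀ k : ℤ, x - c k ∈ cylinder ν t → φ (x - c k) ∈ M :=
      ae_all_iff.2 fun k => (measurePreserving_sub_right (volume : Measure E3)
        (c k)).quasiMeasurePreserving.ae h1
    refine ae_restrict_of_ae ?_
    filter_upwards [h2] with x hx
    by_cases h : ∃ k ∈ index n, x - c k ∈ cylinder ν t
    · obtain ⟨k, hk, hxk⟩ := h
      rw [patch_of_mem hp.disjoint φ W hk hxk]
      exact hx k hxk
    · push Not at h
      rw [patch_of_notMem φ W h]
      exact hWM x
  have hadm : (patch (cylinder ν t) (index n) c φ W, patch (cylinder ν t) (index n) c G (grad W)) ∈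
      admissible M a₁ b₁ ν' T :=
    ⟨⟨hΦi, hGi, fun ψ hψ i j => hΦt.weak_grad D.norm_eq' hΦi hGi hψ i j, hΦM⟩, hΦt⟩
  refine (ThinFilm.cellInf_le_cellEnergy hg hT hadm).trans ?_
  have hcZ : ∀ k ∈ index n, ∃ m n : ℤ, c k = !₂[(m : ℝ), (n : ℝ), 0] := fun k _ => ⟨_, _, rfl⟩
  have h1 := hg.setIntegral_patch_le hp hcZ hφ.integrable_grad hGWi
  have h15 : 0 ≤ 15 / t := by positivity
  have hδ := D.nonneg
  have h2 := hg.setIntegral_grad_le hβ hW (by positivity) (D.lintegral_slope_le hI _ _ _)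
  have hE := cellEnergy_nonneg hg ν ht G
  have h3 : ∫ x in cylinder ν t, recession f x (G x) = t * cellEnergy f ν t G := by
    rw [cellEnergy, one_div, mul_inv_cancel_left₀ ht.ne']
  rw [h3, card_index] at h1
  have h4 : (2 * n + 1) * t ≤ T := by
    have := D.le_size
    have h5 := D.le_spacing
    have h6 : (n + 2 : ℝ) * t ≤ (n + 2) * spacing δ t :=
      mul_le_mul_of_nonneg_left (by linarith) (by positivity)
    linarith
  have h5 : (2 * n + 1) * (t * cellEnergy f ν t G) ≤ T * cellEnergy f ν t G := by
    rw [← mul_assoc]; exact mul_le_mul_of_nonneg_right h4 hE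
  have h6 := h1.trans (add_le_add h5 h2)
  conv_lhs => rw [cellEnergy, one_div]
  rw [inv_mul_le_iff₀ hT]
  refine h6.trans (le_of_eq ?_)
  have d0 : (nndist b₂ a₂ : ℝ) = ‖a₂ - b₂‖ := by rw [coe_nndist, dist_comm, dist_eq_norm]
  have d1 : (nndist a₂ a₁ : ℝ) = ‖a₁ - a₂‖ := by rw [coe_nndist, dist_comm, dist_eq_norm]
  have d2 : (nndist b₁ b₂ : ℝ) = ‖b₁ - b₂‖ := by rw [coe_nndist, dist_eq_norm]
  push_cast
  rw [← coe_nndist, ← coe_nndist, ← coe_nndist, d0, d1, d2]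
  field_simp
  ring

end Tiling

/-- The almost-monotonicity of the infima, from which the existence of the limit and all estimates
of the jump density follow. -/
theorem cellInf_le_cellInf_add (hg : IsCellIntegrand (recession f) β) (hβ : 0 ≤ β)
    (hK : ∀ a ∈ M, ∀ b ∈ M, LipJoined M (K * nndist a b) a b) {a₁ b₁ a₂ b₂ : E3}
    (ha₁ : a₁ ∈ M) (hb₁ : b₁ ∈ M) (ha₂ : a₂ ∈ M) (hb₂ : b₂ ∈ M) {ν ν' : E2} (hν : ‖ν‖ = 1)
    (hν' : ‖ν'‖ = 1) {δ : ℝ} (hδ : 0 ≤ δ) (hδ' : δ ≤ 1 / 20) (hs : |sinAngle ν ν'| ≤ δ)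
    (hc : 1 - δ ≤ cosAngle ν ν') {t T : ℝ} (ht : 0 < t) (hT : 8 * spacing δ t ≤ T) :
    cellInf f M a₁ b₁ ν' T ≤ cellInf f M a₂ b₂ ν t +
      42 * β * K * (‖a₂ - b₂‖ * (6 * δ + 15 / t + 5 * t / T) + 2 * (‖a₁ - a₂‖ + ‖b₁ - b₂‖)) := by
  have hτ : 0 < spacing δ t := div_pos (by linarith) (by linarith)
  have hτt : t ≤ spacing δ t := by
    rw [spacing, le_div_iff₀ (by linarith)]; nlinarith
  have hm := Nat.floor_le (show 0 ≤ T / (2 * spacing δ t) from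
    div_nonneg (by linarith) (by linarith))
  have hm' := Nat.lt_floor_add_one (T / (2 * spacing δ t))
  have hm4 : 4 ≤ ⌊T / (2 * spacing δ t)⌋₊ := Nat.le_floor (by
    rw [le_div_iff₀ (by linarith)]; push_cast; linarith)
  set m := ⌊T / (2 * spacing δ t)⌋₊
  rw [le_div_iff₀ (by linarith)] at hm
  rw [div_lt_iff₀ (by linarith)] at hm'
  have hcast : ((m - 2 : ℕ) : ℝ) = m - 2 := by
    rw [Nat.cast_sub (by omega)]; norm_num
  have D : Tiling ν ν' δ t T (m - 2) :=
    { norm_eq := hν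
      norm_eq' := hν'
      nonneg := hδ
      small := hδ'
      abs_sin_le := hs
      le_cos := hc
      cos_le := by
        have e1 := sq_add_sq_of_norm_eq_one hν
        have e2 := sq_add_sq_of_norm_eq_one hν'
        rw [cosAngle]
        nlinarith [sq_nonneg (ν 0 - ν' 0), sq_nonneg (ν 1 - ν' 1)]
      pos := ht
      large := by linarith
      le_size := by rw [hcast]; linarith
      size_le := by rw [hcast]; linarith }
  rw [← sub_le_iff_le_add]
  obtain ⟨u, hu, -⟩ := exists_admissible_cellEnergy_le hg hβ hK ha₂ hb₂ hν ht
  refine le_csInf ⟨_, u, hu, rfl⟩ ?_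
  rintro _ ⟨v, hv, rfl⟩
  rw [sub_le_iff_le_add]
  exact D.cellInf_le_cellEnergy hg hβ hK ha₁ hb₁ ha₂ hb₂ hv

end Energy

/-! ### Existence and regularity of the limit density -/

/-- A bounded function that is decreasing up to an error `A / t + B * t / T` has a limit. -/
theorem exists_tendsto_of_almost_antitone {F : ℝ → ℝ} {A B C : ℝ}
    (h0 : ∀ t, 0 < t → 0 ≤ F t) (hC : ∀ t, 0 < t → F t ≤ C)
    (hF : ∀ t, 0 < t → ∀ᶠ T in atTop, F T ≤ F t + (A / t + B * t / T)) :
    ∃ l, Tendsto F atTop (𝓝 l) := by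
  have hbdd : IsBoundedUnder (· ≤ ·) atTop F :=
    isBoundedUnder_of_eventually_le ((eventually_gt_atTop 0).mono hC)
  have hbdd' : IsBoundedUnder (· ≥ ·) atTop F :=
    isBoundedUnder_of_eventually_ge ((eventually_gt_atTop 0).mono h0)
  have h1 : ∀ t, 0 < t → limsup F atTop ≤ F t + A / t := fun t ht => by
    have hg : Tendsto (fun T : ℝ => F t + (A / t + B * t / T)) atTop (𝓝 (F t + (A / t + 0))) :=
      tendsto_const_nhds.add (tendsto_const_nhds.add (tendsto_const_nhds.div_atTop tendsto_id))
    have := limsup_le_limsup (hF t ht) hbdd'.isCoboundedUnder_le hg.isBoundedUnder_le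
    rwa [hg.limsup_eq, add_zero] at this
  have h2 : limsup F atTop ≤ liminf F atTop := by
    have hg : Tendsto (fun t : ℝ => limsup F atTop - A / t) atTop (𝓝 (limsup F atTop - 0)) :=
      tendsto_const_nhds.sub (tendsto_const_nhds.div_atTop tendsto_id)
    have := liminf_le_liminf (u := fun t : ℝ => limsup F atTop - A / t) (v := F)
      ((eventually_gt_atTop (0 : ℝ)).mono fun t ht => by
        have := h1 t ht
        show limsup F atTop - A / t ≤ F t
        linarith) hg.isBoundedUnder_ge hbdd.isCoboundedUnder_ge
    rwa [hg.liminf_eq, sub_zero] at this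
  exact ⟨_, tendsto_of_le_liminf_of_limsup_le le_rfl h2 hbdd hbdd'⟩

section Limit

variable {f : E3 → Mat3 → ℝ} {β : ℝ} {M : Set E3} {K : ℝ≥0}

theorem sinAngle_self (ν : E2) : sinAngle ν ν = 0 := by
  simp only [sinAngle]; ring

theorem cosAngle_self {ν : E2} (hν : ‖ν‖ = 1) : cosAngle ν ν = 1 := by
  rw [← sq_add_sq_of_norm_eq_one hν]; simp only [cosAngle]; ring

/-- The limit defining the jump density exists. -/
theorem tendsto_cellInf_theta (hg : IsCellIntegrand (recession f) β) (hβ : 0 ≤ β)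
    (hK : ∀ a ∈ M, ∀ b ∈ M, LipJoined M (K * nndist a b) a b) {a b : E3} (ha : a ∈ M) (hb : b ∈ M)
    {ν : E2} (hν : ‖ν‖ = 1) :
    Tendsto (fun t : ℝ => cellInf f M a b ν t) atTop (𝓝 (theta f M a b ν)) := by
  obtain ⟨l, hl⟩ := exists_tendsto_of_almost_antitone (F := fun t : ℝ => cellInf f M a b ν t)
    (A := 42 * β * K * ‖a - b‖ * 15) (B := 42 * β * K * ‖a - b‖ * 5) (C := 42 * β * K * ‖a - b‖)
    (fun t ht => cellInf_nonneg hg a b ν ht)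
    (fun t ht => cellInf_le_mul_norm hg hβ hK ha hb hν ht)
    (fun t ht => by
      filter_upwards [eventually_ge_atTop (8 * spacing 0 t)] with T hT
      have := cellInf_le_cellInf_add hg hβ hK ha hb ha hb hν hν le_rfl (by norm_num)
        (by rw [sinAngle_self, abs_zero]) (by rw [cosAngle_self hν, sub_zero]) ht hT
      refine this.trans (le_of_eq ?_)
      rw [sub_self, sub_self, norm_zero]
      ring)
  exact tendsto_nhds_limUnder ⟨_, hl⟩

theorem theta_le_mul_norm (hg : IsCellIntegrand (recession f) β) (hβ : 0 ≤ β)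
    (hK : ∀ a ∈ M, ∀ b ∈ M, LipJoined M (K * nndist a b) a b) {a b : E3} (ha : a ∈ M) (hb : b ∈ M)
    {ν : E2} (hν : ‖ν‖ = 1) : theta f M a b ν ≤ 42 * β * K * ‖a - b‖ :=
  le_of_tendsto (tendsto_cellInf_theta hg hβ hK ha hb hν)
    ((eventually_gt_atTop 0).mono fun _ ht => cellInf_le_mul_norm hg hβ hK ha hb hν ht)

/-- The comparison of cells passes to the limit, first in the size of the large cell and then in
the size of the small one. -/
theorem theta_le_theta_add (hg : IsCellIntegrand (recession f) β) (hβ : 0 ≤ β)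
    (hK : ∀ a ∈ M, ∀ b ∈ M, LipJoined M (K * nndist a b) a b) {a₁ b₁ a₂ b₂ : E3}
    (ha₁ : a₁ ∈ M) (hb₁ : b₁ ∈ M) (ha₂ : a₂ ∈ M) (hb₂ : b₂ ∈ M) {ν ν' : E2} (hν : ‖ν‖ = 1)
    (hν' : ‖ν'‖ = 1) {δ : ℝ} (hδ : 0 ≤ δ) (hδ' : δ ≤ 1 / 20) (hs : |sinAngle ν ν'| ≤ δ)
    (hc : 1 - δ ≤ cosAngle ν ν') :
    theta f M a₁ b₁ ν' ≤ theta f M a₂ b₂ ν +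
      42 * β * K * (‖a₂ - b₂‖ * (6 * δ) + 2 * (‖a₁ - a₂‖ + ‖b₁ - b₂‖)) := by
  have h1 : ∀ t, 0 < t → theta f M a₁ b₁ ν' ≤ cellInf f M a₂ b₂ ν t +
      42 * β * K * (‖a₂ - b₂‖ * (6 * δ + 15 / t + 0) + 2 * (‖a₁ - a₂‖ + ‖b₁ - b₂‖)) :=
    fun t ht => by
      refine le_of_tendsto_of_tendsto (tendsto_cellInf_theta hg hβ hK ha₁ hb₁ hν')
        (tendsto_const_nhds.add (tendsto_const_nhds.mul ((tendsto_const_nhds.mul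
          (tendsto_const_nhds.add ((tendsto_const_nhds (x := 5 * t)).div_atTop tendsto_id))).add
          tendsto_const_nhds))) ?_
      filter_upwards [eventually_ge_atTop (8 * spacing δ t)] with T hT
      exact cellInf_le_cellInf_add hg hβ hK ha₁ hb₁ ha₂ hb₂ hν hν' hδ hδ' hs hc ht hT
  have h2 : Tendsto (fun t : ℝ => cellInf f M a₂ b₂ ν t +
      42 * β * K * (‖a₂ - b₂‖ * (6 * δ + 15 / t + 0) + 2 * (‖a₁ - a₂‖ + ‖b₁ - b₂‖))) atTop
      (𝓝 (theta f M a₂ b₂ ν +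
        42 * β * K * (‖a₂ - b₂‖ * (6 * δ + 0 + 0) + 2 * (‖a₁ - a₂‖ + ‖b₁ - b₂‖)))) :=
    (tendsto_cellInf_theta hg hβ hK ha₂ hb₂ hν).add (tendsto_const_nhds.mul
      ((tendsto_const_nhds.mul ((tendsto_const_nhds.add
        ((tendsto_const_nhds (x := (15 : ℝ))).div_atTop tendsto_id)).add tendsto_const_nhds)).add
        tendsto_const_nhds))
  rw [add_zero, add_zero] at h2
  exact ge_of_tendsto h2 ((eventually_gt_atTop 0).mono h1)

/-- The jump density is Lipschitz continuous in the boundary values. -/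
theorem abs_theta_sub_theta_le (hg : IsCellIntegrand (recession f) β) (hβ : 0 ≤ β)
    (hK : ∀ a ∈ M, ∀ b ∈ M, LipJoined M (K * nndist a b) a b) {a₁ b₁ a₂ b₂ : E3}
    (ha₁ : a₁ ∈ M) (hb₁ : b₁ ∈ M) (ha₂ : a₂ ∈ M) (hb₂ : b₂ ∈ M) {ν : E2} (hν : ‖ν‖ = 1) :
    |theta f M a₁ b₁ ν - theta f M a₂ b₂ ν| ≤ 84 * β * K * (‖a₁ - a₂‖ + ‖b₁ - b₂‖) := by
  have hs : |sinAngle ν ν| ≤ 0 := by rw [sinAngle_self, abs_zero]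
  have hc : 1 - 0 ≤ cosAngle ν ν := by rw [cosAngle_self hν, sub_zero]
  have h1 := theta_le_theta_add hg hβ hK ha₁ hb₁ ha₂ hb₂ hν hν le_rfl (by norm_num) hs hc
  have h2 := theta_le_theta_add hg hβ hK ha₂ hb₂ ha₁ hb₁ hν hν le_rfl (by norm_num) hs hc
  rw [norm_sub_rev a₂, norm_sub_rev b₂] at h2
  rw [abs_sub_le_iff]
  constructor <;> linarith

theorem abs_sinAngle_le_norm_sub {ν ν' : E2} (hν : ‖ν‖ = 1) (hν' : ‖ν'‖ = 1) :
    |sinAngle ν ν'| ≤ ‖ν - ν'‖ := by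
  have e1 := sq_add_sq_of_norm_eq_one hν
  have e2 := sq_add_sq_of_norm_eq_one hν'
  rw [EuclideanSpace.norm_eq, Fin.sum_univ_two]
  refine Real.abs_le_sqrt ?_
  simp only [PiLp.sub_apply, Real.norm_eq_abs, sq_abs, sinAngle]
  nlinarith [sq_nonneg (ν 0 * ν' 0 + ν 1 * ν' 1 - 1)]

theorem one_sub_norm_sub_le_cosAngle {ν ν' : E2} (hν : ‖ν‖ = 1) (hν' : ‖ν'‖ = 1)
    (h : ‖ν - ν'‖ ≤ 1) : 1 - ‖ν - ν'‖ ≤ cosAngle ν ν' := by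
  have e1 := sq_add_sq_of_norm_eq_one hν
  have e2 := sq_add_sq_of_norm_eq_one hν'
  have e3 : ‖ν - ν'‖ ^ 2 = 2 - 2 * cosAngle ν ν' := by
    rw [EuclideanSpace.real_norm_sq_eq, Fin.sum_univ_two]
    simp only [PiLp.sub_apply, cosAngle]
    linarith
  nlinarith [norm_nonneg (ν - ν')]

/-- For close directions the error of the comparison of cells is controlled by the distance of the
data; the boundary values range over a bounded set. -/
theorem continuousOn_theta (hg : IsCellIntegrand (recession f) β) (hβ : 0 ≤ β)
    (hMc : IsCompact M) (hK : ∀ a ∈ M, ∀ b ∈ M, LipJoined M (K * nndist a b) a b) :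
    ContinuousOn (fun p : E3 × E3 × E2 => theta f M p.1 p.2.1 p.2.2)
      (M ×ˢ M ×ˢ Metric.sphere (0 : E2) 1) := by
  obtain ⟨R, hR⟩ := hMc.isBounded.exists_norm_le
  rintro ⟨a, b, ν⟩ ⟨ha, hb, hν⟩
  rw [mem_sphere_zero_iff_norm] at hν
  have hB : 0 ≤ 42 * β * K := by positivity
  have hdist : ∀ a ∈ M, ∀ b ∈ M, ‖a - b‖ ≤ 2 * R := fun a ha b hb =>
    (norm_sub_le a b).trans (by linarith [hR a ha, hR b hb])
  let e : E3 × E3 × E2 → ℝ := fun p =>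
    42 * β * K * (2 * R * (6 * ‖ν - p.2.2‖) + 2 * (‖a - p.1‖ + ‖b - p.2.1‖))
  have he : Continuous e := by fun_prop
  have he0 : e (a, b, ν) = 0 := by simp [e]
  refine tendsto_iff_dist_tendsto_zero.2 (squeeze_zero' (Eventually.of_forall fun _ => dist_nonneg)
    (?_ : ∀ᶠ p in 𝓝[_] (a, b, ν), _ ≤ e p) ?_)
  · have hcl : ∀ᶠ p : E3 × E3 × E2 in 𝓝[M ×ˢ M ×ˢ Metric.sphere (0 : E2) 1] (a, b, ν),
        ‖ν - p.2.2‖ < 1 / 20 := by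
      have hc : Continuous fun p : E3 × E3 × E2 => ‖ν - p.2.2‖ := by fun_prop
      refine nhdsWithin_le_nhds (hc.continuousAt.eventually_lt continuousAt_const ?_)
      simp
    filter_upwards [hcl, self_mem_nhdsWithin]
    rintro ⟨a', b', ν'⟩ hlt ⟨ha', hb', hν'⟩
    rw [mem_sphere_zero_iff_norm] at hν'
    change ‖ν - ν'‖ < 1 / 20 at hlt
    have h1 := theta_le_theta_add hg hβ hK ha' hb' ha hb hν hν' (norm_nonneg _) hlt.le
      (abs_sinAngle_le_norm_sub hν hν') (one_sub_norm_sub_le_cosAngle hν hν' (by linarith))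
    rw [norm_sub_rev ν] at hlt
    have h2 := theta_le_theta_add hg hβ hK ha hb ha' hb' hν' hν (norm_nonneg _) hlt.le
      (abs_sinAngle_le_norm_sub hν' hν) (one_sub_norm_sub_le_cosAngle hν' hν (by linarith))
    rw [norm_sub_rev ν'] at h2
    rw [norm_sub_rev a', norm_sub_rev b'] at h1
    have h3 : ∀ c ∈ M, ∀ d ∈ M,
        42 * β * K * (‖c - d‖ * (6 * ‖ν - ν'‖) + 2 * (‖a - a'‖ + ‖b - b'‖)) ≤ e (a', b', ν') :=
      fun c hc d hd => by
        have := hdist c hc d hd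
        dsimp only [e]
        gcongr
    have h4 := h3 a ha b hb
    have h5 := h3 a' ha' b' hb'
    show |theta f M a' b' ν' - theta f M a b ν| ≤ _
    rw [abs_sub_le_iff]
    constructor <;> linarith
  · have := he.tendsto (a, b, ν)
    rw [he0] at this
    exact this.mono_left nhdsWithin_le_nhds

end Limit

end ThinFilm

theorem mainTheorem3 (M : Set E3) (hM : IsSmoothSubmanifold M) (hMc : IsCompact M)
    (hMconn : IsConnected M) (f : E3 → Mat3 → ℝ) (hf : IsCaratheodory f)
    (h1 : IsPlanarPeriodic f) (h2 : HasLinearGrowth f) (h3 : IsUniformlyLipschitz f)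
    (h4 : HasRecessionRate f) :
    -- the infima are over non-empty classes and the limit defining the jump density exists
    (∀ a ∈ M, ∀ b ∈ M, ∀ ν ∈ Metric.sphere (0 : E2) 1,
      (∀ t : ℝ, 0 < t → (admissible M a b ν t).Nonempty) ∧
      Tendsto (fun t : ℝ => cellInf f M a b ν t) atTop (𝓝 (theta f M a b ν))) ∧
    ContinuousOn (fun p : E3 × E3 × E2 => theta f M p.1 p.2.1 p.2.2)
      (M ×ˢ M ×ˢ Metric.sphere (0 : E2) 1) ∧
    ∃ C₁ C₂ : ℝ, 0 < C₁ ∧ 0 < C₂ ∧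
      (∀ a₁ ∈ M, ∀ b₁ ∈ M, ∀ a₂ ∈ M, ∀ b₂ ∈ M, ∀ ν ∈ Metric.sphere (0 : E2) 1,
        |theta f M a₁ b₁ ν - theta f M a₂ b₂ ν| ≤ C₁ * (‖a₁ - a₂‖ + ‖b₁ - b₂‖)) ∧
      (∀ a ∈ M, ∀ b ∈ M, ∀ ν ∈ Metric.sphere (0 : E2) 1,
        theta f M a b ν ≤ C₂ * ‖a - b‖) := by
  obtain ⟨β, hβ, hg⟩ := isCellIntegrand_recession hf h1 h2 h3 h4
  obtain ⟨K, hK⟩ := exists_uniform_lipJoined hM hMc hMconn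
  have hB : 0 ≤ β * K := by positivity
  refine ⟨fun a ha b hb ν hν => ?_, continuousOn_theta hg hβ.le hMc hK,
    84 * β * K + 1, 42 * β * K + 1, by linarith, by linarith,
    fun a₁ ha₁ b₁ hb₁ a₂ ha₂ b₂ hb₂ ν hν => ?_, fun a ha b hb ν hν => ?_⟩
  all_goals rw [mem_sphere_zero_iff_norm] at hν
  · refine ⟨fun t ht => ?_, tendsto_cellInf_theta hg hβ.le hK ha hb hν⟩
    obtain ⟨u, hu, -⟩ := exists_admissible_cellEnergy_le hg hβ.le hK ha hb hν ht
    exact ⟨u, hu⟩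
  · refine (abs_theta_sub_theta_le hg hβ.le hK ha₁ hb₁ ha₂ hb₂ hν).trans ?_
    gcongr
    linarith
  · refine (theta_le_mul_norm hg hβ.le hK ha hb hν).trans ?_
    gcongr
    linarith
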